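/- **Setting.** Let $S$ be a set with a distinguished element $0\in S$, and let $R\subseteq S$ be a subset (which may or may not contain $0$). *Polygons.* For $n\ge 1$ and $a_1,\dots,a_{n+1}\in R$ let $\pi=[a_1,\dots,a_{n+1}]$ be the oriented convex $(n+1)$-gon whose sides, in linear order, are decorated by $a_1,\dots,a_{n+1}$, the last side being the root side; the first vertex is the one between the root side and the first side, and $\chi(\pi)=n$ is the weight. An arrow goes from a vertex to (the interior of) a side not incident with it; it is backward if its end precedes its beginning in the linear order of the sides, and forward otherwise. Arrows with the same starting vertex and the same end side are identified. A dissection $D$ of $\pi$ is a (possibly empty) set of arrows which pairwise do not intersect, except possibly in a common starting vertex. The regions of $D$ are the vertices of its dual tree, rooted at the region containing the first vertex and part of the root side. Contracting arrows turns each region into an $R$-decorated polygon: the root region keeps the root side and the orientation of $\pi$; a region lying just below an arrow $\alpha$ (on the side away from the root) gets as its root side the one on which $\alpha$ ends, with the orientation of $\pi$ if $\alpha$ is forward and the opposite one if $\alpha$ is backward. Put $\operatorname{sgn}(D)=\prod_{\alpha\in D\text{ backward}}(-1)^{\chi(\pi_{D,\alpha})}$, where $\pi_{D,\alpha}$ is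 the polygon of the region just below $\alpha$. *The elements $B(\pi)$.* Let $V$ be the $\mathbb Q$-vector space with basis the $R$-decorated polygons (of positive weight), and let $T(V)=\bigoplus_{i\ge 0}V^{\otimes i}$, with the shuffle product, the deconcatenation coproduct and the projection to $V^{\otimes 0}=\mathbb Q$ as counit. This is the degree-zero part of the bar construction of the polygon algebra (the exterior algebra of $V$). Put $$B(\pi)=\sum_{D}\operatorname{sgn}(D)\sum_{\lambda}\big[\pi_D^{\lambda(1)}\,|\cdots|\,\pi_D^{\lambda(m)}\big]\in T(V),$$ where $D$ runs through all dissections of $\pi$, $m=|D|+1$ is its number of regions, and $\lambda$ runs through the linear orders on the polygons $\pi_D^i$ of the regions of $D$ which are compatible with the dual tree (root first). Let $\langle B(\pi)\rangle\subseteq T(V)$ be the subalgebra generated by all the $B(\pi)$. *Iterated integrals.* Let $\mathcal I_\bullet(S)$ be the commutative $\mathbb Q$-algebra generated by symbols $I(a_0;a_1,\dots,a_n;a_{n+1})$, $n\ge 0$, $a_i\in S$, subject to the relations $I(a;b)=1$, $$I(a_0;a_1,\dots,a_n;a_{n+1})=\sum_{k=0}^n I(a_0;a_1,\dots,a_k;x)\,I(x;a_{k+1},\dots,a_n;a_{n+1})\quad(x\in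 S),$$ $$I(a_{n+1};a_n,\dots,a_1;a_0)=(-1)^nI(a_0;a_1,\dots,a_n;a_{n+1}).$$ It is a bialgebra with Goncharov's coproduct $$\Delta I(a_0;a_1,\dots,a_n;a_{n+1})=\sum_{0=i_0<i_1<\dots<i_r<i_{r+1}=n+1} I(a_0;a_{i_1},\dots,a_{i_r};a_{n+1})\otimes\prod_{k=0}^r I(a_{i_k};a_{i_k+1},\dots,a_{i_{k+1}-1};a_{i_{k+1}})$$ and the counit that vanishes on the generators with $n\ge1$. **Theorem.** The coproduct of $T(V)$ restricts to $\langle B(\pi)\rangle$, i.e. $\langle B(\pi)\rangle$ has a coalgebra structure for which its inclusion into $T(V)$ is a map of coalgebras. There is a unique homomorphism of $\mathbb Q$-algebras $$\varphi:\langle B(\pi)\rangle\longrightarrow \mathcal I_\bullet(S)$$ that satisfies $\varphi\big(B([a_1,\dots,a_{n+1}])\big)=I(0;a_1,\dots,a_n;a_{n+1})$ for all $n\ge1$ and $a_1,\dots,a_{n+1}\in R$ and is a map of coalgebras, i.e. is compatible with coproducts and counits. -/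

import Mathlib

open scoped TensorProduct

noncomputable section

namespace PolyBar

/-! ## Sums over the deconcatenations of a word -/

section Words

variable {α M : Type*} [AddCommMonoid M]

/-- `∑ φ u v` over all the ways to write `w = u ++ v`. -/
def cutSum (φ : List α → List α → M) (w : List α) : M :=
  ∑ k ∈ Finset.range (w.length + 1), φ (w.take k) (w.drop k)

theorem cutSum_nil (φ : List α → List α → M) : cutSum φ [] = φ [] [] := by
  simp [cutSum]

theorem cutSum_cons (φ : List α → List α → M) (x : α) (w : List α) :
    cutSum φ (x :: w) = φ [] (x :: w) + cutSum (fun u v => φ (x :: u) v) w := by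
  simp only [cutSum, List.length_cons]
  rw [Finset.sum_range_succ', add_comm]
  simp

theorem cutSum_snoc (φ : List α → List α → M) (y : α) (w : List α) :
    cutSum φ (w ++ [y]) = cutSum (fun u v => φ u (v ++ [y])) w + φ (w ++ [y]) [] := by
  induction w generalizing φ with
  | nil => simp [cutSum_nil, cutSum_cons]
  | cons x w ih => simp only [List.cons_append, cutSum_cons, ih, add_assoc]

theorem cutSum_add (φ ψ : List α → List α → M) (w : List α) :
    cutSum (fun u v => φ u v + ψ u v) w = cutSum φ w + cutSum ψ w := by
  simp [cutSum, Finset.sum_add_distrib]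

theorem cutSum_assoc (φ : List α → List α → List α → M) (w : List α) :
    cutSum (fun u v => cutSum (fun p q => φ p q v) u) w
      = cutSum (fun u v => cutSum (fun p q => φ u p q) v) w := by
  induction w generalizing φ with
  | nil => simp [cutSum_nil]
  | cons x w ih => simp only [cutSum_cons, cutSum_nil, cutSum_add, ih, add_assoc]

theorem map_cutSum {N F : Type*} [AddCommMonoid N] [FunLike F M N] [AddMonoidHomClass F M N]
    (f : F) (φ : List α → List α → M) (w : List α) :
    f (cutSum φ w) = cutSum (fun u v => f (φ u v)) w := by
  simp [cutSum, map_sum]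

end Words

theorem cutSum_mul_left {α X : Type*} [CommRing X] (c : X) (φ : List α → List α → X)
    (w : List α) : cutSum (fun u v => c * φ u v) w = c * cutSum φ w := by
  simp [cutSum, Finset.mul_sum]

/-! ## The shuffle algebra with its deconcatenation coproduct -/

/-- The tensor coalgebra `T(V) = ⨁ V^{⊗ i}` over `ℚ` on the vector space `V` with basis `α`: it has
the words in `α` as a basis, the word `[x₁, …, xₖ]` being `x₁ | ⋯ | xₖ`. -/
def Shuf (α : Type*) : Type _ := List α →₀ ℚ

namespace Shuf

variable {α : Type*}

instance : AddCommGroup (Shuf α) := inferInstanceAs (AddCommGroup (List α →₀ ℚ))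
instance : Module ℚ (Shuf α) := inferInstanceAs (Module ℚ (List α →₀ ℚ))

/-- The word `x₁ | ⋯ | xₖ`. -/
def word (w : List α) : Shuf α := Finsupp.single w (1 : ℚ)

/-- The words form a basis. -/
def basis (α : Type*) : Module.Basis (List α) ℚ (Shuf α) := ⟨LinearEquiv.refl ℚ (List α →₀ ℚ)⟩

theorem basis_apply (w : List α) : basis α w = word w := rfl

/-- Prefixing all the words with a letter. -/
def consL (x : α) : Shuf α →ₗ[ℚ] Shuf α := (basis α).constr ℚ fun w => word (x :: w)

theorem consL_word (x : α) (w : List α) : consL x (word w) = word (x :: w) := by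
  rw [consL, ← basis_apply w, Module.Basis.constr_basis]

/-- The shuffle product of two words. -/
def shuffle : List α → List α → Shuf α
  | [], v => word v
  | x :: u, [] => word (x :: u)
  | x :: u, y :: v => consL x (shuffle u (y :: v)) + consL y (shuffle (x :: u) v)

theorem shuffle_nil (u : List α) : shuffle u [] = word u := by
  cases u <;> simp [shuffle]

/-- The shuffle product, bilinearly extended. -/
def mulL : Shuf α →ₗ[ℚ] Shuf α →ₗ[ℚ] Shuf α :=
  (basis α).constr ℚ fun u => (basis α).constr ℚ fun v => shuffle u v

instance : Mul (Shuf α) := ⟨fun f g => mulL f g⟩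
instance : One (Shuf α) := ⟨word []⟩

theorem mul_def (f g : Shuf α) : f * g = mulL f g := rfl
theorem one_def : (1 : Shuf α) = word [] := rfl

theorem word_mul_word (u v : List α) : word u * word v = shuffle u v := by
  rw [mul_def, mulL, ← basis_apply u, Module.Basis.constr_basis, ← basis_apply v,
    Module.Basis.constr_basis]

theorem induction_word {p : Shuf α → Prop} (f : Shuf α) (hw : ∀ w, p (word w))
    (hadd : ∀ f g, p f → p g → p (f + g)) (hsmul : ∀ (c : ℚ) f, p f → p (c • f)) : p f := by
  have h := (basis α).mem_span f
  induction h using Submodule.span_induction with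
  | mem x hx => obtain ⟨w, rfl⟩ := hx; exact hw w
  | zero => simpa using hsmul 0 _ (hw [])
  | add x y _ _ hx hy => exact hadd _ _ hx hy
  | smul c x _ hx => exact hsmul c x hx

theorem shuffle_comm (u v : List α) : shuffle u v = shuffle v u := by
  induction u generalizing v with
  | nil => rw [shuffle_nil, shuffle]
  | cons x u ihu =>
    induction v with
    | nil => rw [shuffle_nil, shuffle]
    | cons y v ihv => rw [shuffle, shuffle, ihu, ihv, add_comm]

private theorem mul_add' (f g h : Shuf α) : f * (g + h) = f * g + f * h := by
  simp [mul_def]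

private theorem add_mul' (f g h : Shuf α) : (f + g) * h = f * h + g * h := by
  simp [mul_def]

private theorem smul_mul' (c : ℚ) (f g : Shuf α) : (c • f) * g = c • (f * g) := by
  simp [mul_def]

private theorem mul_smul' (c : ℚ) (f g : Shuf α) : f * (c • g) = c • (f * g) := by
  simp [mul_def]

private theorem mul_comm' (f g : Shuf α) : f * g = g * f := by
  induction f using induction_word with
  | hw u =>
    induction g using induction_word with
    | hw v => rw [word_mul_word, word_mul_word, shuffle_comm]
    | hadd a b ha hb => rw [mul_add', add_mul', ha, hb]
    | hsmul c a ha => rw [mul_smul', smul_mul', ha]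
  | hadd a b ha hb => rw [mul_add', add_mul', ha, hb]
  | hsmul c a ha => rw [mul_smul', smul_mul', ha]

private theorem one_mul' (f : Shuf α) : 1 * f = f := by
  induction f using induction_word with
  | hw v => rw [one_def, word_mul_word, shuffle]
  | hadd a b ha hb => rw [mul_add', ha, hb]
  | hsmul c a ha => rw [mul_smul', ha]

private theorem consL_mul_consL (x y : α) (f g : Shuf α) :
    consL x f * consL y g = consL x (f * consL y g) + consL y (consL x f * g) := by
  induction f using induction_word with
  | hw u =>
    induction g using induction_word with
    | hw v => simp only [consL_word, word_mul_word, shuffle]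
    | hadd a b ha hb => simp only [map_add, mul_add', ha, hb]; abel
    | hsmul c a ha => simp only [map_smul, mul_smul', ha, smul_add]
  | hadd a b ha hb => simp only [map_add, add_mul', ha, hb]; abel
  | hsmul c a ha => simp only [map_smul, smul_mul', ha, smul_add]

private theorem mul_assoc_word (u v w : List α) :
    word u * word v * word w = word u * (word v * word w) := by
  induction u generalizing v w with
  | nil => rw [← one_def, one_mul', one_mul']
  | cons x u ihu =>
    induction v generalizing w with
    | nil => rw [← one_def, one_mul', mul_comm' _ 1, one_mul']
    | cons y v ihv =>
      induction w with
      | nil => rw [← one_def, mul_comm' _ 1, one_mul', mul_comm' _ 1, one_mul']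
      | cons z w ihw =>
        have ihu' : ∀ f g : Shuf α, word u * f * g = word u * (f * g) := by
          intro f g
          induction f using induction_word with
          | hw v =>
            induction g using induction_word with
            | hw w => exact ihu v w
            | hadd a b ha hb => simp only [mul_add', ha, hb]
            | hsmul c a ha => simp only [mul_smul', ha]
          | hadd a b ha hb => simp only [mul_add', add_mul', ha, hb]
          | hsmul c a ha => simp only [mul_smul', smul_mul', ha]
        have h1 := ihv (z :: w)
        have h2 := ihw
        simp only [← consL_word] at h1 h2 ⊢
        have e1 : consL x (word u) * consL y (word v)
            = consL x (word u * consL y (word v)) + consL y (consL x (word u) * word v) :=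
          consL_mul_consL _ _ _ _
        have e2 : consL y (word v) * consL z (word w)
            = consL y (word v * consL z (word w)) + consL z (consL y (word v) * word w) :=
          consL_mul_consL _ _ _ _
        rw [e1] at h2
        rw [e2]
        rw [e1, add_mul', mul_add']
        simp only [consL_mul_consL]
        rw [add_mul'] at h2
        rw [h1, ihu', e2]
        simp only [mul_add', map_add]
        have h3 := congrArg (consL z) h2
        simp only [map_add] at h3
        rw [← sub_eq_zero] at h3 ⊢
        rw [← h3]
        abel

private theorem mul_assoc' (f g h : Shuf α) : f * g * h = f * (g * h) := by
  induction f using induction_word with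
  | hw u =>
    induction g using induction_word with
    | hw v =>
      induction h using induction_word with
      | hw w => exact mul_assoc_word u v w
      | hadd a b ha hb => simp only [mul_add', ha, hb]
      | hsmul c a ha => simp only [mul_smul', ha]
    | hadd a b ha hb => simp only [mul_add', add_mul', ha, hb]
    | hsmul c a ha => simp only [mul_smul', smul_mul', ha]
  | hadd a b ha hb => simp only [add_mul', ha, hb]
  | hsmul c a ha => simp only [smul_mul', ha]

/-- The commutative ring structure given by the shuffle product; its unit is the empty word. -/
instance : CommRing (Shuf α) :=
  { (inferInstance : AddCommGroup (Shuf α)) with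
    mul := (· * ·)
    one := 1
    mul_assoc := mul_assoc'
    one_mul := one_mul'
    mul_one := fun f => by rw [mul_comm', one_mul']
    left_distrib := mul_add'
    right_distrib := add_mul'
    mul_comm := mul_comm'
    zero_mul := fun f => by simp [mul_def]
    mul_zero := fun f => by simp [mul_def] }

instance : Algebra ℚ (Shuf α) := Algebra.ofModule smul_mul' mul_smul'

/-- The deconcatenation coproduct
`x₁ | ⋯ | xₙ ↦ ∑ₖ (x₁ | ⋯ | xₖ) ⊗ (xₖ₊₁ | ⋯ | xₙ)`, `0 ≤ k ≤ n`. -/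
def comulL : Shuf α →ₗ[ℚ] Shuf α ⊗[ℚ] Shuf α :=
  (basis α).constr ℚ fun w => cutSum (fun u v => word u ⊗ₜ[ℚ] word v) w

/-- The counit: the coefficient of the empty word. -/
def counitL : Shuf α →ₗ[ℚ] ℚ := (basis α).constr ℚ fun w => if w = [] then 1 else 0

theorem comulL_word (w : List α) :
    comulL (word w) = cutSum (fun u v => word u ⊗ₜ[ℚ] word v) w := by
  rw [comulL, ← basis_apply w, Module.Basis.constr_basis]

theorem counitL_word (w : List α) : counitL (word w) = if w = [] then 1 else 0 := by
  rw [counitL, ← basis_apply w, Module.Basis.constr_basis]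

private theorem cutSum_counit_left {M : Type*} [AddCommMonoid M] [Module ℚ M]
    (φ : List α → M) (w : List α) :
    cutSum (fun u v => (if u = [] then (1 : ℚ) else 0) • φ v) w = φ w := by
  cases w with
  | nil => simp [cutSum_nil]
  | cons x w => rw [cutSum_cons]; simp [cutSum]

private theorem cutSum_counit_right {M : Type*} [AddCommMonoid M] [Module ℚ M]
    (φ : List α → M) (w : List α) :
    cutSum (fun u v => (if v = [] then (1 : ℚ) else 0) • φ u) w = φ w := by
  induction w generalizing φ with
  | nil => simp [cutSum_nil]
  | cons x w ih => rw [cutSum_cons, ih (fun u => φ (x :: u))]; simp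

instance : Coalgebra ℚ (Shuf α) where
  comul := comulL
  counit := counitL
  coassoc := by
    refine (basis α).ext fun w => ?_
    simp only [basis_apply, LinearMap.comp_apply, LinearEquiv.coe_coe, comulL_word, map_cutSum,
      LinearMap.rTensor_tmul, LinearMap.lTensor_tmul]
    have hL : ∀ u v : List α, (TensorProduct.assoc ℚ (Shuf α) (Shuf α) (Shuf α))
        (cutSum (fun p q => word p ⊗ₜ[ℚ] word q) u ⊗ₜ[ℚ] word v)
        = cutSum (fun p q => word p ⊗ₜ[ℚ] (word q ⊗ₜ[ℚ] word v)) u := by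
      intro u v
      simp [cutSum, TensorProduct.sum_tmul]
    have hR : ∀ u v : List α, word u ⊗ₜ[ℚ] cutSum (fun p q => word p ⊗ₜ[ℚ] word q) v
        = cutSum (fun p q => word u ⊗ₜ[ℚ] (word p ⊗ₜ[ℚ] word q)) v := by
      intro u v
      simp [cutSum, TensorProduct.tmul_sum]
    simp only [hL, hR]
    exact cutSum_assoc (fun p q r => word p ⊗ₜ[ℚ] (word q ⊗ₜ[ℚ] word r)) w
  rTensor_counit_comp_comul := by
    refine (basis α).ext fun w => ?_
    simp only [basis_apply, LinearMap.comp_apply, comulL_word, map_cutSum,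
      LinearMap.rTensor_tmul, counitL_word, TensorProduct.mk_apply]
    rw [← cutSum_counit_left (fun v => (1 : ℚ) ⊗ₜ[ℚ] word v) w]
    simp only [TensorProduct.smul_tmul', smul_eq_mul, mul_one]
  lTensor_counit_comp_comul := by
    refine (basis α).ext fun w => ?_
    simp only [basis_apply, LinearMap.comp_apply, comulL_word, map_cutSum,
      LinearMap.lTensor_tmul, counitL_word, TensorProduct.mk_apply, LinearMap.flip_apply]
    rw [← cutSum_counit_right (fun v => word v ⊗ₜ[ℚ] (1 : ℚ)) w]
    simp only [← TensorProduct.tmul_smul, smul_eq_mul, mul_one]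

end Shuf

/-! ## The Hopf algebra of formal iterated integrals -/

section Splittings

variable {S : Type*}

/-- All the ways to select a subsequence of a word `w`: the pair `(u, [(s₁, v₁), …, (sᵣ, vᵣ)])`
stands for `w = u ++ s₁ :: v₁ ++ ⋯ ++ sᵣ :: vᵣ` with `(s₁, …, sᵣ)` selected; the list has one entry
for each of the `2 ^ w.length` (possibly empty) sets of selected positions. -/
def splits : List S → List (List S × List (S × List S))
  | [] => [([], [])]
  | x :: w =>
      (splits w).map (fun p => (x :: p.1, p.2)) ++ (splits w).map (fun p => ([], (x, p.1) :: p.2))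

variable {X : Type*} [CommRing X]

/-- The product `g(a; u; s₁) g(s₁; v₁; s₂) ⋯ g(sᵣ; vᵣ; b)` over the gaps of a selected
subsequence. -/
def gapProd (g : S → List S → S → X) : S → List S → List (S × List S) → S → X
  | a, u, [], b => g a u b
  | a, u, (s, v) :: m, b => g a u s * gapProd g s v m b

/-- An auxiliary recursive form of the sum over selected subsequences. -/
def selSum (g : S → List S → S → X) (F : List S → X) (e : List S → S → X) (h : List S → X)
    (k : S → List S → X) : List S → List S → X
  | u, [] => F [] * h u
  | u, x :: w => selSum g F e h k (u ++ [x]) w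
      + e u x * selSum g (fun l => F (x :: l)) (g x) (k x) k [] w

variable (g : S → List S → S → X)

/-- The case in which the first gap is like the others. -/
def selSumAt (F : List S → X) (k : S → List S → X) (a : S) (u w : List S) : X :=
  selSum g F (g a) (k a) k u w

theorem selSumAt_nil (F : List S → X) (k : S → List S → X) (a : S) (u : List S) :
    selSumAt g F k a u [] = F [] * k a u := by
  rw [selSumAt, selSum]

theorem selSumAt_cons (F : List S → X) (k : S → List S → X) (a : S) (u : List S) (x : S)
    (w : List S) : selSumAt g F k a u (x :: w) = selSumAt g F k a (u ++ [x]) w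
      + g a u x * selSumAt g (fun l => F (x :: l)) k x [] w := by
  rw [selSumAt, selSum]; rfl

theorem selSumAt_eq (F : List S → X) (a : S) (u w : List S) (b : S) :
    selSumAt g F (fun s v => g s v b) a u w
      = ((splits w).map fun p => F (p.2.map Prod.fst) * gapProd g a (u ++ p.1) p.2 b).sum := by
  induction w generalizing F a u with
  | nil => simp [selSumAt_nil, splits, gapProd]
  | cons x w ih =>
    rw [selSumAt_cons, ih, ih, splits, List.map_append, List.sum_append, List.map_map,
      List.map_map, ← List.sum_map_mul_left]
    congr 2
    · simp [Function.comp_def]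
    · refine List.map_congr_left fun p _ => ?_
      simp only [Function.comp_def, List.map_cons, List.append_nil, gapProd, List.nil_append]
      ring

theorem selSumAt_add (F F' : List S → X) (k : S → List S → X) (a : S) (u w : List S) :
    selSumAt g (fun l => F l + F' l) k a u w = selSumAt g F k a u w + selSumAt g F' k a u w := by
  induction w generalizing F F' a u with
  | nil => simp only [selSumAt_nil]; ring
  | cons x w ih => simp only [selSumAt_cons, ih]; ring

theorem selSumAt_mul (c : X) (F : List S → X) (k : S → List S → X) (a : S) (u w : List S) :
    selSumAt g (fun l => c * F l) k a u w = c * selSumAt g F k a u w := by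
  induction w generalizing F a u with
  | nil => simp only [selSumAt_nil]; ring
  | cons x w ih => simp only [selSumAt_cons, ih]; ring

theorem selSumAt_zero (k : S → List S → X) (a : S) (u w : List S) :
    selSumAt g (fun _ => 0) k a u w = 0 := by
  induction w generalizing a u with
  | nil => simp [selSumAt_nil]
  | cons x w ih => simp [selSumAt_cons, ih]

theorem map_selSumAt {Y T : Type*} [CommRing Y] [FunLike T X Y] [RingHomClass T X Y] (f : T)
    (F : List S → X) (k : S → List S → X) (a : S) (u w : List S) :
    f (selSumAt g F k a u w)
      = selSumAt (fun a u b => f (g a u b)) (fun l => f (F l)) (fun a u => f (k a u)) a u w := by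
  induction w generalizing F a u with
  | nil => simp only [selSumAt_nil, map_mul]
  | cons x w ih => simp only [selSumAt_cons, map_add, map_mul, ih]

theorem selSumAt_snoc (F : List S → X) (k : S → List S → X) (a : S) (u w : List S) (y : S) :
    selSumAt g F k a u (w ++ [y]) = selSumAt g F (fun s v => k s (v ++ [y])) a u w
      + selSumAt g (fun l => F (l ++ [y])) (fun s v => g s v y) a u w * k y [] := by
  induction w generalizing F a u with
  | nil => simp only [List.nil_append, selSumAt_cons, selSumAt_nil]; ring
  | cons x w ih =>
    simp only [List.cons_append, selSumAt_cons, ih]; ring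

theorem selSumAt_reverse (F : List S → X) (a b : S) (r w : List S) :
    selSumAt g F (fun s v => g s (v ++ r) b) a [] w
      = selSumAt (fun s v t => g t v.reverse s) (fun l => F l.reverse)
          (fun s v => g a v.reverse s) b r.reverse w.reverse := by
  induction w using List.reverseRecOn generalizing F b r with
  | nil => simp [selSumAt_nil]
  | append_singleton w y ih =>
    rw [selSumAt_snoc, List.reverse_append, List.reverse_singleton, List.singleton_append,
      selSumAt_cons]
    have h1 := ih F b (y :: r)
    have h2 := ih (fun l => F (l ++ [y])) y []
    simp only [List.append_assoc, List.singleton_append, List.append_nil, List.reverse_cons,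
      List.reverse_nil, List.reverse_reverse, List.nil_append] at h1 h2 ⊢
    rw [h1, h2]
    ring

theorem selSumAt_sign (F : List S → X) (k : S → List S → X) (a : S) (u w : List S) :
    selSumAt (fun s v t => (-1) ^ v.length * g s v t) (fun l => (-1) ^ l.length * F l)
        (fun s v => (-1) ^ v.length * k s v) a u w
      = (-1) ^ (u.length + w.length) * selSumAt g F k a u w := by
  induction w generalizing F a u with
  | nil => simp only [selSumAt_nil, List.length_nil]; ring
  | cons x w ih =>
    have h := ih (fun l => F (x :: l)) x []
    have h' := selSumAt_mul (fun s v t => (-1) ^ v.length * g s v t) (-1)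
      (fun l => (-1) ^ l.length * F (x :: l)) (fun s v => (-1) ^ v.length * k s v) x [] w
    have e : (fun l : List S => (-1 : X) ^ (x :: l).length * F (x :: l))
        = fun l => -1 * ((-1) ^ l.length * F (x :: l)) := by
      funext l; rw [List.length_cons, pow_succ]; ring
    simp only [selSumAt_cons, ih F]
    rw [e, h', h]
    simp only [List.length_append, List.length_cons, List.length_nil]
    ring

/-- Compatibility of sums over subsequences with path composition. -/
theorem selSumAt_path_aux (x b : S)
    (hg : ∀ a u s, g a u s = cutSum (fun v v' => g a v x * g x v' s) u)
    (Φ : List S → List S → X) (a : S) (u w : List S) :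
    selSumAt g (fun l => cutSum Φ l) (fun s v => g s v b) a u w
        + g a u x * selSumAt g (Φ []) (fun s v => g s v b) x [] w
      = cutSum (fun v v' => g a v x * selSumAt g (Φ []) (fun s v => g s v b) x v' w) u
        + cutSum (fun w₁ w₂ => selSumAt g
            (fun l => selSumAt g (Φ l) (fun s v => g s v b) x [] w₂)
            (fun s v => g s v x) a u w₁) w := by
  induction w generalizing Φ a u with
  | nil =>
    simp only [selSumAt_nil, cutSum_nil]
    have : cutSum (fun v v' => g a v x * (Φ [] [] * g x v' b)) u = Φ [] [] * g a u b := by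
      rw [hg a u b, ← cutSum_mul_left]
      congr 1; funext v v'; ring
    rw [this]; ring
  | cons y w ih =>
    have ih1 := ih Φ a (u ++ [y])
    have ih2 := ih (fun l l' => Φ (y :: l) l') y []
    rw [cutSum_snoc] at ih1
    rw [cutSum_nil] at ih2
    have e : cutSum (fun v v' => g a v x * selSumAt g (Φ []) (fun s v => g s v b) x v' (y :: w)) u
        = cutSum (fun v v' => g a v x
            * selSumAt g (Φ []) (fun s v => g s v b) x (v' ++ [y]) w) u
          + g a u y * selSumAt g (fun l => Φ [] (y :: l)) (fun s v => g s v b) y [] w := by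
      rw [hg a u y, mul_comm (cutSum _ u), ← cutSum_mul_left, ← cutSum_add]
      congr 1; funext v v'
      rw [selSumAt_cons]; ring
    rw [e, cutSum_cons]
    simp only [selSumAt_cons, selSumAt_nil, cutSum_cons, selSumAt_add, cutSum_add,
      cutSum_mul_left]
    linear_combination ih1 + g a u y * ih2

theorem selSumAt_path (x b : S)
    (hg : ∀ a u s, g a u s = cutSum (fun v v' => g a v x * g x v' s) u)
    (F₁ F₂ : List S → X) (a : S) (w : List S) :
    selSumAt g (fun l => cutSum (fun l₁ l₂ => F₁ l₁ * F₂ l₂) l) (fun s v => g s v b) a [] w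
      = cutSum (fun w₁ w₂ => selSumAt g F₁ (fun s v => g s v x) a [] w₁
          * selSumAt g F₂ (fun s v => g s v b) x [] w₂) w := by
  have h := selSumAt_path_aux g x b hg (fun l₁ l₂ => F₁ l₁ * F₂ l₂) a [] w
  rw [cutSum_nil, add_comm] at h
  rw [add_left_cancel h]
  congr 1; funext w₁ w₂
  rw [mul_comm, ← selSumAt_mul]
  congr 1; funext l
  rw [selSumAt_mul, mul_comm]

theorem selSum_add (F : List S → X) (e e' : List S → S → X) (h h' : List S → X)
    (k : S → List S → X) (u w : List S) :
    selSum g F (fun v s => e v s + e' v s) (fun v => h v + h' v) k u w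
      = selSum g F e h k u w + selSum g F e' h' k u w := by
  induction w generalizing u with
  | nil => simp only [selSum]; ring
  | cons x w ih => simp only [selSum, ih]; ring

theorem selSum_mul (c : X) (F : List S → X) (e : List S → S → X) (h : List S → X)
    (k : S → List S → X) (u w : List S) :
    selSum g F (fun v s => c * e v s) (fun v => c * h v) k u w = c * selSum g F e h k u w := by
  induction w generalizing u with
  | nil => simp only [selSum]; ring
  | cons x w ih => simp only [selSum, ih]; ring

theorem selSum_shift (F : List S → X) (e : List S → S → X) (h : List S → X)
    (k : S → List S → X) (r u w : List S) :
    selSum g F e h k (r ++ u) w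
      = selSum g F (fun v s => e (r ++ v) s) (fun v => h (r ++ v)) k u w := by
  induction w generalizing u with
  | nil => simp only [selSum]
  | cons x w ih => simp only [selSum, List.append_assoc, ih]

/-- The sum over nested pairs of subsequences, computed in two ways. -/
theorem selSumAt_assoc_aux (g₂ g₃ : S → List S → S → X) (b : S) (F : List S → X) (c a : S)
    (v u w : List S) :
    selSumAt g₃ (fun l => selSumAt g₂ F (fun s t => g₂ s t b) c v l) (fun s t => g₃ s t b) a u w
      = selSum (fun a' w' b' => selSumAt g₃ (fun l => g₂ a' l b') (fun s t => g₃ s t b') a' [] w')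
          F
          (fun w' b' => selSumAt g₃ (fun l => g₂ c (v ++ l) b') (fun s t => g₃ s t b') a u w')
          (fun w' => selSumAt g₃ (fun l => g₂ c (v ++ l) b) (fun s t => g₃ s t b) a u w')
          (fun a' w' => selSumAt g₃ (fun l => g₂ a' l b) (fun s t => g₃ s t b) a' [] w')
          [] w := by
  induction w generalizing F c a v u with
  | nil => simp only [selSumAt_nil, selSum, List.append_nil]; ring
  | cons y w ih =>
    have h1 := ih F c a v (u ++ [y])
    have h2 := ih F c y (v ++ [y]) []
    have h3 := ih (fun l => F (y :: l)) y y [] []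
    simp only [List.nil_append, List.append_assoc, List.singleton_append] at h1 h2 h3
    have h4 := selSum_shift
      (fun a' w' b' => selSumAt g₃ (fun l => g₂ a' l b') (fun s t => g₃ s t b') a' [] w')
      F (fun w' b' => selSumAt g₃ (fun l => g₂ c (v ++ l) b') (fun s t => g₃ s t b') a u w')
      (fun w' => selSumAt g₃ (fun l => g₂ c (v ++ l) b) (fun s t => g₃ s t b) a u w')
      (fun a' w' => selSumAt g₃ (fun l => g₂ a' l b) (fun s t => g₃ s t b) a' [] w')
      [y] [] w
    simp only [List.singleton_append] at h4
    rw [selSum, List.nil_append, h4]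
    simp only [selSumAt_cons, selSumAt_add, selSumAt_mul, selSum_add, selSum_mul, selSumAt_nil,
      List.append_nil]
    rw [h1, h2, h3]
    ring

theorem selSumAt_assoc (g₂ g₃ : S → List S → S → X) (b : S) (F : List S → X) (a : S)
    (w : List S) :
    selSumAt g₃ (fun l => selSumAt g₂ F (fun s t => g₂ s t b) a [] l) (fun s t => g₃ s t b) a [] w
      = selSumAt
          (fun a' w' b' => selSumAt g₃ (fun l => g₂ a' l b') (fun s t => g₃ s t b') a' [] w') F
          (fun a' w' => selSumAt g₃ (fun l => g₂ a' l b) (fun s t => g₃ s t b) a' [] w')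
          a [] w := by
  rw [selSumAt_assoc_aux]; rfl

theorem selSumAt_counit_left (k : S → List S → X) (a : S) (u w : List S) :
    selSumAt g (fun l => if l = [] then 1 else 0) k a u w = k a (u ++ w) := by
  induction w generalizing a u with
  | nil => simp [selSumAt_nil]
  | cons x w ih => simp [selSumAt_cons, ih, selSumAt_zero]

theorem selSumAt_counit_right (F : List S → X) (a : S) (u w : List S) :
    selSumAt (fun _ v _ => if v = [] then 1 else 0) F (fun _ v => if v = [] then 1 else 0) a u w
      = if u = [] then F w else 0 := by
  induction w generalizing F a u with
  | nil => simp [selSumAt_nil]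
  | cons x w ih => simp [selSumAt_cons, ih]

end Splittings

/-- Sanity check on the number of selected subsequences. -/
theorem length_splits {S : Type*} (w : List S) : (splits w).length = 2 ^ w.length := by
  induction w with
  | nil => rfl
  | cons x w ih => simp [splits, ih, pow_succ]; ring

/-- The free commutative `ℚ`-algebra on the symbols `I(a₀; a₁, …, aₙ; aₙ₊₁)` with all `aᵢ ∈ S`,
encoded as `(a₀, [a₁, …, aₙ], aₙ₊₁)`. -/
abbrev FreeIter (S : Type*) : Type _ := MvPolynomial (S × List S × S) ℚ

namespace FreeIter

/-- The generator `I(a; w; b)`. -/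
def gen {S : Type*} (a : S) (w : List S) (b : S) : FreeIter S := MvPolynomial.X (a, w, b)

/-- The ideal generated by the unit identities `I(a; b) = 1`, the path composition formulas
`I(a; s₁, …, sₙ; b) = ∑ₖ I(a; s₁, …, sₖ; x) I(x; sₖ₊₁, …, sₙ; b)` and the inversion formulas
`I(b; sₙ, …, s₁; a) = (-1)ⁿ I(a; s₁, …, sₙ; b)`. -/
def relIdeal (S : Type*) : Ideal (FreeIter S) :=
  Ideal.span
    ({p | ∃ a b : S, p = gen a [] b - 1} ∪
      {p | ∃ (a b x : S) (w : List S), p = gen a w b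
        - ∑ k ∈ Finset.range (w.length + 1), gen a (w.take k) x * gen x (w.drop k) b} ∪
      {p | ∃ (a b : S) (w : List S), p = gen b w.reverse a - (-1) ^ w.length * gen a w b})

end FreeIter

/-- The commutative algebra of formal iterated integrals: generators `I(a₀; a₁, …, aₙ; aₙ₊₁)` with
all `aᵢ ∈ S`, subject to the unit identities, path composition and inversion formulas. -/
def IterInt (S : Type*) : Type _ := FreeIter S ⧸ FreeIter.relIdeal S

namespace IterInt

variable {S : Type*}

instance : CommRing (IterInt S) := inferInstanceAs (CommRing (FreeIter S ⧸ FreeIter.relIdeal S))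
instance : Algebra ℚ (IterInt S) :=
  inferInstanceAs (Algebra ℚ (FreeIter S ⧸ FreeIter.relIdeal S))

/-- The quotient map. -/
def mk : FreeIter S →ₐ[ℚ] IterInt S := Ideal.Quotient.mkₐ ℚ (FreeIter.relIdeal S)

/-- The element `I(a; w; b)`. -/
def I (a : S) (w : List S) (b : S) : IterInt S := mk (FreeIter.gen a w b)

theorem mk_surjective : Function.Surjective (mk (S := S)) := Ideal.Quotient.mk_surjective

theorem mk_eq_zero {p : FreeIter S} (hp : p ∈ FreeIter.relIdeal S) : mk p = 0 :=
  Ideal.Quotient.eq_zero_iff_mem.mpr hp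

theorem I_nil (a b : S) : I a [] b = 1 := by
  have h : mk (FreeIter.gen a [] b - 1) = 0 :=
    mk_eq_zero (Ideal.subset_span (Or.inl (Or.inl ⟨a, b, rfl⟩)))
  rw [map_sub, map_one, sub_eq_zero] at h
  exact h

theorem I_path (a b x : S) (w : List S) : I a w b = cutSum (fun u v => I a u x * I x v b) w := by
  have h := mk_eq_zero (S := S)
    (Ideal.subset_span (Or.inl (Or.inr ⟨a, b, x, w, rfl⟩)))
  rw [map_sub, sub_eq_zero, map_sum] at h
  simp only [map_mul] at h
  exact h

theorem I_reverse (a b : S) (w : List S) : I b w.reverse a = (-1) ^ w.length * I a w b := by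
  have h := mk_eq_zero (S := S) (Ideal.subset_span (Or.inr ⟨a, b, w, rfl⟩))
  rw [map_sub, sub_eq_zero, map_mul, map_pow, map_neg, map_one] at h
  exact h

/-- Algebra maps out of `IterInt S`. -/
def lift {B : Type*} [CommRing B] [Algebra ℚ B] (f : S → List S → S → B)
    (h1 : ∀ a b, f a [] b = 1)
    (h2 : ∀ a b x w, f a w b = cutSum (fun u v => f a u x * f x v b) w)
    (h3 : ∀ a b w, f b w.reverse a = (-1) ^ w.length * f a w b) : IterInt S →ₐ[ℚ] B :=
  Ideal.Quotient.liftₐ (FreeIter.relIdeal S)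
    (MvPolynomial.aeval fun s : S × List S × S => f s.1 s.2.1 s.2.2) (by
      intro p hp
      rw [← RingHom.mem_ker]
      revert p
      change FreeIter.relIdeal S ≤ _
      refine Ideal.span_le.mpr ?_
      rintro p ((⟨a, b, rfl⟩ | ⟨a, b, x, w, rfl⟩) | ⟨a, b, w, rfl⟩)
      · simp [FreeIter.gen, RingHom.mem_ker, h1]
      · have := h2 a b x w
        simp [FreeIter.gen, RingHom.mem_ker, sub_eq_zero, map_sum]
        exact this
      · simp [FreeIter.gen, RingHom.mem_ker, h3 a b w])

theorem lift_I {B : Type*} [CommRing B] [Algebra ℚ B] (f : S → List S → S → B)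
    (h1 : ∀ a b, f a [] b = 1)
    (h2 : ∀ a b x w, f a w b = cutSum (fun u v => f a u x * f x v b) w)
    (h3 : ∀ a b w, f b w.reverse a = (-1) ^ w.length * f a w b) (a : S) (w : List S) (b : S) :
    lift f h1 h2 h3 (I a w b) = f a w b := by
  have : lift f h1 h2 h3 (I a w b)
      = MvPolynomial.aeval (fun s : S × List S × S => f s.1 s.2.1 s.2.2) (FreeIter.gen a w b) :=
    rfl
  rw [this, FreeIter.gen, MvPolynomial.aeval_X]

theorem algHom_ext {B : Type*} [CommRing B] [Algebra ℚ B] {f g : IterInt S →ₐ[ℚ] B}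
    (h : ∀ a w b, f (I a w b) = g (I a w b)) : f = g := by
  have h' : f.comp mk = g.comp mk := MvPolynomial.algHom_ext fun s => h s.1 s.2.1 s.2.2
  refine AlgHom.ext fun x => ?_
  obtain ⟨p, rfl⟩ := mk_surjective x
  exact DFunLike.congr_fun h' p

/-- The value of the coproduct on `I(a; w; b)`: the sum, over all subsequences `(s₁, …, sᵣ)` of
`w`, of `I(a; s₁, …, sᵣ; b) ⊗ ∏ₖ I(sₖ; …; sₖ₊₁)`, where `s₀ = a`, `sᵣ₊₁ = b` and the dots
are the letters of `w` between `sₖ` and `sₖ₊₁`. -/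
def comulI (a : S) (w : List S) (b : S) : IterInt S ⊗[ℚ] IterInt S :=
  ((splits w).map fun p => I a (p.2.map Prod.fst) b ⊗ₜ[ℚ] gapProd I a p.1 p.2 b).sum

theorem map_gapProd {X Y T : Type*} [CommRing X] [CommRing Y] [FunLike T X Y] [RingHomClass T X Y]
    (f : T) (g : S → List S → S → X) (a : S) (u : List S) (m : List (S × List S)) (b : S) :
    f (gapProd g a u m b) = gapProd (fun a u b => f (g a u b)) a u m b := by
  induction m generalizing a u with
  | nil => rfl
  | cons p m ih => simp only [gapProd, map_mul, ih]

/-- The left and right copies of a symbol in the tensor square. -/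
def inl (a : S) (w : List S) (b : S) : IterInt S ⊗[ℚ] IterInt S := I a w b ⊗ₜ 1
/-- The right copy. -/
def inr (a : S) (w : List S) (b : S) : IterInt S ⊗[ℚ] IterInt S := 1 ⊗ₜ I a w b

theorem comulI_eq (a : S) (w : List S) (b : S) :
    comulI a w b = selSumAt inr (fun l => inl a l b) (fun s v => inr s v b) a [] w := by
  rw [selSumAt_eq, comulI]
  congr 1
  refine List.map_congr_left fun p _ => ?_
  have h := map_gapProd (Algebra.TensorProduct.includeRight :
    IterInt S →ₐ[ℚ] IterInt S ⊗[ℚ] IterInt S) I a p.1 p.2 b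
  have h' : gapProd (inr (S := S)) a p.1 p.2 b = 1 ⊗ₜ gapProd I a p.1 p.2 b := h.symm
  rw [List.nil_append, h', inl, Algebra.TensorProduct.tmul_mul_tmul, one_mul, mul_one]

private theorem inl_path (a b x : S) (w : List S) :
    inl a w b = cutSum (fun u v => inl a u x * inl x v b) w := by
  have h := congrArg (Algebra.TensorProduct.includeLeft : IterInt S →ₐ[ℚ] IterInt S ⊗[ℚ] IterInt S)
    (I_path a b x w)
  rw [map_cutSum] at h
  simp only [map_mul] at h
  exact h

private theorem inr_path (a b x : S) (w : List S) :
    inr a w b = cutSum (fun u v => inr a u x * inr x v b) w := by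
  have h := congrArg
    (Algebra.TensorProduct.includeRight : IterInt S →ₐ[ℚ] IterInt S ⊗[ℚ] IterInt S)
    (I_path a b x w)
  rw [map_cutSum] at h
  simp only [map_mul] at h
  exact h

private theorem inl_reverse (a b : S) (w : List S) :
    inl b w.reverse a = (-1) ^ w.length * inl a w b := by
  have h := congrArg (Algebra.TensorProduct.includeLeft : IterInt S →ₐ[ℚ] IterInt S ⊗[ℚ] IterInt S)
    (I_reverse a b w)
  simp only [map_mul, map_pow, map_neg, map_one] at h
  exact h

private theorem inr_reverse (a b : S) (w : List S) :
    inr b w.reverse a = (-1) ^ w.length * inr a w b := by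
  have h := congrArg
    (Algebra.TensorProduct.includeRight : IterInt S →ₐ[ℚ] IterInt S ⊗[ℚ] IterInt S)
    (I_reverse a b w)
  simp only [map_mul, map_pow, map_neg, map_one] at h
  exact h

private theorem comulI_nil (a b : S) : comulI a [] b = 1 := by
  simp [comulI, splits, gapProd, I_nil, Algebra.TensorProduct.one_def]

private theorem comulI_path (a b x : S) (w : List S) :
    comulI a w b = cutSum (fun u v => comulI a u x * comulI x v b) w := by
  simp only [comulI_eq]
  rw [← selSumAt_path inr x b (fun a u s => inr_path a s x u)]
  congr 1
  funext l
  exact inl_path a b x l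

private theorem comulI_reverse (a b : S) (w : List S) :
    comulI b w.reverse a = (-1) ^ w.length * comulI a w b := by
  simp only [comulI_eq]
  have h := selSumAt_reverse inr (fun l => inl b l a) b a [] w.reverse
  have h' := selSumAt_sign inr (fun l => inl a l b) (fun s v => inr s v b) a [] w
  simp only [List.append_nil, List.reverse_reverse, List.reverse_nil, inl_reverse a b] at h
  rw [List.length_nil, Nat.zero_add] at h'
  rw [h, ← h']
  congr 1
  · funext s v t; exact inr_reverse s t v
  · funext s v; exact inr_reverse s b v

/-- The coproduct, as an algebra map. -/
def comulHom : IterInt S →ₐ[ℚ] IterInt S ⊗[ℚ] IterInt S :=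
  lift comulI comulI_nil comulI_path comulI_reverse

theorem comulHom_I (a : S) (w : List S) (b : S) : comulHom (I a w b) = comulI a w b :=
  lift_I _ _ _ _ a w b

/-- The counit: it kills the symbols `I(a; w; b)` with `w` non-empty. -/
def counitHom : IterInt S →ₐ[ℚ] ℚ :=
  lift (fun _ w _ => if w = [] then 1 else 0) (fun _ _ => by simp)
    (fun _ _ _ w => by
      cases w with
      | nil => simp [cutSum_nil]
      | cons x w => rw [cutSum_cons]; simp [cutSum])
    (fun _ _ w => by cases w <;> simp)

theorem counitHom_I (a : S) (w : List S) (b : S) :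
    counitHom (I a w b) = if w = [] then 1 else 0 :=
  lift_I _ _ _ _ a w b

instance : Bialgebra ℚ (IterInt S) :=
  Bialgebra.ofAlgHom comulHom counitHom
    (by
      refine algHom_ext fun a w b => ?_
      simp only [AlgHom.comp_apply, comulHom_I]
      let g₁ : S → List S → S → IterInt S ⊗[ℚ] (IterInt S ⊗[ℚ] IterInt S) :=
        fun a w b => I a w b ⊗ₜ (1 ⊗ₜ 1)
      let g₂ : S → List S → S → IterInt S ⊗[ℚ] (IterInt S ⊗[ℚ] IterInt S) :=
        fun a w b => 1 ⊗ₜ (I a w b ⊗ₜ 1)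
      let g₃ : S → List S → S → IterInt S ⊗[ℚ] (IterInt S ⊗[ℚ] IterInt S) :=
        fun a w b => 1 ⊗ₜ (1 ⊗ₜ I a w b)
      let L : IterInt S ⊗[ℚ] IterInt S →ₐ[ℚ] IterInt S ⊗[ℚ] (IterInt S ⊗[ℚ] IterInt S) :=
        (Algebra.TensorProduct.assoc ℚ ℚ ℚ (IterInt S) (IterInt S) (IterInt S)).toAlgHom.comp
          (Algebra.TensorProduct.map comulHom (AlgHom.id ℚ (IterInt S)))
      let R : IterInt S ⊗[ℚ] IterInt S →ₐ[ℚ] IterInt S ⊗[ℚ] (IterInt S ⊗[ℚ] IterInt S) :=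
        Algebra.TensorProduct.map (AlgHom.id ℚ (IterInt S)) comulHom
      change L (comulI a w b) = R (comulI a w b)
      rw [comulI_eq, map_selSumAt, map_selSumAt]
      let A : IterInt S ⊗[ℚ] IterInt S →ₐ[ℚ] IterInt S ⊗[ℚ] (IterInt S ⊗[ℚ] IterInt S) :=
        (Algebra.TensorProduct.assoc ℚ ℚ ℚ (IterInt S) (IterInt S) (IterInt S)).toAlgHom.comp
          Algebra.TensorProduct.includeLeft
      let A' : IterInt S ⊗[ℚ] IterInt S →ₐ[ℚ] IterInt S ⊗[ℚ] (IterInt S ⊗[ℚ] IterInt S) :=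
        Algebra.TensorProduct.includeRight
      have e1 : ∀ a l b, L (inl a l b)
          = selSumAt g₂ (fun l => g₁ a l b) (fun s t => g₂ s t b) a [] l := by
        intro a l b
        have : L (inl a l b) = A (comulI a l b) := by
          simp [L, A, inl, comulHom_I]
        rw [this, comulI_eq, map_selSumAt]
        rfl
      have e2 : ∀ a l b, L (inr a l b) = g₃ a l b := by
        intro a l b
        simp [L, inr, g₃, Algebra.TensorProduct.one_def]
      have e3 : ∀ a l b, R (inl a l b) = g₁ a l b := by
        intro a l b
        simp [R, inl, g₁, Algebra.TensorProduct.one_def]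
      have e4 : ∀ a l b, R (inr a l b)
          = selSumAt g₃ (fun l => g₂ a l b) (fun s t => g₃ s t b) a [] l := by
        intro a l b
        have : R (inr a l b) = A' (comulI a l b) := by
          simp [R, A', inr, comulHom_I]
        rw [this, comulI_eq, map_selSumAt]
        rfl
      simp only [e1, e2, e3, e4]
      exact selSumAt_assoc g₂ g₃ b (fun l => g₁ a l b) a w)
    (by
      refine algHom_ext fun a w b => ?_
      simp only [AlgHom.comp_apply, comulHom_I]
      rw [comulI_eq, map_selSumAt]
      have e1 : ∀ a l b, (Algebra.TensorProduct.map counitHom (AlgHom.id ℚ (IterInt S)))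
          (inl a l b) = if l = [] then 1 else 0 := by
        intro a l b
        by_cases h : l = [] <;> simp [inl, counitHom_I, h, Algebra.TensorProduct.one_def]
      simp only [e1, selSumAt_counit_left]
      simp [inr])
    (by
      refine algHom_ext fun a w b => ?_
      simp only [AlgHom.comp_apply, comulHom_I]
      rw [comulI_eq, map_selSumAt]
      have e1 : ∀ a l b, (Algebra.TensorProduct.map (AlgHom.id ℚ (IterInt S)) counitHom)
          (inr a l b) = if l = [] then 1 else 0 := by
        intro a l b
        by_cases h : l = [] <;> simp [inr, counitHom_I, h, Algebra.TensorProduct.one_def]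
      simp only [e1, selSumAt_counit_right]
      simp [inl])

theorem comul_I (a : S) (w : List S) (b : S) :
    Coalgebra.comul (R := ℚ) (I a w b) = comulI a w b := comulHom_I a w b

theorem counit_I (a : S) (w : List S) (b : S) :
    Coalgebra.counit (R := ℚ) (I a w b) = if w = [] then 1 else 0 := counitHom_I a w b

end IterInt

/-! ## Polygons, arrows and dissections -/

/-- An `R`-decorated polygon with at least two sides: the decorations of the non-root sides in
their linear order, and the decoration of the root side. -/
structure Polygon (R : Type*) where
  /-- the decorations `a₁, …, aₙ` of the non-root sides -/
  sides : List R
  /-- the decoration `aₙ₊₁` of the root side -/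
  root : R
  /-- there is at least one non-root side -/
  sides_ne : sides ≠ []

/-- An arrow `(v, s)` in a polygon with sides `0, …, n` (side `n` being the root side), from vertex
`v` to side `s`. Vertex `0` is the first vertex (between the sides `n` and `0`), and vertex
`v > 0` lies between the sides `v - 1` and `v`. -/
abbrev Arrow : Type := ℕ × ℕ

namespace Arrow

/-- The arrow ends at one of the two sides incident with its starting vertex. -/
abbrev IsTrivial (n : ℕ) (α : Arrow) : Prop := α.2 = α.1 ∨ α.2 + 1 = α.1 ∨ (α.1 = 0 ∧ α.2 = n)

/-- The end of the arrow comes before its beginning in the linear order of the sides. -/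
abbrev IsBackward (α : Arrow) : Prop := α.2 < α.1

/-- Walking along the boundary from the first vertex, one meets vertex `v` at time `2v` and the
middle of side `s` at time `2s + 1`; these are the times of the two end points of `α`. -/
def lo (α : Arrow) : ℕ := min (2 * α.1) (2 * α.2 + 1)
/-- The larger of the two times. -/
def hi (α : Arrow) : ℕ := max (2 * α.1) (2 * α.2 + 1)

/-- Two arrows intersect, other than in a common starting vertex, and cannot be made disjoint by
moving their ends inside the sides: their end points strictly alternate on the boundary. -/
abbrev Cross (α β : Arrow) : Prop :=
  (α.lo < β.lo ∧ β.lo < α.hi ∧ α.hi < β.hi) ∨ (β.lo < α.lo ∧ α.lo < β.hi ∧ β.hi < α.hi)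

/-- The sides lying entirely on the side of `α` which does not contain the first vertex, i.e. the
non-root sides of the polygon cut off by `α` (its root side being the end `α.2`). -/
def cut (α : Arrow) : Finset ℕ :=
  if α.IsBackward then Finset.Ioo α.2 α.1 else Finset.Ico α.1 α.2

/-- The region cut off by `β` lies inside the one cut off by `α` (for distinct non-crossing
arrows): `β` lies below `α`, away from the root, in the dual tree. -/
abbrev Below (β α : Arrow) : Prop := β.cut ⊂ α.cut

end Arrow

/-- The non-trivial arrows in a polygon with `n` non-root sides. -/
def arrows (n : ℕ) : Finset Arrow :=
  (Finset.range (n + 1) ×ˢ Finset.range (n + 1)).filter fun α => ¬ Arrow.IsTrivial n α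

/-- The dissections of a polygon with `n` non-root sides: the sets of pairwise non-intersecting
non-trivial arrows (the empty set gives the dissection with one region). -/
def dissections (n : ℕ) : Finset (Finset Arrow) :=
  (arrows n).powerset.filter fun D => ∀ α ∈ D, ∀ β ∈ D, ¬ Arrow.Cross α β

/-- The trivial arrow from the first vertex to the root side; the region just below it is the root
region. -/
def rootArrow (n : ℕ) : Arrow := (0, n)

/-- The non-root sides of the region of the dissection `D` just below `α` (where `α ∈ D`, or `α` is
the root arrow): what `α` cuts off, without what is cut off by the arrows below `α`. -/
def regionSides (D : Finset Arrow) (α : Arrow) : Finset ℕ :=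
  α.cut.filter fun i => ∀ β ∈ D, β.Below α → i ∉ β.cut

/-- The sign of a dissection: the product of `(-1) ^ χ` over its backward arrows, `χ` being the
weight of the polygon of the region just below the arrow. -/
def dissectionSign (D : Finset Arrow) : ℚ :=
  ∏ α ∈ D, if α.IsBackward then (-1) ^ (regionSides D α).card else 1

/-- The linear orders on the arrows of `D` which are compatible with the dual tree; putting the root
arrow first they are the compatible linear orders on the regions of `D`. -/
def linearOrders (D : Finset Arrow) : Finset (List Arrow) :=
  (⟨D.val.lists, Multiset.lists_nodup_finset D⟩ : Finset (List Arrow)).filter fun l =>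
    l.Pairwise fun α β => ¬ α.Below β

theorem Arrow.mem_cut {α : Arrow} {i : ℕ} :
    i ∈ α.cut ↔ (α.2 < i ∧ i < α.1) ∨ (α.1 ≤ i ∧ i < α.2) := by
  unfold Arrow.cut
  split_ifs with h
  · rw [Finset.mem_Ioo]; unfold Arrow.IsBackward at h; omega
  · rw [Finset.mem_Ico]; unfold Arrow.IsBackward at h; omega

theorem Arrow.card_cut (α : Arrow) : α.cut.card = (α.1 - α.2 - 1) + (α.2 - α.1) := by
  unfold Arrow.cut
  split_ifs with h
  · rw [Nat.card_Ioo]; unfold Arrow.IsBackward at h; omega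
  · rw [Nat.card_Ico]; unfold Arrow.IsBackward at h; omega

theorem Arrow.cross_of_ff {α β : Arrow} (h1 : α.1 < β.1) (h2 : β.1 ≤ α.2) (h3 : α.2 < β.2) :
    α.Cross β := by
  simp only [Arrow.Cross, Arrow.lo, Arrow.hi]; omega

theorem Arrow.cross_of_bb {α β : Arrow} (h1 : α.2 < β.2) (h2 : β.2 < α.1) (h3 : α.1 < β.1) :
    α.Cross β := by
  simp only [Arrow.Cross, Arrow.lo, Arrow.hi]; omega

theorem Arrow.cross_of_bf {α β : Arrow} (h1 : α.2 < β.1) (h2 : β.1 < α.1) (h3 : α.1 ≤ β.2) :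
    α.Cross β := by
  simp only [Arrow.Cross, Arrow.lo, Arrow.hi]; omega

theorem Arrow.cross_of_fb {α β : Arrow} (h1 : β.2 < α.1) (h2 : α.1 < β.1) (h3 : β.1 ≤ α.2) :
    α.Cross β := by
  simp only [Arrow.Cross, Arrow.lo, Arrow.hi]; omega

theorem Arrow.cross_of_fb' {α β : Arrow} (h1 : α.1 ≤ β.2) (h2 : β.2 < α.2) (h3 : α.2 < β.1) :
    α.Cross β := by
  simp only [Arrow.Cross, Arrow.lo, Arrow.hi]; omega

/-- No region of a dissection is reduced to its root side. -/
theorem regionSides_nonempty {n : ℕ} (hn : 0 < n) {D : Finset Arrow} (hD : D ∈ dissections n)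
    {α : Arrow} (hα : α ∈ insert (rootArrow n) D) : (regionSides D α).Nonempty := by
  rw [dissections, Finset.mem_filter, Finset.mem_powerset] at hD
  obtain ⟨hsub, hcr⟩ := hD
  have harr : ∀ β ∈ D, β.1 ≤ n ∧ β.2 ≤ n ∧ ¬ (β.2 = β.1 ∨ β.2 + 1 = β.1 ∨ (β.1 = 0 ∧ β.2 = n)) := by
    intro β hβ
    have := hsub hβ
    rw [arrows, Finset.mem_filter, Finset.mem_product, Finset.mem_range, Finset.mem_range] at this
    exact ⟨by omega, by omega, this.2⟩
  have hα' : α.2 ≠ α.1 ∧ α.2 + 1 ≠ α.1 := by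
    rcases Finset.mem_insert.mp hα with rfl | h
    · simp only [rootArrow]; omega
    · have := harr α h; omega
  have hcr' : ∀ β ∈ D, ¬ Arrow.Cross α β := by
    intro β hβ
    rcases Finset.mem_insert.mp hα with rfl | h
    · have := harr β hβ
      simp only [Arrow.Cross, Arrow.lo, Arrow.hi, rootArrow]; omega
    · exact hcr α h β hβ
  by_contra hne
  rw [Finset.not_nonempty_iff_eq_empty] at hne
  have hcov : ∀ i ∈ α.cut, ∃ β ∈ D, β.Below α ∧ i ∈ β.cut := by
    intro i hi
    by_contra hcon
    push Not at hcon
    have : i ∈ regionSides D α := Finset.mem_filter.mpr ⟨hi, fun β hβ hb => hcon β hβ hb⟩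
    rw [hne] at this
    exact absurd this (Finset.notMem_empty _)
  -- `i₀` is the side of the region farthest from the end of the arrow
  obtain ⟨i₀, hi₀⟩ : ∃ i₀, (α.2 < α.1 ∧ i₀ = α.1 - 1) ∨ (α.1 < α.2 ∧ i₀ = α.1) := by
    by_cases h : α.2 < α.1
    · exact ⟨_, Or.inl ⟨h, rfl⟩⟩
    · exact ⟨_, Or.inr ⟨by omega, rfl⟩⟩
  have hi₀α : i₀ ∈ α.cut := Arrow.mem_cut.mpr (by omega)
  let T : Finset Arrow := D.filter fun β => β.Below α ∧ i₀ ∈ β.cut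
  have hT : T.Nonempty := by
    obtain ⟨β, hβ, h⟩ := hcov i₀ hi₀α
    exact ⟨β, Finset.mem_filter.mpr ⟨hβ, h⟩⟩
  obtain ⟨β, hβT, hmax⟩ := T.exists_max_image (fun β => β.cut.card) hT
  obtain ⟨hβD, hβα, hβi⟩ := Finset.mem_filter.mp hβT
  have hβs : ∀ i, i ∈ β.cut → i ∈ α.cut := fun i h => hβα.1 h
  have hβc := Finset.card_lt_card hβα
  have hβx := hcr' β hβD
  simp only [Arrow.mem_cut] at hβs hβi
  simp only [Arrow.card_cut] at hβc hmax
  have key : (α.1 < α.2 ∧ β.1 = α.1 ∧ β.1 < β.2 ∧ β.2 < α.2) ∨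
      (α.2 < α.1 ∧ β.1 = α.1 ∧ β.2 < β.1 ∧ α.2 < β.2) := by
    rcases hi₀ with ⟨h, rfl⟩ | ⟨h, rfl⟩ <;> rcases hβi with h' | h'
    · have h1 := hβs (β.1 - 1) (by omega)
      omega
    · have h1 := hβs β.1 (by omega)
      have h2 := hβs (β.2 - 1) (by omega)
      exact (hβx (Arrow.cross_of_bf (by omega) (by omega) (by omega))).elim
    · have h1 := hβs (β.2 + 1) (by omega)
      have h2 := hβs (β.1 - 1) (by omega)
      by_cases h3 : β.2 + 1 = α.1
      · exact (hβx (Arrow.cross_of_fb (by omega) (by omega) (by omega))).elim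
      · omega
    · have h1 := hβs β.1 (by omega)
      have h2 := hβs (β.2 - 1) (by omega)
      omega
  obtain ⟨γ, hγD, hγα, hγi⟩ := hcov β.2 (Arrow.mem_cut.mpr (by omega))
  have hγs : ∀ i, i ∈ γ.cut → i ∈ α.cut := fun i h => hγα.1 h
  have hγx := hcr β hβD γ hγD
  have hγx' := hcr γ hγD β hβD
  have hm := fun h => hmax γ (Finset.mem_filter.mpr ⟨hγD, hγα, Arrow.mem_cut.mpr h⟩)
  simp only [Arrow.mem_cut] at hγs hγi
  clear hβs hmax hβc hβx hβi
  rcases key with ⟨k1, k2, k3, k4⟩ | ⟨k1, k2, k3, k4⟩ <;> rcases hγi with h' | h'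
  · have h1 := hγs (γ.2 + 1) (by omega)
    by_cases h3 : γ.2 + 1 = α.1
    · have := hm (by omega)
      omega
    · exact hγx (Arrow.cross_of_fb' (by omega) (by omega) (by omega))
  · have h1 := hγs γ.1 (by omega)
    by_cases h3 : γ.1 = α.1
    · have := hm (by omega)
      omega
    · exact hγx (Arrow.cross_of_ff (by omega) (by omega) (by omega))
  · have h1 := hγs (γ.1 - 1) (by omega)
    by_cases h3 : γ.1 = α.1
    · have := hm (by omega)
      omega
    · exact hγx' (Arrow.cross_of_bb (by omega) (by omega) (by omega))
  · have h1 := hγs (γ.2 - 1) (by omega)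
    by_cases h3 : γ.2 = α.1
    · have := hm (by omega)
      omega
    · exact hγx' (Arrow.cross_of_fb' (by omega) (by omega) (by omega))

namespace Polygon

variable {R : Type*}

/-- The weight: the number of non-root sides. -/
def weight (π : Polygon R) : ℕ := π.sides.length

/-- The decoration of side `i`, for `i ≤ π.weight`; side `π.weight` is the root side. -/
def deco (π : Polygon R) (i : ℕ) : R := π.sides.getD i π.root

/-- The polygon associated to the region of `D` just below `α`, obtained by contracting the arrows
in its boundary: its root side is the one where `α` ends, and its orientation is the one of `π` if
`α` is forward, and the opposite one if `α` is backward. (The last case of the definition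
does not occur for `α` as above, by `regionSides_nonempty`.) -/
def region (π : Polygon R) (D : Finset Arrow) (α : Arrow) : Polygon R :=
  let l := (regionSides D α).sort (· ≤ ·)
  let l' := (if α.IsBackward then l.reverse else l).map π.deco
  if h : l' ≠ [] then ⟨l', π.deco α.2, h⟩ else π

/-- The element `B(π) = ∑_D sgn(D) ∑_λ [π_D^{λ(1)} | ⋯ | π_D^{λ(n)}]` of the degree zero part of the
bar construction of the polygon algebra. That part is the tensor coalgebra `T(V)` on the vector
space `V` with basis the `R`-decorated polygons (polygons have bar degree `0`, products of two or
more polygons positive degree), with the (unsigned) shuffle product and the deconcatenation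
coproduct. -/
def B (π : Polygon R) : Shuf (Polygon R) :=
  ∑ D ∈ dissections π.weight, dissectionSign D •
    ∑ l ∈ linearOrders D, Shuf.word ((rootArrow π.weight :: l).map (π.region D))

/-- The algebra generated by the elements `B(π)`. -/
def cocycleAlgebra (R : Type*) : Subalgebra ℚ (Shuf (Polygon R)) :=
  Algebra.adjoin ℚ (Set.range B)

/-- The generator `B(π)` of `cocycleAlgebra R`. -/
def cocycle (π : Polygon R) : cocycleAlgebra R := ⟨π.B, Algebra.subset_adjoin ⟨π, rfl⟩⟩

end Polygon

end PolyBar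

end

noncomputable section

namespace PolyBar

/-! ### The shuffle algebra: first letters and the bialgebra structure. -/

namespace Shuf

variable {α : Type*}

/-! The point is that the `B(π)` obey the formal rules of the iterated integrals `I(0; a₁, …, aₙ;
aₙ₊₁)`, Goncharov's coproduct included, and are moreover algebraically independent. An algebra map
out of `⟨B(π)⟩` is then the same as an arbitrary choice of values on the `B(π)`, which gives
existence and uniqueness of `φ`, and compatibility with coproducts has to be compared on generators
only.

The rules come from cutting up dissections. The sides of the root region form a non-empty
subsequence of the sides of `π`, and the arrows fall into independent groups, one for each gap
between consecutive selected sides. In a gap all the outermost arrows start at one vertex: at most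
one goes back to the side before the gap and at most one goes forward to the side after it. The
forward group is a copy of some `B(π')`. The backward group is a reflected copy, and reflection
exchanges forward and backward arrows, so it costs `(-1)` to the total weight. Summing over the
vertex gives `∑ (-1)^|u| E(u.reverse; a) E(v; b)` over `w = u ++ v`, which is the expression of
`I(a; w; b)` through integrals from the base point (`formalI`, `gapSum_eq_formalI`). Independent
groups of arrows multiply under the shuffle product because their linear orders are shuffled
(`orderSum_union`). Hence the recursion `B_eq_selSumOp`: `B(π)` is a sum, over the non-empty
subsequences of sides, of one letter prefixed to a product of `formalI` over the gaps.

Prefixing a letter `x` satisfies `Δ(x|f) = 1 ⊗ x|f + (x| ⊗ id) Δ f`. Applying this to the recursion,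
and by induction Goncharov's formula to the shorter gaps, leaves a sum over nested subsequences.
Exchanging the two summations is the combinatorics of coassociativity, and yields Goncharov's
formula for `B(π)` (`comul_formalEnd`).

Algebraic independence is a triangularity argument. Removing a first letter `π₀` is a derivation of
the shuffle algebra, and on the `B(π)` of weight at most that of `π₀` it acts as the partial
derivative with respect to `B(π₀)` (`headL_aeval_B`). A relation of minimal degree could therefore
be differentiated to a smaller one.

The base point is a separate element `none` of `Option R`, whether or not it lies in `R`; it is sent
to the distinguished element of `S` only in the final comparison. -/

theorem consL_mul_consL_eq (x y : α) (f g : Shuf α) :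
    consL x f * consL y g = consL x (f * consL y g) + consL y (consL x f * g) := by
  induction f using induction_word with
  | hw u =>
    induction g using induction_word with
    | hw v => simp only [consL_word, word_mul_word, shuffle]
    | hadd a b ha hb => simp only [map_add, mul_add, ha, hb]; abel
    | hsmul c a ha => simp only [map_smul, mul_smul_comm, ha, smul_add]
  | hadd a b ha hb => simp only [map_add, add_mul, ha, hb]; abel
  | hsmul c a ha => simp only [map_smul, smul_mul_assoc, ha, smul_add]

/-- Simultaneous induction on two elements, following the recursion for the shuffle product. -/
theorem induction_word₂ {p : Shuf α → Shuf α → Prop} (f g : Shuf α)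
    (hnil : ∀ g, p 1 g) (hnil' : ∀ f, p f 1)
    (hcons : ∀ x y u v, p (word u) (word (y :: v)) → p (word (x :: u)) (word v) →
      p (word (x :: u)) (word (y :: v)))
    (hadd : ∀ f f' g, p f g → p f' g → p (f + f') g) (hsmul : ∀ (c : ℚ) f g, p f g → p (c • f) g)
    (hadd' : ∀ f g g', p f g → p f g' → p f (g + g'))
    (hsmul' : ∀ (c : ℚ) f g, p f g → p f (c • g)) : p f g := by
  have hw : ∀ u v, p (word u) (word v) := by
    intro u
    induction u with
    | nil => exact fun v => hnil _
    | cons x u ihu =>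
      intro v
      induction v with
      | nil => exact hnil' _
      | cons y v ihv => exact hcons x y u v (ihu _) ihv
  induction f using induction_word with
  | hw u =>
    induction g using induction_word with
    | hw v => exact hw u v
    | hadd a b ha hb => exact hadd' _ _ _ ha hb
    | hsmul c a ha => exact hsmul' _ _ _ ha
  | hadd a b ha hb => exact hadd _ _ _ ha hb
  | hsmul c a ha => exact hsmul _ _ _ ha

/-! ### The coproduct and the counit are algebra maps -/

theorem comulL_one : comulL (1 : Shuf α) = 1 := by
  rw [one_def, comulL_word, cutSum_nil]; rfl

/-- A word is cut either before its first letter or after it. This cocycle identity is the only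
property of deconcatenation used for the coproduct of the `B(π)`. -/
theorem comulL_consL (x : α) (f : Shuf α) :
    comulL (consL x f) = 1 ⊗ₜ consL x f + TensorProduct.map (consL x) LinearMap.id (comulL f) := by
  induction f using induction_word with
  | hw u =>
    rw [consL_word, comulL_word, comulL_word, cutSum_cons, map_cutSum]
    simp only [TensorProduct.map_tmul, consL_word, LinearMap.id_apply]
    rfl
  | hadd a b ha hb => simp only [map_add, TensorProduct.tmul_add, ha, hb]; abel
  | hsmul c a ha => simp only [map_smul, TensorProduct.tmul_smul, ha, smul_add]

theorem map_consL_mul_one_tmul (x : α) (X : Shuf α ⊗[ℚ] Shuf α) (b : Shuf α) :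
    TensorProduct.map (consL x) LinearMap.id (X * 1 ⊗ₜ b)
      = TensorProduct.map (consL x) LinearMap.id X * 1 ⊗ₜ b := by
  induction X with
  | zero => simp
  | add X Y hX hY => simp only [add_mul, map_add, hX, hY]
  | tmul u v => simp [Algebra.TensorProduct.tmul_mul_tmul]

theorem map_consL_mul_map_consL (x y : α) (X Y : Shuf α ⊗[ℚ] Shuf α) :
    TensorProduct.map (consL x) LinearMap.id X * TensorProduct.map (consL y) LinearMap.id Y
      = TensorProduct.map (consL x) LinearMap.id
          (X * TensorProduct.map (consL y) LinearMap.id Y)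
        + TensorProduct.map (consL y) LinearMap.id
          (TensorProduct.map (consL x) LinearMap.id X * Y) := by
  induction X with
  | zero => simp
  | add X X' hX hX' => simp only [add_mul, map_add, hX, hX']; abel
  | tmul u v =>
    induction Y with
    | zero => simp
    | add Y Y' hY hY' => simp only [mul_add, map_add, hY, hY']; abel
    | tmul u' v' =>
      simp only [TensorProduct.map_tmul, Algebra.TensorProduct.tmul_mul_tmul, LinearMap.id_apply,
        consL_mul_consL_eq, TensorProduct.add_tmul]

/-- Both sides satisfy the recursion of the shuffle product: split each coproduct according to
whether the first letter stays on the left. -/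
theorem comulL_mul (f g : Shuf α) : comulL (f * g) = comulL f * comulL g := by
  induction f, g using induction_word₂ with
  | hnil g => rw [one_mul, comulL_one, one_mul]
  | hnil' f => rw [mul_one, comulL_one, mul_one]
  | hcons x y u v h1 h2 =>
    simp only [← consL_word] at h1 h2 ⊢
    rw [consL_mul_consL_eq, map_add, comulL_consL, comulL_consL, h1, h2, comulL_consL,
      comulL_consL, mul_add, add_mul, add_mul, mul_add, mul_add, map_add, map_add,
      map_consL_mul_one_tmul, map_consL_mul_map_consL, mul_comm (1 ⊗ₜ consL x (word u)) (comulL _),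
      map_consL_mul_one_tmul, Algebra.TensorProduct.tmul_mul_tmul, one_mul, consL_mul_consL_eq,
      TensorProduct.tmul_add, mul_comm (1 ⊗ₜ consL x (word u)) (TensorProduct.map _ _ _)]
    abel
  | hadd f f' g h h' => simp only [add_mul, map_add, h, h']
  | hsmul c f g h => simp only [smul_mul_assoc, map_smul, h]
  | hadd' f g g' h h' => simp only [mul_add, map_add, h, h']
  | hsmul' c f g h => simp only [mul_smul_comm, map_smul, h]

/-- The deconcatenation coproduct as an algebra map. -/
def comulHom : Shuf α →ₐ[ℚ] Shuf α ⊗[ℚ] Shuf α :=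
  AlgHom.ofLinearMap comulL comulL_one comulL_mul

theorem counitL_consL (x : α) (f : Shuf α) : counitL (consL x f) = 0 := by
  induction f using induction_word with
  | hw u => rw [consL_word, counitL_word, if_neg (List.cons_ne_nil _ _)]
  | hadd a b ha hb => simp only [map_add, ha, hb, add_zero]
  | hsmul c a ha => simp only [map_smul, ha, smul_zero]

theorem counitL_one : counitL (1 : Shuf α) = 1 := by
  rw [one_def, counitL_word, if_pos rfl]

theorem counitL_mul (f g : Shuf α) : counitL (f * g) = counitL f * counitL g := by
  induction f, g using induction_word₂ with
  | hnil g => rw [one_mul, counitL_one, one_mul]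
  | hnil' f => rw [mul_one, counitL_one, mul_one]
  | hcons x y u v h1 h2 =>
    simp only [← consL_word]
    rw [consL_mul_consL_eq, map_add, counitL_consL, counitL_consL, counitL_consL, zero_mul,
      add_zero]
  | hadd f f' g h h' => simp only [add_mul, map_add, h, h']
  | hsmul c f g h => simp only [smul_mul_assoc, map_smul, h]
  | hadd' f g g' h h' => simp only [mul_add, map_add, h, h']
  | hsmul' c f g h => simp only [mul_smul_comm, map_smul, h]

/-- The counit as an algebra map. -/
def counitHom : Shuf α →ₐ[ℚ] ℚ := AlgHom.ofLinearMap counitL counitL_one counitL_mul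

/-! ### Removing the first letter is a derivation -/

open Classical in
/-- The linear map removing the first letter `z` from a word, and killing the words with another
first letter. -/
def headL (z : α) : Shuf α →ₗ[ℚ] Shuf α :=
  (basis α).constr ℚ fun w => match w with
    | [] => 0
    | x :: w => if x = z then word w else 0

theorem headL_one (z : α) : headL z 1 = 0 := by
  rw [one_def, headL, ← basis_apply, Module.Basis.constr_basis]

open Classical in
theorem headL_word_cons (z x : α) (w : List α) :
    headL z (word (x :: w)) = if x = z then word w else 0 := by
  rw [headL, ← basis_apply (x :: w), Module.Basis.constr_basis]

open Classical in
theorem headL_consL (z x : α) (f : Shuf α) : headL z (consL x f) = if x = z then f else 0 := by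
  induction f using induction_word with
  | hw u => rw [consL_word, headL_word_cons]
  | hadd a b ha hb => rw [map_add, map_add, ha, hb]; split_ifs <;> simp
  | hsmul c a ha => rw [map_smul, map_smul, ha]; split_ifs <;> simp

/-- The first letter of a shuffle is the first letter of one of the two factors, so the Leibniz rule
is the shuffle recursion itself. -/
theorem headL_mul (z : α) (f g : Shuf α) : headL z (f * g) = f * headL z g + g * headL z f := by
  induction f, g using induction_word₂ with
  | hnil g => rw [one_mul, headL_one, one_mul, mul_zero, add_zero]
  | hnil' f => rw [mul_one, headL_one, one_mul, mul_zero, zero_add]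
  | hcons x y u v h1 h2 =>
    simp only [← consL_word]
    rw [consL_mul_consL_eq, map_add]
    simp only [headL_consL]
    split_ifs <;> simp [mul_comm, add_comm]
  | hadd f f' g h h' => simp only [add_mul, map_add, mul_add, h, h']; abel
  | hsmul c f g h => simp only [smul_mul_assoc, map_smul, mul_smul_comm, h, smul_add]
  | hadd' f g g' h h' => simp only [add_mul, map_add, mul_add, h, h']; abel
  | hsmul' c f g h => simp only [smul_mul_assoc, map_smul, mul_smul_comm, h, smul_add]

end Shuf

/-! ## Sums over the compatible linear orders -/

section LinearOrders

variable {X : Type*}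

theorem mem_linearOrders {D : Finset Arrow} {l : List Arrow} :
    l ∈ linearOrders D ↔ D.val = (l : Multiset Arrow) ∧ l.Pairwise fun α β => ¬ α.Below β := by
  rw [linearOrders, Finset.mem_filter, Finset.mem_mk, Multiset.mem_lists_iff]
  rfl

/-- The sum of the words of letters `ℓ α` over the compatible linear orders on `D`. -/
def orderSum (ℓ : Arrow → X) (D : Finset Arrow) : Shuf X :=
  ∑ l ∈ linearOrders D, Shuf.word (l.map ℓ)

/-- The arrows of `D` not lying below another one. -/
def topArrows (D : Finset Arrow) : Finset Arrow := D.filter fun α => ∀ β ∈ D, ¬ α.Below β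

theorem orderSum_empty (ℓ : Arrow → X) : orderSum ℓ ∅ = 1 := by
  have : linearOrders ∅ = {[]} := by
    ext l
    rw [mem_linearOrders, Finset.mem_singleton, Finset.empty_val, eq_comm, Multiset.coe_eq_zero]
    constructor
    · exact fun h => h.1
    · rintro rfl; exact ⟨rfl, List.Pairwise.nil⟩
  rw [orderSum, this, Finset.sum_singleton]; rfl

theorem cons_mem_linearOrders {D : Finset Arrow} {α : Arrow} {l : List Arrow} :
    α :: l ∈ linearOrders D ↔ α ∈ topArrows D ∧ l ∈ linearOrders (D.erase α) := by
  rw [mem_linearOrders, mem_linearOrders, topArrows, Finset.mem_filter, List.pairwise_cons]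
  constructor
  · rintro ⟨h, h1, h2⟩
    have hα : α ∈ D := by rw [← Finset.mem_val, h]; simp
    refine ⟨⟨hα, fun β hβ => ?_⟩, ?_, h2⟩
    · rw [← Finset.mem_val, h, Multiset.mem_coe, List.mem_cons] at hβ
      rcases hβ with rfl | hβ
      · exact fun hb => (ssubset_irrefl _ hb)
      · exact h1 β hβ
    · rw [Finset.erase_val, h, ← Multiset.cons_coe, Multiset.erase_cons_head]
  · rintro ⟨⟨hα, h1⟩, h, h2⟩
    have hv : D.val = ((α :: l : List Arrow) : Multiset Arrow) := by
      rw [← Multiset.cons_coe, ← h, Finset.erase_val, Multiset.cons_erase (Finset.mem_val.mpr hα)]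
    refine ⟨hv, fun β hβ => h1 β ?_, h2⟩
    rw [← Finset.mem_val, hv]; simp [hβ]

/-- A compatible order begins with an arrow lying below no other, and the rest is a compatible order
of what remains. All later facts on these sums follow from this recursion. -/
theorem orderSum_eq (ℓ : Arrow → X) {D : Finset Arrow} (hD : D.Nonempty) :
    orderSum ℓ D = ∑ α ∈ topArrows D, Shuf.consL (ℓ α) (orderSum ℓ (D.erase α)) := by
  have : linearOrders D = (topArrows D).biUnion
      fun α => (linearOrders (D.erase α)).map ⟨(α :: ·), List.cons_injective⟩ := by
    ext l
    rw [Finset.mem_biUnion]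
    cases l with
    | nil =>
      simp only [Finset.mem_map, Function.Embedding.coeFn_mk, reduceCtorEq, and_false, exists_false,
        iff_false]
      intro h
      rw [mem_linearOrders] at h
      exact hD.ne_empty (Finset.val_eq_zero.mp h.1)
    | cons α l =>
      rw [cons_mem_linearOrders]
      simp only [Finset.mem_map, Function.Embedding.coeFn_mk, List.cons.injEq]
      constructor
      · exact fun h => ⟨α, h.1, l, h.2, rfl, rfl⟩
      · rintro ⟨a, h1, l', h2, rfl, rfl⟩; exact ⟨h1, h2⟩
  rw [orderSum, this, Finset.sum_biUnion]
  · refine Finset.sum_congr rfl fun α _ => ?_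
    rw [Finset.sum_map, orderSum, map_sum]
    refine Finset.sum_congr rfl fun l _ => ?_
    rw [Shuf.consL_word]; rfl
  · intro α _ β _ hne
    rw [Function.onFun, Finset.disjoint_left]
    intro l h1 h2
    obtain ⟨l1, _, rfl⟩ := Finset.mem_map.mp h1
    obtain ⟨l2, _, h⟩ := Finset.mem_map.mp h2
    simp only [Function.Embedding.coeFn_mk, List.cons.injEq] at h
    exact hne h.1.symm

theorem orderSum_congr {ℓ ℓ' : Arrow → X} {D : Finset Arrow} (h : ∀ α ∈ D, ℓ α = ℓ' α) :
    orderSum ℓ D = orderSum ℓ' D := by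
  refine Finset.sum_congr rfl fun l hl => ?_
  rw [mem_linearOrders] at hl
  congr 1
  refine List.map_congr_left fun α hα => h α ?_
  rw [← Finset.mem_val, hl.1]; exact hα

theorem topArrows_union {D E : Finset Arrow}
    (h : ∀ α ∈ D, ∀ β ∈ E, ¬ α.Below β ∧ ¬ β.Below α) :
    topArrows (D ∪ E) = topArrows D ∪ topArrows E := by
  ext α
  simp only [topArrows, Finset.mem_filter, Finset.mem_union]
  constructor
  · rintro ⟨h1 | h1, h2⟩
    · exact Or.inl ⟨h1, fun β hβ => h2 β (Or.inl hβ)⟩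
    · exact Or.inr ⟨h1, fun β hβ => h2 β (Or.inr hβ)⟩
  · rintro (⟨h1, h2⟩ | ⟨h1, h2⟩)
    · refine ⟨Or.inl h1, ?_⟩
      rintro β (hβ | hβ)
      · exact h2 β hβ
      · exact (h α h1 β hβ).1
    · refine ⟨Or.inr h1, ?_⟩
      rintro β (hβ | hβ)
      · exact (h β hβ α h1).2
      · exact h2 β hβ

/-- The linear orders on a union of two unrelated pieces are the shuffles. -/
theorem orderSum_union (ℓ : Arrow → X) {D E : Finset Arrow} (hd : Disjoint D E)
    (h : ∀ α ∈ D, ∀ β ∈ E, ¬ α.Below β ∧ ¬ β.Below α) :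
    orderSum ℓ (D ∪ E) = orderSum ℓ D * orderSum ℓ E := by
  obtain ⟨n, hn⟩ : ∃ n, D.card + E.card = n := ⟨_, rfl⟩
  induction n using Nat.strong_induction_on generalizing D E with
  | _ n ih =>
    rcases D.eq_empty_or_nonempty with rfl | hD
    · rw [Finset.empty_union, orderSum_empty, one_mul]
    rcases E.eq_empty_or_nonempty with rfl | hE
    · rw [Finset.union_empty, orderSum_empty, mul_one]
    have e1 : ∀ α ∈ topArrows D, orderSum ℓ ((D ∪ E).erase α)
        = orderSum ℓ (D.erase α) * orderSum ℓ E := by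
      intro α hα
      have hαD : α ∈ D := (Finset.mem_filter.mp hα).1
      rw [Finset.erase_union_distrib, Finset.erase_eq_of_notMem
        (Finset.disjoint_left.mp hd hαD)]
      refine ih _ ?_ (hd.mono_left (Finset.erase_subset _ _))
        (fun a ha => h a (Finset.mem_of_mem_erase ha)) rfl
      have := Finset.card_erase_lt_of_mem hαD
      omega
    have e2 : ∀ β ∈ topArrows E, orderSum ℓ ((D ∪ E).erase β)
        = orderSum ℓ D * orderSum ℓ (E.erase β) := by
      intro β hβ
      have hβE : β ∈ E := (Finset.mem_filter.mp hβ).1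
      rw [Finset.erase_union_distrib, Finset.erase_eq_of_notMem
        (Finset.disjoint_right.mp hd hβE)]
      refine ih _ ?_ (hd.mono_right (Finset.erase_subset _ _))
        (fun a ha b hb => h a ha b (Finset.mem_of_mem_erase hb)) rfl
      have := Finset.card_erase_lt_of_mem hβE
      omega
    have hdt : Disjoint (topArrows D) (topArrows E) :=
      hd.mono (Finset.filter_subset _ _) (Finset.filter_subset _ _)
    rw [orderSum_eq ℓ (hD.mono Finset.subset_union_left), topArrows_union h,
      Finset.sum_union hdt, Finset.sum_congr rfl fun α hα => congrArg _ (e1 α hα),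
      Finset.sum_congr rfl fun β hβ => congrArg _ (e2 β hβ)]
    conv_rhs => rw [orderSum_eq ℓ hD, orderSum_eq ℓ hE, Finset.sum_mul_sum]
    -- The shuffle recursion gives two double sums, by the origin of the first letter. In each of
    -- them the other factor is reassembled by reading `orderSum_eq` backwards.
    simp only [Shuf.consL_mul_consL_eq, Finset.sum_add_distrib]
    congr 1
    · refine Finset.sum_congr rfl fun α _ => ?_
      rw [← map_sum, ← Finset.mul_sum, ← orderSum_eq ℓ hE]
    · rw [Finset.sum_comm]
      refine Finset.sum_congr rfl fun β _ => ?_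
      rw [← map_sum, ← Finset.sum_mul, ← orderSum_eq ℓ hD]

theorem orderSum_insert (ℓ : Arrow → X) {D : Finset Arrow} {α : Arrow}
    (h : ∀ β ∈ D, β.Below α) : orderSum ℓ (insert α D) = Shuf.consL (ℓ α) (orderSum ℓ D) := by
  have hα : α ∉ D := fun hα => ssubset_irrefl _ (h α hα)
  have ht : topArrows (insert α D) = {α} := by
    ext γ
    rw [topArrows, Finset.mem_filter, Finset.mem_singleton, Finset.mem_insert]
    constructor
    · rintro ⟨rfl | hγ, h2⟩
      · rfl
      · exact (h2 α (Finset.mem_insert_self _ _) (h γ hγ)).elim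
    · rintro rfl
      refine ⟨Or.inl rfl, fun β hβ => ?_⟩
      rcases Finset.mem_insert.mp hβ with rfl | hβ
      · exact ssubset_irrefl _
      · exact fun hb => ssubset_irrefl _ (hb.trans (h β hβ))
  rw [orderSum_eq ℓ (Finset.insert_nonempty _ _), ht, Finset.sum_singleton,
    Finset.erase_insert hα]

/-- The sum depends only on the partial order of the arrows and on their letters, so it can be
transported along a relabelling. -/
theorem orderSum_image (ℓ : Arrow → X) {D : Finset Arrow} (e : Arrow → Arrow)
    (he : Set.InjOn e D) (h : ∀ α ∈ D, ∀ β ∈ D, (e α).Below (e β) ↔ α.Below β) :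
    orderSum ℓ (D.image e) = orderSum (fun α => ℓ (e α)) D := by
  obtain ⟨n, hn⟩ : ∃ n, D.card = n := ⟨_, rfl⟩
  induction n generalizing D with
  | zero => rw [Finset.card_eq_zero.mp hn, Finset.image_empty, orderSum_empty, orderSum_empty]
  | succ n ih =>
    have hD : D.Nonempty := Finset.card_pos.mp (by omega)
    have ht : topArrows (D.image e) = (topArrows D).image e := by
      ext γ
      simp only [topArrows, Finset.mem_filter, Finset.mem_image]
      constructor
      · rintro ⟨⟨α, hα, rfl⟩, h2⟩
        exact ⟨α, ⟨hα, fun β hβ hb => h2 (e β) ⟨β, hβ, rfl⟩ ((h α hα β hβ).mpr hb)⟩, rfl⟩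
      · rintro ⟨α, ⟨hα, h2⟩, rfl⟩
        refine ⟨⟨α, hα, rfl⟩, ?_⟩
        rintro _ ⟨β, hβ, rfl⟩ hb
        exact h2 β hβ ((h α hα β hβ).mp hb)
    rw [orderSum_eq ℓ (hD.image e), orderSum_eq _ hD, ht, Finset.sum_image]
    · refine Finset.sum_congr rfl fun α hα => ?_
      have hαD : α ∈ D := (Finset.mem_filter.mp hα).1
      have hi : (D.image e).erase (e α) = (D.erase α).image e := by
        ext γ
        simp only [Finset.mem_erase, Finset.mem_image]
        constructor
        · rintro ⟨h1, β, hβ, rfl⟩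
          exact ⟨β, ⟨fun hb => h1 (by rw [hb]), hβ⟩, rfl⟩
        · rintro ⟨β, ⟨h1, hβ⟩, rfl⟩
          exact ⟨fun hb => h1 (he hβ hαD hb), β, hβ, rfl⟩
      rw [hi, ih (he.mono (Finset.coe_subset.mpr (Finset.erase_subset _ _)))
        (fun a ha b hb => h a (Finset.mem_of_mem_erase ha) b (Finset.mem_of_mem_erase hb))]
      rw [Finset.card_erase_of_mem hαD, hn]; rfl
    · exact he.mono (Finset.coe_subset.mpr (Finset.filter_subset _ _))

end LinearOrders

/-! ## Decomposing dissections -/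

/-- The arrows `(x, y)` with `a ≤ x ≤ b` and `c ≤ y ≤ d` that do not end at a side incident with
their starting vertex. -/
def boxArrows (a b c d : ℕ) : Finset Arrow :=
  (Finset.Icc a b ×ˢ Finset.Icc c d).filter fun α => α.2 ≠ α.1 ∧ α.2 + 1 ≠ α.1

theorem mem_boxArrows {a b c d : ℕ} {α : Arrow} : α ∈ boxArrows a b c d ↔
    ((a ≤ α.1 ∧ α.1 ≤ b) ∧ c ≤ α.2 ∧ α.2 ≤ d) ∧ α.2 ≠ α.1 ∧ α.2 + 1 ≠ α.1 := by
  rw [boxArrows, Finset.mem_filter, Finset.mem_product, Finset.mem_Icc, Finset.mem_Icc]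

/-- The sets of pairwise non-intersecting arrows from `A`. -/
def noncrossing (A : Finset Arrow) : Finset (Finset Arrow) :=
  A.powerset.filter fun D => ∀ α ∈ D, ∀ β ∈ D, ¬ Arrow.Cross α β

theorem mem_noncrossing {A D : Finset Arrow} :
    D ∈ noncrossing A ↔ D ⊆ A ∧ ∀ α ∈ D, ∀ β ∈ D, ¬ Arrow.Cross α β := by
  rw [noncrossing, Finset.mem_filter, Finset.mem_powerset]

/-- Of the excluded arrows only `(0, n)` meets its side around the root vertex. Keeping it inside
the box lets the root region be treated like a region below an arrow. -/
theorem arrows_eq (n : ℕ) : arrows n = (boxArrows 0 n 0 n).erase (rootArrow n) := by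
  ext α
  rw [arrows, Finset.mem_filter, Finset.mem_product, Finset.mem_range, Finset.mem_range,
    Finset.mem_erase, mem_boxArrows, rootArrow, Ne, Prod.ext_iff]
  unfold Arrow.IsTrivial
  omega

theorem dissections_eq (n : ℕ) :
    dissections n = (noncrossing (boxArrows 0 n 0 n)).filter fun D => rootArrow n ∉ D := by
  ext D
  rw [Finset.mem_filter, mem_noncrossing, dissections, Finset.mem_filter, Finset.mem_powerset,
    arrows_eq, Finset.subset_erase]
  tauto

/-- Side `i` is cut off by some arrow of `D`. -/
abbrev Covered (D : Finset Arrow) (i : ℕ) : Prop := ∃ β ∈ D, i ∈ β.cut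

theorem Arrow.cut_nonempty {α : Arrow} (h1 : α.2 ≠ α.1) (h2 : α.2 + 1 ≠ α.1) : α.cut.Nonempty := by
  rw [← Finset.card_pos, Arrow.card_cut]; omega

/-- The bound `c + 1` comes from the backward arrows: they cut off only sides strictly after the one
on which they end, which is at least `c`. -/
theorem Arrow.cut_subset_of_mem_boxArrows {a b c d : ℕ} {α : Arrow} (h : α ∈ boxArrows a b c d) :
    α.cut ⊆ Finset.Ico (min a (c + 1)) (max b d) := by
  intro i hi
  rw [mem_boxArrows] at h
  rw [Arrow.mem_cut] at hi
  rw [Finset.mem_Ico]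
  omega

theorem Arrow.not_below_of_disjoint {α β : Arrow} (hα : α.cut.Nonempty)
    (h : Disjoint α.cut β.cut) : ¬ α.Below β := by
  intro hb
  obtain ⟨i, hi⟩ := hα
  exact Finset.disjoint_left.mp h hi (hb.1 hi)

theorem regionSides_union_left {D E : Finset Arrow} {α : Arrow} (h : ∀ β ∈ E, ¬ β.Below α) :
    regionSides (D ∪ E) α = regionSides D α := by
  ext i
  simp only [regionSides, Finset.mem_filter, Finset.mem_union]
  refine and_congr_right fun _ => ⟨fun H β hβ => H β (Or.inl hβ), fun H β hβ hb => ?_⟩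
  rcases hβ with hβ | hβ
  · exact H β hβ hb
  · exact (h β hβ hb).elim

theorem regionSides_union_right {D E : Finset Arrow} {α : Arrow} (h : ∀ β ∈ D, ¬ β.Below α) :
    regionSides (D ∪ E) α = regionSides E α := by
  rw [Finset.union_comm, regionSides_union_left h]

theorem dissectionSign_union {D E : Finset Arrow} (hd : Disjoint D E)
    (h : ∀ α ∈ D, ∀ β ∈ E, ¬ α.Below β ∧ ¬ β.Below α) :
    dissectionSign (D ∪ E) = dissectionSign D * dissectionSign E := by
  rw [dissectionSign, Finset.prod_union hd]
  congr 1
  · refine Finset.prod_congr rfl fun α hα => ?_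
    rw [regionSides_union_left fun β hβ => (h α hα β hβ).2]
  · refine Finset.prod_congr rfl fun β hβ => ?_
    rw [regionSides_union_right fun α hα => (h α hα β hβ).1]

/-! ### Independent sets of arrows and the splitting of a gap at a vertex. -/

namespace Polygon

variable {R : Type*}

theorem region_congr (π : Polygon R) {D E : Finset Arrow} {α : Arrow}
    (h : regionSides D α = regionSides E α) : π.region D α = π.region E α := by
  rw [region, region, h]

/-- The contribution of a set of arrows to `B(π)`, without the root region. -/
def term (π : Polygon R) (D : Finset Arrow) : Shuf (Polygon R) :=
  dissectionSign D • orderSum (π.region D) D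

theorem term_empty (π : Polygon R) : π.term ∅ = 1 := by
  rw [term, orderSum_empty, dissectionSign, Finset.prod_empty, one_smul]

/-- When no arrow of one set is nested with an arrow of the other, neither set changes the regions
of the other. Signs and letters are then unaffected, and linear orders are shuffled. -/
theorem term_union (π : Polygon R) {D E : Finset Arrow} (hd : Disjoint D E)
    (h : ∀ α ∈ D, ∀ β ∈ E, ¬ α.Below β ∧ ¬ β.Below α) :
    π.term (D ∪ E) = π.term D * π.term E := by
  rw [term, term, term, orderSum_union _ hd h, dissectionSign_union hd h, smul_mul_smul_comm]
  congr 2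
  · exact orderSum_congr fun α hα => π.region_congr
      (regionSides_union_left fun β hβ => (h α hα β hβ).2)
  · exact orderSum_congr fun β hβ => π.region_congr
      (regionSides_union_right fun α hα => (h α hα β hβ).1)

theorem term_union_of_cut (π : Polygon R) {D E : Finset Arrow}
    (hD : ∀ α ∈ D, α.cut.Nonempty) (hE : ∀ α ∈ E, α.cut.Nonempty)
    (h : ∀ α ∈ D, ∀ β ∈ E, Disjoint α.cut β.cut) : π.term (D ∪ E) = π.term D * π.term E := by
  refine π.term_union ?_ fun α hα β hβ => ⟨?_, ?_⟩
  · rw [Finset.disjoint_left]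
    intro α h1 h2
    exact (hD α h1).ne_empty (disjoint_self.mp (h α h1 α h2))
  · exact Arrow.not_below_of_disjoint (hD α hα) (h α hα β hβ)
  · exact Arrow.not_below_of_disjoint (hE β hβ) (h α hα β hβ).symm

theorem term_union_of_box (π : Polygon R) {D E : Finset Arrow} {a b c d a' b' c' d' : ℕ}
    (hD : D ⊆ boxArrows a b c d) (hE : E ⊆ boxArrows a' b' c' d')
    (h : max b d ≤ min a' (c' + 1)) : π.term (D ∪ E) = π.term D * π.term E := by
  refine π.term_union_of_cut (fun α hα => ?_) (fun α hα => ?_) fun α hα β hβ => ?_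
  · have := mem_boxArrows.mp (hD hα); exact Arrow.cut_nonempty this.2.1 this.2.2
  · have := mem_boxArrows.mp (hE hα); exact Arrow.cut_nonempty this.2.1 this.2.2
  · rw [Finset.disjoint_left]
    intro i h1 h2
    have h1 := Finset.mem_Ico.mp (Arrow.cut_subset_of_mem_boxArrows (hD hα) h1)
    have h2 := Finset.mem_Ico.mp (Arrow.cut_subset_of_mem_boxArrows (hE hβ) h2)
    omega

/-- The sum over the sets of arrows cutting off all the sides `i` with `p ≤ i < m`, and lying
between the sides `p - 1` and `m`. -/
def gapSum (π : Polygon R) (p m : ℕ) : Shuf (Polygon R) :=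
  ∑ D ∈ (noncrossing (boxArrows p m (p - 1) m)).filter fun D => ∀ i ∈ Finset.Ico p m, Covered D i,
    π.term D

/-- The sum over the sets of arrows between vertex `v` and side `m`. -/
def forwardSum (π : Polygon R) (v m : ℕ) : Shuf (Polygon R) :=
  ∑ D ∈ (noncrossing (boxArrows v m v m)).filter fun D => v < m → (v, m) ∈ D, π.term D

/-- The sum over the sets of arrows between side `p - 1` and vertex `v`; for `p = 0` there is no
such side. -/
def backwardSum (π : Polygon R) (p v : ℕ) : Shuf (Polygon R) :=
  ∑ D ∈ (noncrossing (boxArrows p v (p - 1) (v - 1))).filter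
    fun D => v = p ∨ (0 < p ∧ (v, p - 1) ∈ D), π.term D

/-- In a set of arrows cutting off a whole gap there is a vertex from which all the outermost arrows
start. -/
theorem exists_gap_vertex {p m : ℕ} (hpm : p ≤ m) {D : Finset Arrow}
    (hD : D ⊆ boxArrows p m (p - 1) m) (hc : ∀ α ∈ D, ∀ β ∈ D, ¬ Arrow.Cross α β)
    (hcov : ∀ i ∈ Finset.Ico p m, Covered D i) :
    ∃ v, p ≤ v ∧ v ≤ m ∧ (v = p ∨ (0 < p ∧ (v, p - 1) ∈ D)) ∧ (v < m → (v, m) ∈ D) := by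
  have hbox : ∀ α ∈ D, ((p ≤ α.1 ∧ α.1 ≤ m) ∧ p - 1 ≤ α.2 ∧ α.2 ≤ m) ∧ α.2 ≠ α.1 ∧ α.2 + 1 ≠ α.1 :=
    fun α hα => mem_boxArrows.mp (hD hα)
  -- the last vertex from which an arrow goes to the side `p - 1`
  obtain ⟨v, hpv, hvm, hv, hmax⟩ : ∃ v, p ≤ v ∧ v ≤ m ∧ (v = p ∨ (0 < p ∧ (v, p - 1) ∈ D)) ∧
      ∀ α ∈ D, 0 < p → α.2 = p - 1 → α.1 ≤ v := by
    let V : Finset ℕ := (Finset.Icc p m).filter fun v => v = p ∨ (0 < p ∧ (v, p - 1) ∈ D)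
    have hV : V.Nonempty := ⟨p, Finset.mem_filter.mpr ⟨Finset.mem_Icc.mpr ⟨le_rfl, hpm⟩, Or.inl rfl⟩⟩
    obtain ⟨v, hv, hmax⟩ := V.exists_max_image id hV
    obtain ⟨h1, h2⟩ := Finset.mem_filter.mp hv
    rw [Finset.mem_Icc] at h1
    refine ⟨v, h1.1, h1.2, h2, fun α hα hp h => ?_⟩
    have := (hbox α hα).1
    exact hmax α.1 (Finset.mem_filter.mpr ⟨Finset.mem_Icc.mpr this.1, Or.inr ⟨hp, by
      rw [← h]; exact hα⟩⟩)
  refine ⟨v, hpv, hvm, hv, fun hlt => ?_⟩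
  have hcv : ∀ α ∈ D, v = p ∨ (0 < p ∧ ¬ Arrow.Cross α (v, p - 1)) := fun α hα =>
    hv.imp id fun h => ⟨h.1, hc α hα _ h.2⟩
  -- the longest arrow from `v` over the side `v`
  let T : Finset Arrow := D.filter fun β => β.1 = v ∧ v < β.2
  have hT : T.Nonempty := by
    obtain ⟨β, hβ, hi⟩ := hcov v (Finset.mem_Ico.mpr ⟨hpv, hlt⟩)
    have h1 := hbox β hβ
    have h2 := hcv β hβ
    have h3 := hmax β hβ
    rw [Arrow.mem_cut] at hi
    simp only [Arrow.Cross, Arrow.lo, Arrow.hi] at h2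
    exact ⟨β, Finset.mem_filter.mpr ⟨hβ, by omega⟩⟩
  obtain ⟨β, hβT, hβmax⟩ := T.exists_max_image (fun β => β.2) hT
  obtain ⟨hβ, hβ1, hβ2⟩ := Finset.mem_filter.mp hβT
  by_cases hβm : β.2 = m
  · rw [← hβ1, ← hβm]; exact hβ
  exfalso
  have hb1 := hbox β hβ
  -- The side on which the longest forward arrow from `v` ends is itself cut off, by `γ` say. Such a
  -- `γ` crosses that arrow or the one from `v` to `p - 1`, or contradicts the maximality of one of
  -- the two choices.
  obtain ⟨γ, hγ, hi⟩ := hcov β.2 (Finset.mem_Ico.mpr (by omega))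
  have h1 := hbox γ hγ
  have h2 := hcv γ hγ
  have h3 := hmax γ hγ
  have h4 := hc β hβ γ hγ
  have h5 : γ.1 = v → γ.2 ≤ β.2 ∨ γ.2 ≤ v := fun h => by
    by_cases h' : v < γ.2
    · exact Or.inl (hβmax γ (Finset.mem_filter.mpr ⟨hγ, h, h'⟩))
    · exact Or.inr (by omega)
  rw [Arrow.mem_cut] at hi
  simp only [Arrow.Cross, Arrow.lo, Arrow.hi] at h2 h4
  omega

/-- The common starting vertex `v` of the outermost arrows separates the arrows into those before it
and those after it, and is determined by the whole set. The two groups cut off disjoint ranges of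
sides, so the terms multiply. -/
theorem gapSum_eq (π : Polygon R) {p m : ℕ} (hpm : p ≤ m) :
    π.gapSum p m = ∑ v ∈ Finset.Icc p m, π.backwardSum p v * π.forwardSum v m := by
  simp only [backwardSum, forwardSum, Finset.sum_mul_sum, ← Finset.sum_product', gapSum]
  rw [Finset.sum_sigma']
  symm
  refine Finset.sum_bij (fun x _ => x.2.1 ∪ x.2.2) ?_ ?_ ?_ ?_
  · rintro ⟨v, D, E⟩ hx
    simp only [Finset.mem_sigma, Finset.mem_product, Finset.mem_filter, mem_noncrossing,
      Finset.mem_Icc] at hx ⊢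
    obtain ⟨hv, ⟨⟨hD, hcD⟩, hDv⟩, ⟨hE, hcE⟩, hEv⟩ := hx
    have hbD := fun (α : Arrow) hα => mem_boxArrows.mp (@hD α hα)
    have hbE := fun (α : Arrow) hα => mem_boxArrows.mp (@hE α hα)
    refine ⟨⟨?_, ?_⟩, ?_⟩
    · intro α hα
      rw [mem_boxArrows]
      rcases Finset.mem_union.mp hα with hα | hα
      · have := hbD α hα; omega
      · have := hbE α hα; omega
    · have key : ∀ α ∈ D, ∀ β ∈ E, ¬ Arrow.Cross α β ∧ ¬ Arrow.Cross β α := by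
        intro α hα β hβ
        have h1 := hbD α hα
        have h2 := hbE β hβ
        simp only [Arrow.Cross, Arrow.lo, Arrow.hi]
        omega
      intro α hα β hβ
      rcases Finset.mem_union.mp hα with hα | hα <;> rcases Finset.mem_union.mp hβ with hβ | hβ
      · exact hcD α hα β hβ
      · exact (key α hα β hβ).1
      · exact (key β hβ α hα).2
      · exact hcE α hα β hβ
    · intro i hi
      rw [Finset.mem_Ico] at hi
      by_cases hiv : i < v
      · have h := hDv.resolve_left (by omega)
        exact ⟨_, Finset.mem_union_left _ h.2, Arrow.mem_cut.mpr (by simp only; omega)⟩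
      · exact ⟨_, Finset.mem_union_right _ (hEv (by omega)), Arrow.mem_cut.mpr (by simp only; omega)⟩
  · rintro ⟨v, D, E⟩ hx ⟨v', D', E'⟩ hx' he
    simp only [Finset.mem_sigma, Finset.mem_product, Finset.mem_filter, mem_noncrossing,
      Finset.mem_Icc] at hx hx' he
    obtain ⟨hv, ⟨⟨hD, -⟩, hDv⟩, ⟨hE, -⟩, hEv⟩ := hx
    obtain ⟨hv', ⟨⟨hD', -⟩, hDv'⟩, ⟨hE', -⟩, hEv'⟩ := hx'
    have hbD := fun (α : Arrow) hα => mem_boxArrows.mp (@hD α hα)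
    have hbE := fun (α : Arrow) hα => mem_boxArrows.mp (@hE α hα)
    have hbD' := fun (α : Arrow) hα => mem_boxArrows.mp (@hD' α hα)
    have hbE' := fun (α : Arrow) hα => mem_boxArrows.mp (@hE' α hα)
    -- The vertex is recovered as follows: an arrow from `v` to `p - 1` cannot belong to the forward
    -- half of the other decomposition, whose arrows end at sides `≥ v' ≥ p`, hence it lies in the
    -- backward half and `v ≤ v'`.
    have aux : ∀ {v v' : ℕ} {D E D' E' : Finset Arrow},
        (∀ α ∈ D', ((p ≤ α.1 ∧ α.1 ≤ v') ∧ p - 1 ≤ α.2 ∧ α.2 ≤ v' - 1) ∧ α.2 ≠ α.1 ∧ α.2 + 1 ≠ α.1) →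
        (∀ α ∈ E', ((v' ≤ α.1 ∧ α.1 ≤ m) ∧ v' ≤ α.2 ∧ α.2 ≤ m) ∧ α.2 ≠ α.1 ∧ α.2 + 1 ≠ α.1) →
        p ≤ v' → D ∪ E = D' ∪ E' → (v = p ∨ (0 < p ∧ (v, p - 1) ∈ D)) → v ≤ v' := by
      intro v v' D E D' E' hbD' hbE' hpv he hDv
      rcases hDv with rfl | ⟨hp, h⟩
      · exact hpv
      · have := Finset.mem_union_left E h
        rw [he] at this
        rcases Finset.mem_union.mp this with h | h
        · exact (hbD' _ h).1.1.2
        · have := (hbE' _ h).1.2.1; simp only at this; omega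
    obtain rfl : v = v' := le_antisymm (aux hbD' hbE' hv'.1 he hDv) (aux hbD hbE hv.1 he.symm hDv')
    have hDD : ∀ {D E D' E' : Finset Arrow}, (∀ α ∈ D, ((p ≤ α.1 ∧ α.1 ≤ v) ∧ p - 1 ≤ α.2 ∧
          α.2 ≤ v - 1) ∧ α.2 ≠ α.1 ∧ α.2 + 1 ≠ α.1) →
        (∀ α ∈ E', ((v ≤ α.1 ∧ α.1 ≤ m) ∧ v ≤ α.2 ∧ α.2 ≤ m) ∧ α.2 ≠ α.1 ∧ α.2 + 1 ≠ α.1) →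
        D ∪ E = D' ∪ E' → D ⊆ D' := by
      intro D E D' E' hbD hbE' he α hα
      have := Finset.mem_union_left E hα
      rw [he] at this
      refine (Finset.mem_union.mp this).resolve_right fun h => ?_
      have h1 := hbD α hα
      have h2 := hbE' α h
      omega
    have hEE : ∀ {D E D' E' : Finset Arrow}, (∀ α ∈ D', ((p ≤ α.1 ∧ α.1 ≤ v) ∧ p - 1 ≤ α.2 ∧
          α.2 ≤ v - 1) ∧ α.2 ≠ α.1 ∧ α.2 + 1 ≠ α.1) →
        (∀ α ∈ E, ((v ≤ α.1 ∧ α.1 ≤ m) ∧ v ≤ α.2 ∧ α.2 ≤ m) ∧ α.2 ≠ α.1 ∧ α.2 + 1 ≠ α.1) →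
        D ∪ E = D' ∪ E' → E ⊆ E' := by
      intro D E D' E' hbD' hbE he α hα
      have := Finset.mem_union_right D hα
      rw [he] at this
      refine (Finset.mem_union.mp this).resolve_left fun h => ?_
      have h1 := hbE α hα
      have h2 := hbD' α h
      omega
    obtain rfl : D = D' := (hDD hbD hbE' he).antisymm (hDD hbD' hbE he.symm)
    obtain rfl : E = E' := (hEE hbD hbE he).antisymm (hEE hbD hbE' he.symm)
    rfl
  · intro D hD
    simp only [Finset.mem_filter, mem_noncrossing] at hD
    obtain ⟨⟨hD, hc⟩, hcov⟩ := hD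
    obtain ⟨v, hpv, hvm, hv, hv'⟩ := exists_gap_vertex hpm hD hc hcov
    -- An arrow crossing neither `(v, p - 1)` nor `(v, m)` stays on one side of `v`.
    have hsplit : ∀ α ∈ D, α ∈ boxArrows p v (p - 1) (v - 1) ∨ α ∈ boxArrows v m v m := by
      intro α hα
      have h1 := mem_boxArrows.mp (hD hα)
      have h2 : v = p ∨ (0 < p ∧ ¬ Arrow.Cross α (v, p - 1)) := hv.imp id fun h =>
        ⟨h.1, hc α hα _ h.2⟩
      have h3 : v < m → ¬ Arrow.Cross α (v, m) := fun h => hc α hα _ (hv' h)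
      rw [mem_boxArrows, mem_boxArrows]
      simp only [Arrow.Cross, Arrow.lo, Arrow.hi] at h2 h3
      omega
    refine ⟨⟨v, D ∩ boxArrows p v (p - 1) (v - 1), D ∩ boxArrows v m v m⟩, ?_, ?_⟩
    · simp only [Finset.mem_sigma, Finset.mem_product, Finset.mem_filter, mem_noncrossing,
        Finset.mem_Icc, Finset.mem_inter]
      refine ⟨⟨hpv, hvm⟩, ⟨⟨Finset.inter_subset_right, fun α hα β hβ => hc α hα.1 β hβ.1⟩, ?_⟩,
        ⟨Finset.inter_subset_right, fun α hα β hβ => hc α hα.1 β hβ.1⟩, fun h => ⟨hv' h, ?_⟩⟩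
      · refine hv.imp id fun h => ⟨h.1, h.2, ?_⟩
        have := mem_boxArrows.mp (hD h.2)
        rw [mem_boxArrows]
        omega
      · have := mem_boxArrows.mp (hD (hv' h))
        rw [mem_boxArrows]
        omega
    · rw [← Finset.inter_union_distrib_left, Finset.inter_eq_left]
      exact fun α hα => Finset.mem_union.mpr (hsplit α hα)
  · rintro ⟨v, D, E⟩ hx
    simp only [Finset.mem_sigma, Finset.mem_product, Finset.mem_filter, mem_noncrossing,
      Finset.mem_Icc] at hx ⊢
    obtain ⟨hv, ⟨⟨hD, -⟩, hDv⟩, ⟨hE, -⟩, hEv⟩ := hx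
    exact (π.term_union_of_box hD hE (by omega)).symm

end Polygon

/-! ## Relabelling -/

theorem rootArrow_mem_boxArrows {n : ℕ} (hn : 0 < n) : rootArrow n ∈ boxArrows 0 n 0 n := by
  rw [mem_boxArrows, rootArrow]; simp only; omega

theorem Arrow.cut_subset_range {n : ℕ} {α : Arrow} (h : α ∈ boxArrows 0 n 0 n) :
    α.cut ⊆ Finset.range n := by
  intro i hi
  have := Finset.mem_Ico.mp (Arrow.cut_subset_of_mem_boxArrows h hi)
  rw [Finset.mem_range]; omega

theorem Arrow.cut_rootArrow (n : ℕ) : (rootArrow n).cut = Finset.range n := by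
  ext i; rw [Arrow.mem_cut, Finset.mem_range, rootArrow]; simp only; omega

theorem Arrow.eq_rootArrow {n : ℕ} {α : Arrow} (h : α ∈ boxArrows 0 n 0 n)
    (hc : Finset.range n ⊆ α.cut) : α = rootArrow n := by
  rw [mem_boxArrows] at h
  have h1 := Arrow.mem_cut.mp (hc (Finset.mem_range.mpr (show 0 < n by omega)))
  have h2 := Arrow.mem_cut.mp (hc (Finset.mem_range.mpr (show n - 1 < n by omega)))
  rw [Prod.ext_iff, rootArrow]
  simp only
  omega

theorem Arrow.below_rootArrow {n : ℕ} {α : Arrow} (h : α ∈ boxArrows 0 n 0 n)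
    (hne : α ≠ rootArrow n) : α.Below (rootArrow n) := by
  refine ⟨?_, fun hs => hne (Arrow.eq_rootArrow h ?_)⟩
  · rw [Arrow.cut_rootArrow]; exact Arrow.cut_subset_range h
  · rw [← Arrow.cut_rootArrow n]; exact hs

theorem Arrow.not_rootArrow_below {n : ℕ} {α : Arrow} (h : α ∈ boxArrows 0 n 0 n) :
    ¬ (rootArrow n).Below α := by
  intro hb
  rw [Arrow.Below, Arrow.cut_rootArrow] at hb
  exact hb.2 (Arrow.cut_subset_range h)

theorem below_rootArrow_of_mem_dissections {n : ℕ} {D : Finset Arrow} (hD : D ∈ dissections n)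
    {α : Arrow} (hα : α ∈ D) : α.Below (rootArrow n) := by
  rw [dissections_eq, Finset.mem_filter, mem_noncrossing] at hD
  exact Arrow.below_rootArrow (hD.1.1 hα) fun h => hD.2 (h ▸ hα)

theorem insert_rootArrow_subset {n : ℕ} (hn : 0 < n) {D : Finset Arrow} (hD : D ∈ dissections n) :
    insert (rootArrow n) D ⊆ boxArrows 0 n 0 n := by
  rw [dissections_eq, Finset.mem_filter, mem_noncrossing] at hD
  exact Finset.insert_subset (rootArrow_mem_boxArrows hn) hD.1.1

theorem not_cross_of_mem_insert {n : ℕ} {D : Finset Arrow} (hD : D ∈ dissections n)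
    {α β : Arrow} (hα : α ∈ insert (rootArrow n) D) (hβ : β ∈ insert (rootArrow n) D) :
    ¬ Arrow.Cross α β := by
  rw [dissections_eq, Finset.mem_filter, mem_noncrossing] at hD
  obtain ⟨⟨hs, hc⟩, -⟩ := hD
  rcases Finset.mem_insert.mp hα with rfl | hα' <;> rcases Finset.mem_insert.mp hβ with rfl | hβ'
  · simp only [Arrow.Cross, Arrow.lo, Arrow.hi]; omega
  · have := mem_boxArrows.mp (hs hβ')
    simp only [Arrow.Cross, Arrow.lo, Arrow.hi, rootArrow]; omega
  · have := mem_boxArrows.mp (hs hα')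
    simp only [Arrow.Cross, Arrow.lo, Arrow.hi, rootArrow]; omega
  · exact hc α hα' β hβ'

/-- The cuts of non-crossing arrows are nested or disjoint. -/
theorem Arrow.below_or_below {α β : Arrow} {i : ℕ} (hx : ¬ Arrow.Cross α β) (hα : i ∈ α.cut)
    (hβ : i ∈ β.cut) : α = β ∨ α.Below β ∨ β.Below α := by
  rw [Arrow.mem_cut] at hα hβ
  simp only [Arrow.Cross, Arrow.lo, Arrow.hi] at hx
  by_cases hab : α = β
  · exact Or.inl hab
  have hab' : ¬ (α.1 = β.1 ∧ α.2 = β.2) := fun h => hab (Prod.ext h.1 h.2)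
  refine Or.inr ?_
  have hsub : ∀ {γ δ : Arrow}, (∀ j, ((γ.2 < j ∧ j < γ.1) ∨ (γ.1 ≤ j ∧ j < γ.2)) →
      ((δ.2 < j ∧ j < δ.1) ∨ (δ.1 ≤ j ∧ j < δ.2))) →
      (γ.1 - γ.2 - 1) + (γ.2 - γ.1) < (δ.1 - δ.2 - 1) + (δ.2 - δ.1) → γ.Below δ := by
    intro γ δ h hc
    have hs : γ.cut ⊆ δ.cut := fun j hj => Arrow.mem_cut.mpr (h j (Arrow.mem_cut.mp hj))
    refine ⟨hs, fun hs' => ?_⟩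
    have := Finset.card_le_card hs'
    rw [Arrow.card_cut, Arrow.card_cut] at this
    omega
  have hd : ((α.1 - α.2 - 1) + (α.2 - α.1) < (β.1 - β.2 - 1) + (β.2 - β.1)) ∨
      ((β.1 - β.2 - 1) + (β.2 - β.1) < (α.1 - α.2 - 1) + (α.2 - α.1)) := by omega
  rcases hd with hd | hd
  · exact Or.inl (hsub (fun j hj => by omega) hd)
  · exact Or.inr (hsub (fun j hj => by omega) hd)

/-- Each side belongs to exactly one region. -/
theorem sum_card_regionSides {n : ℕ} (hn : 0 < n) {D : Finset Arrow} (hD : D ∈ dissections n) :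
    ∑ α ∈ insert (rootArrow n) D, (regionSides D α).card = n := by
  have hs := insert_rootArrow_subset hn hD
  have hu : (insert (rootArrow n) D).biUnion (regionSides D) = Finset.range n := by
    ext i
    rw [Finset.mem_biUnion, Finset.mem_range]
    constructor
    · rintro ⟨α, hα, hi⟩
      exact Finset.mem_range.mp (Arrow.cut_subset_range (hs hα) (Finset.mem_filter.mp hi).1)
    · intro hi
      have hne : ((insert (rootArrow n) D).filter fun α => i ∈ α.cut).Nonempty :=
        ⟨rootArrow n, Finset.mem_filter.mpr ⟨Finset.mem_insert_self _ _, by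
          rw [Arrow.cut_rootArrow]; exact Finset.mem_range.mpr hi⟩⟩
      -- The region containing side `i` is the one just below the arrow with the smallest cut around
      -- `i`.
      obtain ⟨α, hα, hmin⟩ := Finset.exists_min_image _ (fun α => α.cut.card) hne
      obtain ⟨h1, h2⟩ := Finset.mem_filter.mp hα
      refine ⟨α, h1, Finset.mem_filter.mpr ⟨h2, fun β hβ hb hi' => ?_⟩⟩
      have := hmin β (Finset.mem_filter.mpr ⟨Finset.mem_insert_of_mem hβ, hi'⟩)
      exact absurd (Finset.card_lt_card hb) (not_lt.mpr this)
  rw [← Finset.card_biUnion, hu, Finset.card_range]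
  intro α hα β hβ hne
  refine Finset.disjoint_left.mpr fun i h1 h2 => ?_
  obtain ⟨h1, h1'⟩ := Finset.mem_filter.mp h1
  obtain ⟨h2, h2'⟩ := Finset.mem_filter.mp h2
  rcases Arrow.below_or_below (not_cross_of_mem_insert hD hα hβ) h1 h2 with h | h | h
  · exact hne h
  · rcases Finset.mem_insert.mp hα with rfl | hα
    · exact Arrow.not_rootArrow_below (hs hβ) h
    · exact h2' α hα h h1
  · rcases Finset.mem_insert.mp hβ with rfl | hβ
    · exact Arrow.not_rootArrow_below (hs hα) h
    · exact h1' β hβ h h2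

theorem sort_image_of_strictMonoOn (s : Finset ℕ) (f : ℕ → ℕ) (hf : StrictMonoOn f s) :
    (s.image f).sort (· ≤ ·) = (s.sort (· ≤ ·)).map f := by
  refine List.Perm.eq_of_pairwise' (r := (· ≤ ·)) (Finset.pairwise_sort _ _) ?_ ?_
  · rw [List.pairwise_map]
    refine (Finset.pairwise_sort s (· ≤ ·)).imp_of_mem fun {a b} ha hb hab => ?_
    rw [Finset.mem_sort] at ha hb
    exact hf.monotoneOn ha hb hab
  · rw [List.perm_ext_iff_of_nodup (Finset.sort_nodup _ _)]
    · intro a; simp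
    · exact List.Nodup.map_on (fun x hx y hy h => hf.injOn ((Finset.mem_sort _).mp hx)
        ((Finset.mem_sort _).mp hy) h) (Finset.sort_nodup _ _)

theorem sort_image_of_strictAntiOn (s : Finset ℕ) (f : ℕ → ℕ) (hf : StrictAntiOn f s) :
    (s.image f).sort (· ≤ ·) = ((s.sort (· ≤ ·)).map f).reverse := by
  refine List.Perm.eq_of_pairwise' (r := (· ≤ ·)) (Finset.pairwise_sort _ _) ?_ ?_
  · rw [List.pairwise_reverse, List.pairwise_map]
    refine (Finset.pairwise_sort s (· ≤ ·)).imp_of_mem fun {a b} ha hb hab => ?_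
    rw [Finset.mem_sort] at ha hb
    exact hf.antitoneOn ha hb hab
  · refine List.Perm.trans ?_ (List.reverse_perm _).symm
    rw [List.perm_ext_iff_of_nodup (Finset.sort_nodup _ _)]
    · intro a; simp
    · exact List.Nodup.map_on (fun x hx y hy h => hf.injOn ((Finset.mem_sort _).mp hx)
        ((Finset.mem_sort _).mp hy) h) (Finset.sort_nodup _ _)

/-- A relabelling `e` of the arrows, given by a relabelling `σ` of the sides on the cut off parts,
is compatible with the order of the arrows. -/
theorem below_iff_of_cut_eq_image {n : ℕ} {e : Arrow → Arrow} {σ : ℕ → ℕ}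
    (hσ : Set.InjOn σ (Finset.range n))
    (he : ∀ α ∈ boxArrows 0 n 0 n, (e α).cut = α.cut.image σ)
    {α β : Arrow} (hα : α ∈ boxArrows 0 n 0 n) (hβ : β ∈ boxArrows 0 n 0 n) :
    (e α).Below (e β) ↔ α.Below β := by
  have key : ∀ {α β : Arrow}, α ∈ boxArrows 0 n 0 n → β ∈ boxArrows 0 n 0 n →
      ((e α).cut ⊆ (e β).cut ↔ α.cut ⊆ β.cut) := by
    intro α β hα hβ
    rw [he α hα, he β hβ, ← Finset.coe_subset, Finset.coe_image, Finset.coe_image,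
      hσ.image_subset_image_iff (Finset.coe_subset.mpr (Arrow.cut_subset_range hα))
        (Finset.coe_subset.mpr (Arrow.cut_subset_range hβ)), Finset.coe_subset]
  rw [Arrow.Below, Arrow.Below, Finset.ssubset_def, Finset.ssubset_def, key hα hβ, key hβ hα]

/-- After relabelling, the root arrow becomes an honest arrow of the set. It lies below no arrow of
the set, so its presence does not change any region. -/
theorem regionSides_image {n : ℕ} (hn : 0 < n) {e : Arrow → Arrow} {σ : ℕ → ℕ}
    (hσ : Set.InjOn σ (Finset.range n))
    (he : ∀ α ∈ boxArrows 0 n 0 n, (e α).cut = α.cut.image σ)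
    {D : Finset Arrow} (hD : D ∈ dissections n) {α : Arrow} (hα : α ∈ insert (rootArrow n) D) :
    regionSides ((insert (rootArrow n) D).image e) (e α) = (regionSides D α).image σ := by
  have hs := insert_rootArrow_subset hn hD
  ext i
  simp only [regionSides, Finset.mem_filter, Finset.mem_image]
  have hmem : ∀ {β : Arrow} {j : ℕ}, β ∈ boxArrows 0 n 0 n → j ∈ Finset.range n →
      (σ j ∈ (e β).cut ↔ j ∈ β.cut) := by
    intro β j hβ hj
    rw [he β hβ, ← Finset.mem_coe, Finset.coe_image,
      hσ.mem_image_iff (Finset.coe_subset.mpr (Arrow.cut_subset_range hβ)) hj, Finset.mem_coe]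
  constructor
  · rintro ⟨h1, h2⟩
    rw [he α (hs hα), Finset.mem_image] at h1
    obtain ⟨j, hj, rfl⟩ := h1
    refine ⟨j, ⟨hj, fun β hβ hb hjβ => ?_⟩, rfl⟩
    have hβ' := Finset.mem_insert_of_mem (b := rootArrow n) hβ
    exact h2 (e β) ⟨β, hβ', rfl⟩ ((below_iff_of_cut_eq_image hσ he (hs hβ') (hs hα)).mpr hb)
      ((hmem (hs hβ') (Arrow.cut_subset_range (hs hα) hj)).mpr hjβ)
  · rintro ⟨j, ⟨hj, h2⟩, rfl⟩
    have hjn := Arrow.cut_subset_range (hs hα) hj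
    refine ⟨(hmem (hs hα) hjn).mpr hj, ?_⟩
    rintro _ ⟨β, hβ, rfl⟩ hb hjβ
    rw [below_iff_of_cut_eq_image hσ he (hs hβ) (hs hα)] at hb
    rw [hmem (hs hβ) hjn] at hjβ
    rcases Finset.mem_insert.mp hβ with rfl | hβ
    · exact Arrow.not_rootArrow_below (hs hα) hb
    · exact h2 β hβ hb hjβ

namespace Polygon

variable {R : Type*}

theorem weight_pos (π : Polygon R) : 0 < π.weight := List.length_pos_iff.mpr π.sides_ne

/-- Here the root arrow is one of the arrows that are ordered. In this form a dissection of a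
smaller polygon can be carried to a set of arrows, inside a larger one, that contains a prescribed
outermost arrow. -/
theorem B_eq (π : Polygon R) : π.B = ∑ D ∈ dissections π.weight,
    dissectionSign D • orderSum (π.region D) (insert (rootArrow π.weight) D) := by
  refine Finset.sum_congr rfl fun D hD => ?_
  rw [orderSum_insert _ fun β hβ => below_rootArrow_of_mem_dissections hD hβ, orderSum, map_sum]
  simp only [Shuf.consL_word, List.map_cons]

theorem B_eq_consL (π : Polygon R) : π.B = ∑ D ∈ dissections π.weight,
    Shuf.consL (π.region D (rootArrow π.weight)) (π.term D) := by
  rw [B_eq]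
  refine Finset.sum_congr rfl fun D hD => ?_
  rw [orderSum_insert _ fun β hβ => below_rootArrow_of_mem_dissections hD hβ, term, map_smul]

/-- The transport of the dissections of `π'` to the sets of arrows of `π` below a given arrow. -/
theorem sum_closed_eq (π π' : Polygon R) (A : Finset Arrow) (c : ℚ) (e e' : Arrow → Arrow)
    (σ : ℕ → ℕ) (hσ : Set.InjOn σ (Finset.range π'.weight))
    (he : ∀ α ∈ boxArrows 0 π'.weight 0 π'.weight, (e α).cut = α.cut.image σ)
    (h1 : ∀ α ∈ boxArrows 0 π'.weight 0 π'.weight, e α ∈ A ∧ e' (e α) = α)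
    (h2 : ∀ α ∈ A, e' α ∈ boxArrows 0 π'.weight 0 π'.weight ∧ e (e' α) = α)
    (hx : ∀ α ∈ boxArrows 0 π'.weight 0 π'.weight, ∀ β ∈ boxArrows 0 π'.weight 0 π'.weight,
      (e α).Cross (e β) ↔ α.Cross β)
    (hr : ∀ D ∈ dissections π'.weight, ∀ α ∈ insert (rootArrow π'.weight) D,
      π.region ((insert (rootArrow π'.weight) D).image e) (e α) = π'.region D α)
    (hsgn : ∀ D ∈ dissections π'.weight,
      dissectionSign ((insert (rootArrow π'.weight) D).image e) = c * dissectionSign D) :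
    ∑ D ∈ (noncrossing A).filter fun D => e (rootArrow π'.weight) ∈ D, π.term D = c • π'.B := by
  rw [B_eq, Finset.smul_sum]
  symm
  have hn := π'.weight_pos
  have hroot := rootArrow_mem_boxArrows hn
  refine Finset.sum_nbij' (fun D => (insert (rootArrow π'.weight) D).image e)
    (fun D => (D.image e').erase (rootArrow π'.weight)) ?_ ?_ ?_ ?_ ?_
  · intro D hD
    have hs := insert_rootArrow_subset hn hD
    rw [Finset.mem_filter, mem_noncrossing]
    refine ⟨⟨?_, ?_⟩, Finset.mem_image_of_mem _ (Finset.mem_insert_self _ _)⟩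
    · intro α hα
      obtain ⟨β, hβ, rfl⟩ := Finset.mem_image.mp hα
      exact (h1 β (hs hβ)).1
    · intro α hα β hβ
      obtain ⟨γ, hγ, rfl⟩ := Finset.mem_image.mp hα
      obtain ⟨δ, hδ, rfl⟩ := Finset.mem_image.mp hβ
      rw [hx _ (hs hγ) _ (hs hδ)]
      exact not_cross_of_mem_insert hD hγ hδ
  · intro D hD
    rw [Finset.mem_filter, mem_noncrossing] at hD
    rw [dissections_eq, Finset.mem_filter, mem_noncrossing]
    refine ⟨⟨?_, ?_⟩, Finset.notMem_erase _ _⟩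
    · intro α hα
      obtain ⟨β, hβ, rfl⟩ := Finset.mem_image.mp (Finset.mem_of_mem_erase hα)
      exact (h2 β (hD.1.1 hβ)).1
    · intro α hα β hβ
      obtain ⟨γ, hγ, rfl⟩ := Finset.mem_image.mp (Finset.mem_of_mem_erase hα)
      obtain ⟨δ, hδ, rfl⟩ := Finset.mem_image.mp (Finset.mem_of_mem_erase hβ)
      rw [← hx _ (h2 γ (hD.1.1 hγ)).1 _ (h2 δ (hD.1.1 hδ)).1, (h2 γ (hD.1.1 hγ)).2,
        (h2 δ (hD.1.1 hδ)).2]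
      exact hD.1.2 γ hγ δ hδ
  · intro D hD
    have hs := insert_rootArrow_subset hn hD
    have : ((insert (rootArrow π'.weight) D).image e).image e' = insert (rootArrow π'.weight) D := by
      rw [Finset.image_image]
      conv_rhs => rw [← Finset.image_id (s := insert (rootArrow π'.weight) D)]
      exact Finset.image_congr fun α hα => (h1 α (hs hα)).2
    simp only [this]
    rw [dissections_eq, Finset.mem_filter] at hD
    exact Finset.erase_insert hD.2
  · intro D hD
    rw [Finset.mem_filter, mem_noncrossing] at hD
    have hr : rootArrow π'.weight ∈ D.image e' :=
      Finset.mem_image.mpr ⟨_, hD.2, (h1 _ hroot).2⟩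
    simp only [Finset.insert_erase hr]
    rw [Finset.image_image]
    conv_rhs => rw [← Finset.image_id (s := D)]
    exact Finset.image_congr fun α hα => (h2 α (hD.1.1 hα)).2
  · intro D hD
    have hs := insert_rootArrow_subset hn hD
    have hinj : Set.InjOn e (insert (rootArrow π'.weight) D : Finset Arrow) := by
      intro α hα β hβ h
      rw [← (h1 α (hs hα)).2, h, (h1 β (hs hβ)).2]
    rw [term, hsgn D hD, mul_smul, orderSum_image _ e hinj fun α hα β hβ =>
      below_iff_of_cut_eq_image hσ he (hs hα) (hs hβ),
      orderSum_congr fun α hα => hr D hD α hα]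

/-- Frees the later arguments from the default branch in the definition of `region`; for dissections
the hypothesis is `regionSides_nonempty`. -/
theorem region_sides_eq (π : Polygon R) {D : Finset Arrow} {α : Arrow}
    (h : (regionSides D α).Nonempty) :
    (π.region D α).sides = (if α.IsBackward then ((regionSides D α).sort (· ≤ ·)).reverse
      else (regionSides D α).sort (· ≤ ·)).map π.deco ∧ (π.region D α).root = π.deco α.2 := by
  have : (if α.IsBackward then ((regionSides D α).sort (· ≤ ·)).reverse
      else (regionSides D α).sort (· ≤ ·)).map π.deco ≠ [] := by
    obtain ⟨i, hi⟩ := h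
    refine List.ne_nil_of_mem (List.mem_map_of_mem (a := i) ?_)
    split_ifs <;> simp [hi]
  rw [region]
  simp only [dif_pos this, and_self]

theorem ext_sides_root {π π' : Polygon R} (h : π.sides = π'.sides) (h' : π.root = π'.root) :
    π = π' := by
  cases π; cases π'; simp_all

theorem regionSides_subset_range {n : ℕ} (hn : 0 < n) {D : Finset Arrow} (hD : D ∈ dissections n)
    {α : Arrow} (hα : α ∈ insert (rootArrow n) D) : regionSides D α ⊆ Finset.range n :=
  (Finset.filter_subset _ _).trans (Arrow.cut_subset_range (insert_rootArrow_subset hn hD hα))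

/-- Translation by `v` carries the root arrow to `(v, m)` and keeps the direction of every arrow, so
all orientations and signs are preserved. The root arrow stays forward and contributes the factor
`1`. -/
theorem forwardSum_eq_B (π π' : Polygon R) {v m : ℕ} (hn : v + π'.weight = m)
    (hdeco : ∀ i ≤ π'.weight, π.deco (v + i) = π'.deco i) : π.forwardSum v m = π'.B := by
  have hpos := π'.weight_pos
  have hcut : ∀ α ∈ boxArrows 0 π'.weight 0 π'.weight,
      Arrow.cut (v + α.1, v + α.2) = α.cut.image (v + ·) := by
    intro α hα
    ext i
    rw [Finset.mem_image, Arrow.mem_cut]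
    simp only [Arrow.mem_cut]
    constructor
    · intro h; exact ⟨i - v, by omega, by omega⟩
    · rintro ⟨j, h, rfl⟩; omega
  have hσ : Set.InjOn (v + ·) (Finset.range π'.weight : Set ℕ) := (add_right_injective v).injOn
  have key := sum_closed_eq π π' (boxArrows v m v m) 1 (fun α => (v + α.1, v + α.2))
    (fun α => (α.1 - v, α.2 - v)) (v + ·) hσ hcut ?_ ?_ ?_ ?_ ?_
  · rw [one_smul] at key
    rw [← key, forwardSum]
    congr 1
    refine Finset.filter_congr fun D _ => ?_
    simp only [rootArrow, add_zero, hn]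
    exact ⟨fun h => h (by omega), fun h _ => h⟩
  · intro α hα
    rw [mem_boxArrows] at hα ⊢
    exact ⟨by simp only; omega, Prod.ext (by simp) (by simp)⟩
  · intro α hα
    rw [mem_boxArrows] at hα ⊢
    exact ⟨by simp only; omega, Prod.ext (by simp only; omega) (by simp only; omega)⟩
  · intro α _ β _
    simp only [Arrow.Cross, Arrow.lo, Arrow.hi]; omega
  · intro D hD α hα
    have hne := regionSides_nonempty hpos hD hα
    have hi := regionSides_image hpos hσ hcut hD hα
    have hs := regionSides_subset_range hpos hD hα
    have hb : Arrow.IsBackward (v + α.1, v + α.2) ↔ α.IsBackward := by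
      simp only [Arrow.IsBackward]; omega
    have hbox := mem_boxArrows.mp (insert_rootArrow_subset hpos hD hα)
    obtain ⟨e1, e2⟩ := π.region_sides_eq (hi ▸ hne.image _)
    obtain ⟨e3, e4⟩ := π'.region_sides_eq hne
    refine ext_sides_root ?_ ?_
    · rw [e1, e3, hi, sort_image_of_strictMonoOn _ _ (fun a _ b _ h => Nat.add_lt_add_left h v)]
      simp only [hb]
      split_ifs
      · rw [← List.map_reverse, List.map_map]
        refine List.map_congr_left fun i hi => hdeco i ?_
        have := hs ((Finset.mem_sort _).mp (List.mem_reverse.mp hi))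
        exact (Finset.mem_range.mp this).le
      · rw [List.map_map]
        refine List.map_congr_left fun i hi => hdeco i ?_
        have := hs ((Finset.mem_sort _).mp hi)
        exact (Finset.mem_range.mp this).le
    · rw [e2, e4]; exact hdeco _ (by omega)
  · intro D hD
    have hr : rootArrow π'.weight ∉ D := by
      rw [dissections_eq, Finset.mem_filter] at hD; exact hD.2
    rw [dissectionSign, Finset.prod_image, one_mul]
    · rw [dissectionSign, Finset.prod_insert hr, if_neg (by
        simp only [rootArrow, Arrow.IsBackward]; omega), one_mul]
      refine Finset.prod_congr rfl fun α hα => ?_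
      rw [regionSides_image hpos hσ hcut hD (Finset.mem_insert_of_mem hα),
        Finset.card_image_of_injective _ (add_right_injective v)]
      simp only [Arrow.IsBackward, add_lt_add_iff_left]
    · intro α _ β _ h
      simp only [Prod.mk.injEq, add_right_inj] at h
      exact Prod.ext h.1 h.2

/-- The reflection taking vertex `a` to `v - a` and side `s` to `v - 1 - s` carries the root arrow
to `(v, p - 1)` and exchanges forward and backward arrows. Regions below reflected arrows get the
same decorated polygons, since reversing both the sides and the orientation cancels; only the signs
change. -/
theorem backwardSum_eq_B (π π' : Polygon R) {p v : ℕ} (hp : 0 < p) (hn : p + π'.weight = v)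
    (hdeco : ∀ i ≤ π'.weight, π.deco (v - 1 - i) = π'.deco i) :
    π.backwardSum p v = (-1 : ℚ) ^ π'.weight • π'.B := by
  have hpos := π'.weight_pos
  have hcut : ∀ α ∈ boxArrows 0 π'.weight 0 π'.weight,
      Arrow.cut (v - α.1, v - 1 - α.2) = α.cut.image (v - 1 - ·) := by
    intro α hα
    rw [mem_boxArrows] at hα
    ext i
    rw [Finset.mem_image, Arrow.mem_cut]
    simp only [Arrow.mem_cut]
    constructor
    · intro h; exact ⟨v - 1 - i, by omega, by omega⟩
    · rintro ⟨j, h, rfl⟩; omega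
  have hσ' : StrictAntiOn (v - 1 - ·) (Finset.range π'.weight : Set ℕ) := by
    intro a ha b hb h
    rw [Finset.mem_coe, Finset.mem_range] at ha hb
    simp only; omega
  have hσ := hσ'.injOn
  have key := sum_closed_eq π π' (boxArrows p v (p - 1) (v - 1)) ((-1) ^ π'.weight)
    (fun α => (v - α.1, v - 1 - α.2))
    (fun α => (v - α.1, v - 1 - α.2)) (v - 1 - ·) hσ hcut ?_ ?_ ?_ ?_ ?_
  · rw [← key, backwardSum]
    congr 1
    refine Finset.filter_congr fun D _ => ?_
    have e : v - 1 - π'.weight = p - 1 := by omega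
    simp only [rootArrow, Nat.sub_zero, e]
    exact ⟨fun h => (h.resolve_left (by omega)).2, fun h => Or.inr ⟨hp, h⟩⟩
  · intro α hα
    rw [mem_boxArrows] at hα ⊢
    exact ⟨by simp only; omega, Prod.ext (by simp only; omega) (by simp only; omega)⟩
  · intro α hα
    rw [mem_boxArrows] at hα ⊢
    exact ⟨by simp only; omega, Prod.ext (by simp only; omega) (by simp only; omega)⟩
  · intro α hα β hβ
    rw [mem_boxArrows] at hα hβ
    simp only [Arrow.Cross, Arrow.lo, Arrow.hi]; omega
  · intro D hD α hα
    have hne := regionSides_nonempty hpos hD hα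
    have hi := regionSides_image hpos hσ hcut hD hα
    have hs := regionSides_subset_range hpos hD hα
    have hbox := mem_boxArrows.mp (insert_rootArrow_subset hpos hD hα)
    have hb : Arrow.IsBackward (v - α.1, v - 1 - α.2) ↔ ¬ α.IsBackward := by
      simp only [Arrow.IsBackward]; omega
    obtain ⟨e1, e2⟩ := π.region_sides_eq (hi ▸ hne.image _)
    obtain ⟨e3, e4⟩ := π'.region_sides_eq hne
    refine ext_sides_root ?_ ?_
    · rw [e1, e3, hi, sort_image_of_strictAntiOn _ _ (hσ'.mono (Finset.coe_subset.mpr hs))]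
      simp only [hb, ite_not]
      split_ifs
      · rw [← List.map_reverse, List.map_map]
        refine List.map_congr_left fun i hi => hdeco i ?_
        have := hs ((Finset.mem_sort _).mp (List.mem_reverse.mp hi))
        exact (Finset.mem_range.mp this).le
      · rw [List.reverse_reverse, List.map_map]
        refine List.map_congr_left fun i hi => hdeco i ?_
        have := hs ((Finset.mem_sort _).mp hi)
        exact (Finset.mem_range.mp this).le
    · rw [e2, e4]; exact hdeco _ (by omega)
  · intro D hD
    have hr : rootArrow π'.weight ∉ D := by
      rw [dissections_eq, Finset.mem_filter] at hD; exact hD.2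
    have hs := insert_rootArrow_subset hpos hD
    -- The root arrow is forward, so it may be added at no cost, while its reflection is backward
    -- and carries a genuine sign. Over each region exactly one of the two signs is `(-1) ^ χ`, so
    -- their quotient is `(-1)` to the sum of all the weights; the regions partition the sides, so
    -- this sum is the weight of the polygon.
    have e1 : dissectionSign D = ∏ α ∈ insert (rootArrow π'.weight) D,
        if α.IsBackward then (-1) ^ (regionSides D α).card else 1 := by
      rw [Finset.prod_insert hr, if_neg (by
        simp only [rootArrow, Arrow.IsBackward]; omega), one_mul, dissectionSign]
    have e2 : (-1 : ℚ) ^ π'.weight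
        = (-1) ^ ∑ α ∈ insert (rootArrow π'.weight) D, (regionSides D α).card := by
      rw [sum_card_regionSides hpos hD]
    rw [e1, e2, ← Finset.prod_pow_eq_pow_sum, ← Finset.prod_mul_distrib, dissectionSign, Finset.prod_image]
    · refine Finset.prod_congr rfl fun α hα => ?_
      have hbox := mem_boxArrows.mp (hs hα)
      rw [regionSides_image hpos hσ hcut hD hα, Finset.card_image_of_injOn
        (hσ.mono (Finset.coe_subset.mpr (regionSides_subset_range hpos hD hα)))]
      have hb : Arrow.IsBackward (v - α.1, v - 1 - α.2) ↔ ¬ α.IsBackward := by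
        simp only [Arrow.IsBackward]; omega
      simp only [hb, ite_not]
      split_ifs
      · rw [← mul_pow]; norm_num
      · rw [mul_one]
    · intro α hα β hβ h
      have h1 := mem_boxArrows.mp (hs hα)
      have h2 := mem_boxArrows.mp (hs hβ)
      simp only [Prod.mk.injEq] at h
      exact Prod.ext (by omega) (by omega)

end Polygon

/-! ## Formal iterated integrals attached to a family of elements indexed by polygons -/

section Formal

theorem cutSum_congr {α M : Type*} [AddCommMonoid M] {φ ψ : List α → List α → M} {w : List α}
    (h : ∀ u v, u ++ v = w → φ u v = ψ u v) : cutSum φ w = cutSum ψ w :=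
  Finset.sum_congr rfl fun _ _ => h _ _ (List.take_append_drop _ _)

theorem cutSum_reverse {α M : Type*} [AddCommMonoid M] (φ : List α → List α → M) (w : List α) :
    cutSum φ w.reverse = cutSum (fun u v => φ v.reverse u.reverse) w := by
  induction w generalizing φ with
  | nil => simp [cutSum_nil]
  | cons x w ih =>
    rw [List.reverse_cons, cutSum_snoc, cutSum_cons, ih, add_comm]
    simp

theorem cutSum_delta_mul {α X : Type*} [CommRing X] [DecidablePred fun u : List α => u = []] (φ : List α → X)
    (w : List α) : cutSum (fun u v => (if u = [] then 1 else 0) * φ v) w = φ w := by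
  cases w with
  | nil => simp [cutSum_nil]
  | cons x w => rw [cutSum_cons]; simp [cutSum]

theorem cutSum_mul_delta {α X : Type*} [CommRing X] [DecidablePred fun u : List α => u = []] (φ : List α → X)
    (w : List α) : cutSum (fun u v => φ u * (if v = [] then 1 else 0)) w = φ w := by
  induction w generalizing φ with
  | nil => simp [cutSum_nil]
  | cons x w ih => rw [cutSum_cons, ih fun u => φ (x :: u)]; simp

variable {R Y : Type*} [CommRing Y] (b : Polygon R → Y)

/-- The analogue of `I(o; w; s)`, the base point `o` being `none`. -/
def formalEnd (w : List (Option R)) : Option R → Y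
  | none => if w = [] then 1 else 0
  | some r => if h : w = [] then 1 else b ⟨w.map (·.getD r), r, by simpa using h⟩

/-- The analogue of `I(a; w; s)`, defined by path composition through the base point. -/
def formalI (a : Option R) (w : List (Option R)) (s : Option R) : Y :=
  cutSum (fun u v => (-1) ^ u.length * formalEnd b u.reverse a * formalEnd b v s) w

theorem formalEnd_nil (s : Option R) : formalEnd b [] s = 1 := by
  cases s <;> simp [formalEnd]

theorem formalI_none_left (w : List (Option R)) (s : Option R) :
    formalI b none w s = formalEnd b w s := by
  rw [formalI, ← cutSum_delta_mul (fun v => formalEnd b v s) w]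
  refine cutSum_congr fun u v _ => ?_
  by_cases hu : u = [] <;> simp [formalEnd, hu]

theorem formalI_none_right (a : Option R) (w : List (Option R)) :
    formalI b a w none = (-1) ^ w.length * formalEnd b w.reverse a := by
  rw [formalI, ← cutSum_mul_delta (fun u => (-1) ^ u.length * formalEnd b u.reverse a) w]
  rfl

theorem formalI_path (a : Option R) (w : List (Option R)) (s : Option R) :
    formalI b a w s = cutSum (fun u v => formalI b a u none * formalI b none v s) w := by
  simp only [formalI_none_left, formalI_none_right]; rfl

/-- Inversion is built into the definition: reversing the word exchanges the two factors of each
term, and the signs differ by `(-1) ^ w.length`. -/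
theorem formalI_reverse (a : Option R) (w : List (Option R)) (s : Option R) :
    formalI b s w.reverse a = (-1) ^ w.length * formalI b a w s := by
  rw [formalI, formalI, cutSum_reverse, ← cutSum_mul_left]
  refine cutSum_congr fun u v h => ?_
  have e : (-1 : Y) ^ v.length = (-1) ^ w.length * (-1) ^ u.length := by
    rw [← h, List.length_append, pow_add, mul_comm, ← mul_assoc, ← mul_pow]; simp
  rw [List.length_reverse, List.reverse_reverse, e]; ring

theorem map_formalEnd {Z F : Type*} [CommRing Z] [FunLike F Y Z] [RingHomClass F Y Z] (f : F)
    (w : List (Option R)) (s : Option R) :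
    f (formalEnd b w s) = formalEnd (fun π => f (b π)) w s := by
  cases s with
  | none => simp only [formalEnd]; split_ifs <;> simp
  | some r => simp only [formalEnd]; split_ifs <;> simp

theorem map_formalI {Z F : Type*} [CommRing Z] [FunLike F Y Z] [RingHomClass F Y Z] (f : F)
    (a : Option R) (w : List (Option R)) (s : Option R) :
    f (formalI b a w s) = formalI (fun π => f (b π)) a w s := by
  simp only [formalI, map_cutSum, map_mul, map_pow, map_neg, map_one, map_formalEnd]

end Formal

/-! ## The recursion for `B(π)` -/

namespace Polygon

variable {R : Type*}

theorem noncrossing_empty : noncrossing ∅ = {∅} := by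
  ext D
  rw [mem_noncrossing, Finset.mem_singleton, Finset.subset_empty]
  constructor
  · exact fun h => h.1
  · rintro rfl; simp

theorem boxArrows_eq_empty_of_forward (m : ℕ) : boxArrows m m m m = ∅ := by
  ext α
  rw [mem_boxArrows]
  simp only [Finset.notMem_empty, iff_false]
  omega

theorem boxArrows_eq_empty_of_backward (p : ℕ) : boxArrows p p (p - 1) (p - 1) = ∅ := by
  ext α
  rw [mem_boxArrows]
  simp only [Finset.notMem_empty, iff_false]
  omega

/-- The decorations of the sides `p, …, p + k - 1`. -/
def decos (π : Polygon R) (p k : ℕ) : List (Option R) :=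
  (List.range' p k).map fun i => some (π.deco i)

/-- The decoration of the side before `p`, or the base point. -/
def decoBefore (π : Polygon R) : ℕ → Option R
  | 0 => none
  | p + 1 => some (π.deco p)

theorem decos_succ (π : Polygon R) (p k : ℕ) :
    π.decos p (k + 1) = some (π.deco p) :: π.decos (p + 1) k := by
  rw [decos, List.range'_succ]; rfl

theorem decos_concat (π : Polygon R) (p k : ℕ) :
    π.decos p (k + 1) = π.decos p k ++ [some (π.deco (p + k))] := by
  rw [decos, List.range'_concat, List.map_append, one_mul]; rfl

theorem length_decos (π : Polygon R) (p k : ℕ) : (π.decos p k).length = k := by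
  rw [decos, List.length_map, List.length_range']

theorem take_decos (π : Polygon R) {p k l : ℕ} (h : k ≤ l) :
    (π.decos p l).take k = π.decos p k := by
  obtain ⟨j, rfl⟩ := Nat.exists_eq_add_of_le h
  rw [decos, ← List.range'_append, List.map_append, List.take_left' (by simp), decos]

theorem drop_decos (π : Polygon R) (p k l : ℕ) :
    (π.decos p l).drop k = π.decos (p + k) (l - k) := by
  rw [decos, ← List.map_drop, List.drop_range', mul_one, decos]

theorem decos_map_getD (π : Polygon R) (p k : ℕ) (r : R) :
    (π.decos p k).map (·.getD r) = (List.range' p k).map π.deco := by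
  rw [decos, List.map_map]; rfl

theorem deco_weight (π : Polygon R) : π.deco π.weight = π.root := by
  rw [deco, weight, List.getD_eq_default _ _ le_rfl]

theorem decos_zero_weight (π : Polygon R) : π.decos 0 π.weight = π.sides.map some := by
  apply List.ext_getElem
  · simp [decos, weight]
  · intro i h1 h2
    simp only [decos, List.getElem_map, List.getElem_range', deco]
    simp at h2
    simp [h2]

/-- For `k = 0` there is no polygon; the only set of arrows is empty and gives `1`, the value of
`formalEnd` on the empty word. -/
theorem forwardSum_eq (π : Polygon R) (v k : ℕ) :
    π.forwardSum v (v + k) = formalEnd B (π.decos v k) (some (π.deco (v + k))) := by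
  rcases Nat.eq_zero_or_pos k with rfl | hk
  · rw [forwardSum, add_zero, boxArrows_eq_empty_of_forward, noncrossing_empty,
      Finset.filter_true_of_mem (by simp), Finset.sum_singleton, term_empty]
    exact (formalEnd_nil _ _).symm
  · have hne : π.decos v k ≠ [] := List.ne_nil_of_length_pos (by rwa [length_decos])
    rw [formalEnd, dif_neg hne]
    refine forwardSum_eq_B π _ ?_ ?_
    · simp only [weight, List.length_map, length_decos]
    · intro i hi
      simp only [weight, List.length_map, length_decos] at hi
      rcases hi.lt_or_eq with hi | rfl
      · simp [deco, decos_map_getD, hi]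
      · simp [deco, decos_map_getD]

theorem backwardSum_eq (π : Polygon R) (p k : ℕ) :
    π.backwardSum p (p + k)
      = (-1) ^ k * formalEnd B (π.decos p k).reverse (π.decoBefore p) := by
  rcases Nat.eq_zero_or_pos k with rfl | hk
  · rw [backwardSum, add_zero, boxArrows_eq_empty_of_backward, noncrossing_empty,
      Finset.filter_true_of_mem (by simp), Finset.sum_singleton, term_empty, pow_zero, one_mul]
    exact (formalEnd_nil _ _).symm
  have hne : (π.decos p k).reverse ≠ [] :=
    List.ne_nil_of_length_pos (by rwa [List.length_reverse, length_decos])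
  cases p with
  | zero =>
    -- Before the first vertex there is no side on which a backward arrow could end, so the sum is
    -- empty. This matches the vanishing of the loops at the base point.
    rw [backwardSum, Finset.filter_false_of_mem, Finset.sum_empty, decoBefore, formalEnd,
      if_neg hne, mul_zero]
    intro D _; omega
  | succ j =>
    rw [decoBefore, formalEnd, dif_neg hne]
    have hw : ∀ h, (⟨(π.decos (j + 1) k).reverse.map (·.getD (π.deco j)), π.deco j, h⟩ :
        Polygon R).weight = k := by
      intro h; simp only [weight, List.length_map, List.length_reverse, length_decos]
    rw [backwardSum_eq_B π _ (Nat.succ_pos j) (congrArg _ (hw _)), hw]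
    · rw [Algebra.smul_def, map_pow, map_neg, map_one]
    · intro i hi
      rw [hw] at hi
      rcases hi.lt_or_eq with hi | rfl
      · rw [deco, deco]
        simp only [List.map_reverse, decos_map_getD]
        rw [List.getD_eq_getElem?_getD, List.getD_eq_getElem?_getD, List.getElem?_reverse (by simpa)]
        simp only [List.length_map, List.length_range', List.getElem?_map]
        rw [List.getElem?_range' (by omega)]
        simp only [Option.map_some, Option.getD_some, deco, List.getD_eq_getElem?_getD]
        congr 2
        omega
      · have : j + 1 + i - 1 - i = j := by omega
        rw [this]
        simp [deco, decos_map_getD]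

/-- The vertex from which the outermost arrows of a gap start corresponds to the place where a path
is cut when it is composed through the base point. -/
theorem gapSum_eq_formalI (π : Polygon R) (p k : ℕ) :
    π.gapSum p (p + k) = formalI B (π.decoBefore p) (π.decos p k) (some (π.deco (p + k))) := by
  have e : Finset.Icc p (p + k) = Finset.Ico p (p + k + 1) := by
    ext i; rw [Finset.mem_Icc, Finset.mem_Ico]; omega
  rw [gapSum_eq π (Nat.le_add_right p k), e, Finset.sum_Ico_eq_sum_range, formalI, cutSum,
    length_decos]
  refine Finset.sum_congr (by congr 1; omega) fun i hi => ?_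
  rw [Finset.mem_range] at hi
  have h1 := π.forwardSum_eq (p + i) (k - i)
  rw [show p + i + (k - i) = p + k by omega] at h1
  rw [h1, backwardSum_eq, take_decos π (by omega), drop_decos, length_decos]

/-! ### Scanning the sides: which of them are exposed in the root region. -/

variable {X : Type*} [CommRing X]

/-- The decorations of the sides `i ≥ m` that are not cut off. -/
def exposed (π : Polygon R) (D : Finset Arrow) (m k : ℕ) : List (Option R) :=
  ((List.range' m k).filter fun i => ¬ Covered D i).map fun i => some (π.deco i)

/-- The sum over the sets of arrows between the side `p - 1` and the root side cutting off all the
sides `i` with `p ≤ i < m`. -/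
def tailSum (π : Polygon R) (c : Shuf (Polygon R) →+* X) (H : List (Option R) → X)
    (p m k : ℕ) : X :=
  ∑ D ∈ (noncrossing (boxArrows p (m + k) (p - 1) (m + k))).filter
    fun D => ∀ i ∈ Finset.Ico p m, Covered D i, c (π.term D) * H (π.exposed D m k)

theorem tailSum_zero (π : Polygon R) (c : Shuf (Polygon R) →+* X) (H : List (Option R) → X)
    (p m : ℕ) : π.tailSum c H p m 0 = H [] * c (π.gapSum p m) := by
  rw [tailSum, gapSum, map_sum, Finset.mul_sum]
  refine Finset.sum_congr rfl fun D _ => ?_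
  rw [mul_comm]; rfl

theorem covered_union {D E : Finset Arrow} {i : ℕ} :
    Covered (D ∪ E) i ↔ Covered D i ∨ Covered E i := by
  simp only [Covered, Finset.mem_union, or_and_right, exists_or]

theorem not_covered_of_box {D : Finset Arrow} {a b c d i : ℕ} (hD : D ⊆ boxArrows a b c d)
    (h : i < min a (c + 1) ∨ max b d ≤ i) : ¬ Covered D i := by
  rintro ⟨β, hβ, hi⟩
  have := Finset.mem_Ico.mp (Arrow.cut_subset_of_mem_boxArrows (hD hβ) hi)
  omega

/-- Side `m` either is cut off, and then it joins the current gap, or is exposed. In the second case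
no arrow passes over it, the arrows before and after it are independent, and a new gap starts. -/
theorem tailSum_succ (π : Polygon R) (c : Shuf (Polygon R) →+* X) (H : List (Option R) → X)
    {p m : ℕ} (hpm : p ≤ m) (k : ℕ) :
    π.tailSum c H p m (k + 1) = π.tailSum c H p (m + 1) k
      + c (π.gapSum p m)
        * π.tailSum c (fun l => H (some (π.deco m) :: l)) (m + 1) (m + 1) k := by
  rw [tailSum, ← Finset.sum_filter_add_sum_filter_not _ fun D => Covered D m]
  congr 1
  · rw [tailSum, Finset.filter_filter, show m + (k + 1) = m + 1 + k by omega]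
    refine Finset.sum_congr ?_ fun D hD => ?_
    · refine Finset.filter_congr fun D _ => ⟨fun h i hi => ?_, fun h => ⟨fun i hi => ?_, ?_⟩⟩
      · rw [Finset.mem_Ico] at hi
        rcases (Nat.lt_succ_iff.mp hi.2).lt_or_eq with h' | rfl
        · exact h.1 i (Finset.mem_Ico.mpr ⟨hi.1, h'⟩)
        · exact h.2
      · rw [Finset.mem_Ico] at hi
        exact h i (Finset.mem_Ico.mpr (by omega))
      · exact h m (Finset.mem_Ico.mpr (by omega))
    · have hm := (Finset.mem_filter.mp hD).2 m (Finset.mem_Ico.mpr (by omega))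
      rw [exposed, List.range'_succ, List.filter_cons_of_neg (by simpa using hm)]
      rfl
  · rw [gapSum, tailSum, map_sum, Finset.sum_mul_sum, ← Finset.sum_product', Finset.filter_filter]
    symm
    refine Finset.sum_nbij' (fun x => x.1 ∪ x.2) (fun D => (D ∩ boxArrows p m (p - 1) m,
      D ∩ boxArrows (m + 1) (m + 1 + k) (m + 1 - 1) (m + 1 + k))) ?_ ?_ ?_ ?_ ?_
    · rintro ⟨D, E⟩ hx
      simp only [Finset.mem_product, Finset.mem_filter, mem_noncrossing] at hx ⊢
      obtain ⟨⟨⟨hD, hcD⟩, hDc⟩, ⟨hE, hcE⟩, -⟩ := hx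
      have hbD := fun (α : Arrow) hα => mem_boxArrows.mp (@hD α hα)
      have hbE := fun (α : Arrow) hα => mem_boxArrows.mp (@hE α hα)
      refine ⟨⟨?_, ?_⟩, ?_, ?_⟩
      · intro α hα
        rw [mem_boxArrows]
        rcases Finset.mem_union.mp hα with hα | hα
        · have := hbD α hα; omega
        · have := hbE α hα; omega
      · have key : ∀ α ∈ D, ∀ β ∈ E, ¬ Arrow.Cross α β ∧ ¬ Arrow.Cross β α := by
          intro α hα β hβ
          have h1 := hbD α hα
          have h2 := hbE β hβ
          simp only [Arrow.Cross, Arrow.lo, Arrow.hi]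
          omega
        intro α hα β hβ
        rcases Finset.mem_union.mp hα with hα | hα <;> rcases Finset.mem_union.mp hβ with hβ | hβ
        · exact hcD α hα β hβ
        · exact (key α hα β hβ).1
        · exact (key β hβ α hα).2
        · exact hcE α hα β hβ
      · exact fun i hi => covered_union.mpr (Or.inl (hDc i hi))
      · rw [covered_union, not_or]
        exact ⟨not_covered_of_box hD (by omega), not_covered_of_box hE (by omega)⟩
    · intro D hD
      simp only [Finset.mem_product, Finset.mem_filter, mem_noncrossing] at hD ⊢
      obtain ⟨⟨hD, hc⟩, hcov, hm⟩ := hD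
      refine ⟨⟨⟨Finset.inter_subset_right, fun α hα β hβ => hc α (Finset.mem_inter.mp hα).1 β
        (Finset.mem_inter.mp hβ).1⟩, fun i hi => ?_⟩, ⟨Finset.inter_subset_right,
          fun α hα β hβ => hc α (Finset.mem_inter.mp hα).1 β (Finset.mem_inter.mp hβ).1⟩,
          fun i hi => by rw [Finset.mem_Ico] at hi; omega⟩
      obtain ⟨β, hβ, hi'⟩ := hcov i hi
      refine ⟨β, Finset.mem_inter.mpr ⟨hβ, ?_⟩, hi'⟩
      -- An arrow that cuts off a side before `m` but not `m` itself cannot reach past side `m`, so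
      -- it lies in the left box. Ending on side `m` is allowed.
      have h1 := mem_boxArrows.mp (hD hβ)
      have h2 : ¬ m ∈ β.cut := fun h => hm ⟨β, hβ, h⟩
      rw [Finset.mem_Ico] at hi
      rw [Arrow.mem_cut] at h2 hi'
      rw [mem_boxArrows]
      omega
    · rintro ⟨D, E⟩ hx
      simp only [Finset.mem_product, Finset.mem_filter, mem_noncrossing] at hx
      obtain ⟨⟨⟨hD, -⟩, -⟩, ⟨hE, -⟩, -⟩ := hx
      have hbD := fun (α : Arrow) hα => mem_boxArrows.mp (@hD α hα)
      have hbE := fun (α : Arrow) hα => mem_boxArrows.mp (@hE α hα)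
      refine Prod.ext ?_ ?_
      · ext α
        simp only [Finset.mem_inter, Finset.mem_union, mem_boxArrows]
        refine ⟨fun h => h.1.resolve_right fun h' => ?_, fun h => ⟨Or.inl h, hbD α h⟩⟩
        have := hbE α h'
        omega
      · ext α
        simp only [Finset.mem_inter, Finset.mem_union, mem_boxArrows]
        refine ⟨fun h => h.1.resolve_left fun h' => ?_, fun h => ⟨Or.inr h, hbE α h⟩⟩
        have := hbD α h'
        omega
    · intro D hD
      simp only [Finset.mem_filter, mem_noncrossing] at hD
      obtain ⟨⟨hD, hc⟩, hcov, hm⟩ := hD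
      simp only
      rw [← Finset.inter_union_distrib_left, Finset.inter_eq_left]
      intro α hα
      have h1 := mem_boxArrows.mp (hD hα)
      have h2 : ¬ m ∈ α.cut := fun h => hm ⟨α, hα, h⟩
      rw [Arrow.mem_cut] at h2
      rw [Finset.mem_union, mem_boxArrows, mem_boxArrows]
      omega
    · rintro ⟨D, E⟩ hx
      simp only [Finset.mem_product, Finset.mem_filter, mem_noncrossing] at hx ⊢
      obtain ⟨⟨⟨hD, -⟩, hDc⟩, ⟨hE, -⟩, -⟩ := hx
      have hm : ¬ Covered (D ∪ E) m := by
        rw [covered_union, not_or]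
        exact ⟨not_covered_of_box hD (by omega), not_covered_of_box hE (by omega)⟩
      have he : π.exposed (D ∪ E) m (k + 1) = some (π.deco m) :: π.exposed E (m + 1) k := by
        rw [exposed, List.range'_succ, List.filter_cons_of_pos (by simpa using hm), List.map_cons,
          exposed]
        congr 2
        refine List.filter_congr fun i hi => ?_
        rw [List.mem_range'_1] at hi
        rw [decide_eq_decide, covered_union, or_iff_right (not_covered_of_box hD (by omega))]
      rw [he, π.term_union_of_box hD hE (by omega), map_mul, mul_assoc]

/-- The alternative for each side is the recursion defining `selSumAt`: letters that are cut off
accumulate in the current gap, exposed ones are selected. The map `c` leaves room for values in the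
square-zero extension used below. -/
theorem tailSum_eq_selSumAt (π : Polygon R) (c : Shuf (Polygon R) →+* X) {n : ℕ} (k : ℕ)
    (H : List (Option R) → X) {p m : ℕ} (hpm : p ≤ m) (hn : m + k = n) :
    π.tailSum c H p m k = selSumAt (fun a u s => c (formalI B a u s)) H
      (fun a u => c (formalI B a u (some (π.deco n)))) (π.decoBefore p) (π.decos p (m - p))
      (π.decos m k) := by
  induction k generalizing H p m with
  | zero =>
    obtain ⟨j, rfl⟩ := Nat.exists_eq_add_of_le hpm
    rw [add_zero] at hn
    rw [tailSum_zero, gapSum_eq_formalI, show π.decos (p + j) 0 = [] from rfl, selSumAt_nil,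
      Nat.add_sub_cancel_left, hn]
  | succ k ih =>
    rw [tailSum_succ π c H hpm, decos_succ, selSumAt_cons, ih _ (by omega) (by omega),
      ih _ le_rfl (by omega), Nat.succ_sub hpm, decos_concat, Nat.sub_self]
    obtain ⟨j, rfl⟩ := Nat.exists_eq_add_of_le hpm
    rw [gapSum_eq_formalI, Nat.add_sub_cancel_left]
    rfl

end Polygon

/-! ## Operator valued sums over subsequences -/

section SelSumOp

variable {S Y Z : Type*} [CommRing Y] [AddCommGroup Z]

/-- The sum over the selected subsequences of `w`, an additive map depending on the subsequence
being applied to the product over the gaps. -/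
def selSumOp (f : List S → Y →+ Z) (g : S → List S → S → Y) (a : S) (w : List S) (b : S) : Z :=
  ((splits w).map fun p => f (p.2.map Prod.fst) (gapProd g a p.1 p.2 b)).sum

/-- Reading off the value of a family of operators from the square-zero extension by the free module
on the operators. -/
def readOff (f : List S → Y →+ Z) : TrivSqZeroExt Y (List S →₀ Y) →+ Z :=
  (Finsupp.liftAddHom f).comp (TrivSqZeroExt.sndHom Y (List S →₀ Y)).toAddMonoidHom

/-- In the square-zero extension, multiplying the generator of the operator `l` by the scalar `y`
records the pair `(l, y)`, which is then evaluated. -/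
theorem readOff_mul (f : List S → Y →+ Z) (y : Y) (l : List S) :
    readOff f (TrivSqZeroExt.inr (Finsupp.single l 1) * TrivSqZeroExt.inl y) = f l y := by
  simp [readOff]

/-- Prefixing a letter is not multiplication by a ring element, so `selSumAt` does not apply
directly. Encoding the operators in a square-zero extension makes its identities available for
operator valued sums. -/
theorem selSumOp_eq_readOff (f : List S → Y →+ Z) (g : S → List S → S → Y) (a : S) (w : List S)
    (b : S) : selSumOp f g a w b = readOff f (selSumAt
      (fun a u s => TrivSqZeroExt.inlHom Y (List S →₀ Y) (g a u s))
      (fun l => TrivSqZeroExt.inr (Finsupp.single l 1))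
      (fun s v => TrivSqZeroExt.inlHom Y (List S →₀ Y) (g s v b)) a [] w) := by
  rw [selSumAt_eq (fun a u s => TrivSqZeroExt.inlHom Y (List S →₀ Y) (g a u s)), map_list_sum,
    selSumOp, List.map_map]
  congr 1
  refine List.map_congr_left fun p _ => ?_
  rw [Function.comp_apply, List.nil_append,
    ← IterInt.map_gapProd (TrivSqZeroExt.inlHom Y (List S →₀ Y)) g]
  exact (readOff_mul f _ _).symm

end SelSumOp

/-! ### `B(π)` as a sum of prefixed letters over subsequences of sides. -/

namespace Polygon

variable {R : Type*}

open Classical in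
/-- Prefixing the letter given by the selected sides, if there are any. -/
def letterOp (r : R) (l : List (Option R)) : Shuf (Polygon R) →+ Shuf (Polygon R) :=
  if h : l = [] then 0 else
    (Shuf.consL (⟨l.map (·.getD r), r, by simpa using h⟩ : Polygon R)).toAddMonoidHom

/-- The recursion for `B(π)`. -/
theorem B_eq_selSumOp (π : Polygon R) :
    π.B = selSumOp (letterOp π.root) (formalI B) none (π.sides.map some) (some π.root) := by
  have h := π.tailSum_eq_selSumAt (TrivSqZeroExt.inlHom (Shuf (Polygon R))
    (List (Option R) →₀ Shuf (Polygon R))) π.weight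
    (fun l => TrivSqZeroExt.inr (Finsupp.single l 1)) (le_refl 0) (zero_add _)
  rw [selSumOp_eq_readOff, ← decos_zero_weight, ← deco_weight]
  refine Eq.trans ?_ (congrArg (readOff (letterOp (π.deco π.weight))) h)
  rw [tailSum, map_sum, Finset.filter_true_of_mem (by simp), zero_add, Nat.zero_sub,
    -- The scan also counts the sets containing the root arrow, which are not dissections. They
    -- expose no side, and `letterOp` kills the empty selection, so they drop out.
    ← Finset.sum_filter_add_sum_filter_not (noncrossing _) fun D => rootArrow π.weight ∉ D,
    ← dissections_eq, B_eq_consL]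
  have hexp : ∀ D, π.exposed D 0 π.weight
      = ((List.range π.weight).filter fun i => ¬ Covered D i).map fun i => some (π.deco i) := by
    intro D; rw [exposed, List.range_eq_range']
  rw [Finset.sum_eq_zero (s := Finset.filter _ _), add_zero]
  · refine Finset.sum_congr rfl fun D hD => ?_
    have hne := regionSides_nonempty π.weight_pos hD (Finset.mem_insert_self _ _)
    -- Every arrow of `D` lies below the root arrow, so the sides of the root region are exactly
    -- those that no arrow cuts off.
    have hsort : (regionSides D (rootArrow π.weight)).sort (· ≤ ·)
        = (List.range π.weight).filter fun i => ¬ Covered D i := by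
      refine List.Perm.eq_of_pairwise' (r := (· ≤ ·)) (Finset.pairwise_sort _ _)
        (List.Pairwise.filter _ List.pairwise_le_range) ?_
      rw [List.perm_ext_iff_of_nodup (Finset.sort_nodup _ _) (List.nodup_range.filter _)]
      intro i
      rw [Finset.mem_sort, List.mem_filter, regionSides, Finset.mem_filter, Arrow.cut_rootArrow,
        Finset.mem_range, List.mem_range, decide_eq_true_iff, Covered]
      push Not
      exact and_congr_right fun _ => ⟨fun H β hβ => H β hβ
        (below_rootArrow_of_mem_dissections hD hβ), fun H β hβ _ => H β hβ⟩
    obtain ⟨e1, e2⟩ := π.region_sides_eq hne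
    rw [if_neg (by simp only [rootArrow, Arrow.IsBackward]; omega), hsort] at e1
    rw [mul_comm, TrivSqZeroExt.inlHom_apply, readOff_mul, letterOp]
    have hex : (π.exposed D 0 π.weight).map (·.getD (π.deco π.weight))
        = (π.region D (rootArrow π.weight)).sides := by
      rw [e1, hexp, List.map_map]; rfl
    rw [dif_neg]
    · change _ = Shuf.consL _ _
      congr 2
      exact ext_sides_root hex.symm e2
    · intro h0
      rw [h0] at hex
      exact (π.region D _).sides_ne hex.symm
  · intro D hD
    obtain ⟨-, hD⟩ := Finset.mem_filter.mp hD
    rw [not_not] at hD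
    have : π.exposed D 0 π.weight = [] := by
      rw [hexp, List.map_eq_nil_iff, List.filter_eq_nil_iff]
      intro i hi
      rw [List.mem_range] at hi
      rw [decide_eq_true_iff, not_not]
      exact ⟨_, hD, by rw [Arrow.cut_rootArrow]; exact Finset.mem_range.mpr hi⟩
    rw [this, mul_comm, TrivSqZeroExt.inlHom_apply, readOff_mul, letterOp, dif_pos rfl]
    rfl

end Polygon

/-! ## The coproduct of `B(π)` -/

section Splits

variable {S : Type*}

theorem mem_of_mem_splits {w : List S} {p : List S × List (S × List S)} (hp : p ∈ splits w) :
    (∀ x ∈ p.1, x ∈ w) ∧ ∀ q ∈ p.2, q.1 ∈ w ∧ ∀ x ∈ q.2, x ∈ w := by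
  induction w generalizing p with
  | nil =>
    obtain rfl : p = ([], []) := by simpa [splits] using hp
    simp
  | cons y w ih =>
    rw [splits, List.mem_append, List.mem_map, List.mem_map] at hp
    rcases hp with ⟨q, hq, rfl⟩ | ⟨q, hq, rfl⟩
    · obtain ⟨h1, h2⟩ := ih hq
      refine ⟨fun x hx => ?_, fun r hr => ⟨List.mem_cons_of_mem _ (h2 r hr).1,
        fun x hx => List.mem_cons_of_mem _ ((h2 r hr).2 x hx)⟩⟩
      rcases List.mem_cons.mp hx with rfl | hx
      · exact List.mem_cons_self
      · exact List.mem_cons_of_mem _ (h1 x hx)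
    · obtain ⟨h1, h2⟩ := ih hq
      refine ⟨by simp, fun r hr => ?_⟩
      rcases List.mem_cons.mp hr with rfl | hr
      · exact ⟨List.mem_cons_self, fun x hx => List.mem_cons_of_mem _ (h1 x hx)⟩
      · exact ⟨List.mem_cons_of_mem _ (h2 r hr).1,
          fun x hx => List.mem_cons_of_mem _ ((h2 r hr).2 x hx)⟩

variable {Y : Type*} [CommRing Y]

/-- Keeps track of lengths: once some letter is selected, every gap is strictly shorter than the
whole word. The word `u` is the part of the current gap already read. -/
theorem gapProd_congr_aux {g g' : S → List S → S → Y} {P : S → Prop} {N : ℕ} (b : S)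
    (h : ∀ a u s, (∀ x ∈ u, P x) → u.length < N → g a u s = g' a u s) {w : List S}
    (hw : ∀ x ∈ w, P x) {u : List S} (hu : ∀ x ∈ u, P x) (a : S)
    {p : List S × List (S × List S)} (hp : p ∈ splits w)
    (hN : u.length + w.length < N ∨ (p.2 ≠ [] ∧ u.length + w.length ≤ N)) :
    gapProd g a (u ++ p.1) p.2 b = gapProd g' a (u ++ p.1) p.2 b := by
  induction w generalizing u a p with
  | nil =>
    obtain rfl : p = ([], []) := by simpa [splits] using hp
    simp only [List.append_nil, gapProd]
    refine h a u b hu ?_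
    simpa using hN
  | cons y w ih =>
    have hy := hw y List.mem_cons_self
    have hw' := fun x hx => hw x (List.mem_cons_of_mem y hx)
    rw [splits, List.mem_append, List.mem_map, List.mem_map] at hp
    rw [List.length_cons] at hN
    rcases hp with ⟨q, hq, rfl⟩ | ⟨q, hq, rfl⟩
    · have := ih hw' (u := u ++ [y]) (fun x hx => ?_) a hq ?_
      · simpa using this
      · rcases List.mem_append.mp hx with hx | hx
        · exact hu x hx
        · rw [List.mem_singleton.mp hx]; exact hy
      · simp only [List.length_append, List.length_singleton]
        rcases hN with hN | hN
        · left; omega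
        · exact Or.inr ⟨hN.1, by omega⟩
    · have h1 := ih hw' (u := []) (by simp) y hq
        (Or.inl (by simp only [List.length_nil]; omega))
      simp only [List.nil_append] at h1
      simp only [List.append_nil, gapProd]
      rw [h1, h a u y hu (by omega)]

theorem gapProd_congr {g g' : S → List S → S → Y} {P : S → Prop} (b : S)
    (h : ∀ a u s, (∀ x ∈ u, P x) → g a u s = g' a u s) {w : List S}
    (hw : ∀ x ∈ w, P x) (a : S) {p : List S × List (S × List S)} (hp : p ∈ splits w) :
    gapProd g a p.1 p.2 b = gapProd g' a p.1 p.2 b :=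
  gapProd_congr_aux (u := []) b (N := w.length + 1) (fun a u s hu _ => h a u s hu) hw (by simp) a hp
    (Or.inl (by simp only [List.length_nil]; omega))

/-- As `f []` vanishes, only selections with at least one letter count, and their gaps are shorter
than `w`. This is what lets an induction on length run through the recursion for `B(π)`. -/
theorem selSumOp_congr {Z : Type*} [AddCommGroup Z] {f : List S → Y →+ Z} (hf : f [] = 0)
    {g g' : S → List S → S → Y} {P : S → Prop} (b : S) {w : List S}
    (h : ∀ a u s, (∀ x ∈ u, P x) → u.length < w.length → g a u s = g' a u s)
    (hw : ∀ x ∈ w, P x) (a : S) : selSumOp f g a w b = selSumOp f g' a w b := by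
  rw [selSumOp, selSumOp]
  congr 1
  refine List.map_congr_left fun p hp => ?_
  by_cases h0 : p.2 = []
  · simp [h0, hf]
  · congr 1
    exact gapProd_congr_aux (u := []) b h hw (by simp) a hp (Or.inr ⟨h0, by simp⟩)

theorem selSumAt_congr_left {P : S → Prop} (g : S → List S → S → Y) {F F' : List S → Y}
    (h : ∀ l, (∀ x ∈ l, P x) → F l = F' l) (a : S) {w : List S} (hw : ∀ x ∈ w, P x) (b : S) :
    selSumAt g F (fun s v => g s v b) a [] w = selSumAt g F' (fun s v => g s v b) a [] w := by
  rw [selSumAt_eq, selSumAt_eq]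
  congr 1
  refine List.map_congr_left fun p hp => ?_
  rw [h]
  intro x hx
  obtain ⟨q, hq, rfl⟩ := List.mem_map.mp hx
  exact hw _ ((mem_of_mem_splits hp).2 q hq).1

/-- `T` need not be multiplicative; it suffices that it is linear with respect to the gap factors.
-/
theorem map_selSumAt_of_mul {X : Type*} [CommRing X] (T : X →+ Y) (g : S → List S → S → X)
    (g' : S → List S → S → Y) (F : List S → X) (k : S → List S → X) (k' : S → List S → Y)
    (hg : ∀ a u s x, T (g a u s * x) = g' a u s * T x)
    (hk : ∀ a u x, T (x * k a u) = T x * k' a u) (a : S) (u w : List S) :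
    T (selSumAt g F k a u w) = selSumAt g' (fun l => T (F l)) k' a u w := by
  induction w generalizing F a u with
  | nil => rw [selSumAt_nil, selSumAt_nil, hk]
  | cons x w ih => rw [selSumAt_cons, selSumAt_cons, map_add, hg, ih, ih]

/-- Choosing a subsequence of a subsequence amounts to choosing first the smaller one and then
refining each of its gaps. The operators commute with the outer gap factors, so `selSumAt_assoc` can
be read off through the square-zero extension. -/
theorem selSumOp_assoc (f : List S → Y →+ Y) (g₂ g₃ : S → List S → S → Y)
    (hf : ∀ l a u s y, f l (g₃ a u s * y) = g₃ a u s * f l y) (a : S) (w : List S) (b : S) :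
    selSumOp f (fun a w b => selSumAt g₃ (fun l => g₂ a l b) (fun s t => g₃ s t b) a [] w) a w b
      = selSumAt g₃ (fun l => selSumOp f g₂ a l b) (fun s t => g₃ s t b) a [] w := by
  have hr : ∀ a u s x, readOff f (TrivSqZeroExt.inlHom Y (List S →₀ Y) (g₃ a u s) * x)
      = g₃ a u s * readOff f x := by
    intro a u s x
    have : (TrivSqZeroExt.inlHom Y (List S →₀ Y) (g₃ a u s) * x).snd = g₃ a u s • x.snd := by
      simp
    change Finsupp.liftAddHom f _ = g₃ a u s * Finsupp.liftAddHom f x.snd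
    change Finsupp.liftAddHom f (TrivSqZeroExt.snd _) = _
    rw [this]
    induction x.snd using Finsupp.induction_linear with
    | zero => simp
    | add x y hx hy => rw [smul_add, map_add, map_add, hx, hy, mul_add]
    | single l y =>
      rw [Finsupp.smul_single, Finsupp.liftAddHom_apply_single, Finsupp.liftAddHom_apply_single,
        smul_eq_mul, hf]
  rw [selSumOp_eq_readOff]
  simp only [map_selSumAt]
  rw [← selSumAt_assoc, map_selSumAt_of_mul (readOff f) _ g₃ _ _ (fun s t => g₃ s t b) hr
    (fun a u x => by rw [mul_comm, hr, mul_comm])]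
  simp only [← selSumOp_eq_readOff]

end Splits

/-- Goncharov's formula for the coproduct of `formalI`. -/
def formalComul {R Y : Type*} [CommRing Y] [Algebra ℚ Y] (b : Polygon R → Y) (a : Option R)
    (w : List (Option R)) (s : Option R) : Y ⊗[ℚ] Y :=
  selSumAt (fun a u s => 1 ⊗ₜ[ℚ] formalI b a u s) (fun l => formalI b a l s ⊗ₜ[ℚ] 1)
    (fun x v => 1 ⊗ₜ[ℚ] formalI b x v s) a [] w

section FormalComul

variable {R Y : Type*} [CommRing Y] [Algebra ℚ Y] (b : Polygon R → Y)

theorem includeRight_formalI (a : Option R) (u : List (Option R)) (s : Option R) :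
    (1 : Y) ⊗ₜ[ℚ] formalI b a u s = formalI (fun π => (1 : Y) ⊗ₜ[ℚ] b π) a u s :=
  map_formalI b (Algebra.TensorProduct.includeRight : Y →ₐ[ℚ] Y ⊗[ℚ] Y) a u s

theorem includeLeft_formalI (a : Option R) (u : List (Option R)) (s : Option R) :
    formalI b a u s ⊗ₜ[ℚ] (1 : Y) = formalI (fun π => b π ⊗ₜ[ℚ] (1 : Y)) a u s :=
  map_formalI b (Algebra.TensorProduct.includeLeft : Y →ₐ[ℚ] Y ⊗[ℚ] Y) a u s

/-- The proof used for `comulI` only composes paths through the chosen point, and for the point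
`none` the formal symbols do satisfy path composition. -/
theorem formalComul_path (a : Option R) (w : List (Option R)) (s : Option R) :
    formalComul b a w s
      = cutSum (fun u v => formalComul b a u none * formalComul b none v s) w := by
  simp only [formalComul, includeRight_formalI, includeLeft_formalI]
  rw [← selSumAt_path _ none s fun a u s => formalI_path _ a u s]
  congr 1
  funext l
  exact formalI_path _ a l s

theorem formalComul_reverse (a : Option R) (w : List (Option R)) (s : Option R) :
    formalComul b s w.reverse a = (-1) ^ w.length * formalComul b a w s := by
  simp only [formalComul, includeRight_formalI, includeLeft_formalI]
  set r := formalI (fun π => (1 : Y) ⊗ₜ[ℚ] b π) with hr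
  set l := formalI (fun π => b π ⊗ₜ[ℚ] (1 : Y)) with hl
  have h := selSumAt_reverse r (fun v => l s v a) s a [] w.reverse
  have h' := selSumAt_sign r (fun v => l a v s) (fun x v => r x v s) a [] w
  simp only [List.append_nil, List.reverse_reverse, List.reverse_nil] at h
  rw [List.length_nil, Nat.zero_add] at h'
  rw [h, ← h']
  congr 1
  · funext x v t; exact formalI_reverse _ x v t
  · funext v; exact formalI_reverse _ a v s
  · funext x v; exact formalI_reverse _ x v s

/-- In the left factor the loop at the base point kills every non-empty selection. What remains is
the loop on the whole word in the right factor. -/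
theorem formalComul_none (w : List (Option R)) :
    formalComul b none w none = if w = [] then 1 else 0 := by
  have h1 : ∀ l : List (Option R), formalI b none l none ⊗ₜ[ℚ] (1 : Y) = if l = [] then 1 else 0 := by
    intro l
    rw [formalI_none_left, formalEnd]
    split_ifs
    · rfl
    · exact TensorProduct.zero_tmul _ _
  simp only [formalComul, includeRight_formalI, h1]
  have := selSumAt_counit_left (fun a u s => formalI (fun π => (1 : Y) ⊗ₜ[ℚ] b π) a u s)
    (fun x v => formalI (fun π => (1 : Y) ⊗ₜ[ℚ] b π) x v none) none [] w
  rw [formalI_none_left] at this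
  simpa [formalEnd] using this

theorem map_formalComul {Z : Type*} [CommRing Z] [Algebra ℚ Z] (f : Y →ₐ[ℚ] Z) (a : Option R)
    (w : List (Option R)) (s : Option R) :
    Algebra.TensorProduct.map f f (formalComul b a w s)
      = formalComul (fun π => f (b π)) a w s := by
  rw [formalComul, map_selSumAt, formalComul]
  simp only [Algebra.TensorProduct.map_tmul, map_formalI, map_one]

end FormalComul

/-! ### Goncharov's formula for the coproduct of the `B(π)`. -/

namespace Polygon

variable {R : Type*}

/-- `formalI` is a polynomial in values of `formalEnd` on words that are no longer, and the
conjectured coproduct obeys the same path composition and inversion. The formula for paths from the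
base point therefore implies it for all paths. -/
theorem comul_formalI_of_formalEnd {N : ℕ}
    (h : ∀ v : List (Option R), (∀ x ∈ v, x.isSome) → v.length < N → ∀ s,
      Shuf.comulHom (formalEnd B v s) = formalComul B none v s)
    (a : Option R) {w : List (Option R)} (hw : ∀ x ∈ w, x.isSome) (hN : w.length < N)
    (s : Option R) : Shuf.comulHom (formalI B a w s) = formalComul B a w s := by
  rw [formalComul_path, formalI, map_cutSum]
  refine cutSum_congr fun u v huv => ?_
  have hu : ∀ x ∈ u.reverse, x.isSome := fun x hx =>
    hw x (huv ▸ List.mem_append_left v (List.mem_reverse.mp hx))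
  have hv : ∀ x ∈ v, x.isSome := fun x hx => hw x (huv ▸ List.mem_append_right u hx)
  have hl : u.length + v.length = w.length := by rw [← huv, List.length_append]
  have hr := formalComul_reverse B none u.reverse a
  rw [List.reverse_reverse, List.length_reverse] at hr
  rw [map_mul, map_mul, map_pow, map_neg, map_one,
    h u.reverse hu (by rw [List.length_reverse]; omega), h v hv (by omega), hr]

/-- The part of the coproduct of `letterOp r l` with a non-trivial left factor. -/
def letterOpLeft (r : R) (l : List (Option R)) :
    Shuf (Polygon R) ⊗[ℚ] Shuf (Polygon R) →+ Shuf (Polygon R) ⊗[ℚ] Shuf (Polygon R) :=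
  open Classical in
  if h : l = [] then 0 else (TensorProduct.map
    (Shuf.consL (⟨l.map (·.getD r), r, by simpa using h⟩ : Polygon R))
    LinearMap.id).toAddMonoidHom

theorem letterOp_nil (r : R) : letterOp r [] = 0 := dif_pos rfl

theorem letterOpLeft_nil (r : R) : letterOpLeft r [] = 0 := dif_pos rfl

theorem comul_letterOp (r : R) (l : List (Option R)) (y : Shuf (Polygon R)) :
    Shuf.comulHom (letterOp r l y)
      = 1 ⊗ₜ letterOp r l y + letterOpLeft r l (Shuf.comulHom y) := by
  rw [letterOp, letterOpLeft]
  split_ifs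
  · simp
  · exact Shuf.comulL_consL _ y

theorem letterOpLeft_tmul_mul (r : R) (l : List (Option R)) (y : Shuf (Polygon R))
    (x : Shuf (Polygon R) ⊗[ℚ] Shuf (Polygon R)) :
    letterOpLeft r l ((1 ⊗ₜ y) * x) = (1 ⊗ₜ y) * letterOpLeft r l x := by
  rw [letterOpLeft]
  split_ifs
  · simp
  · have := Shuf.map_consL_mul_one_tmul
      (⟨l.map (·.getD r), r, by simpa using ‹l ≠ []›⟩ : Polygon R) x y
    rw [mul_comm]
    exact this.trans (mul_comm _ _)

theorem letterOpLeft_tmul_one (r : R) (l : List (Option R)) (y : Shuf (Polygon R)) :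
    letterOpLeft r l (y ⊗ₜ 1) = letterOp r l y ⊗ₜ 1 := by
  rw [letterOpLeft, letterOp]
  split_ifs
  · simp
  · simp

/-- `formalEnd` fills occurrences of the base point inside a word by a default decoration; on words
without base point nothing is altered. -/
theorem map_some_of_isSome {α : Type*} {w : List (Option α)} (hw : ∀ x ∈ w, x.isSome) (r : α) :
    (w.map (·.getD r)).map some = w := by
  rw [List.map_map]
  conv_rhs => rw [← List.map_id w]
  refine List.map_congr_left fun x hx => ?_
  obtain ⟨y, rfl⟩ := Option.isSome_iff_exists.mp (hw x hx)
  rfl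

/-- The recursion for `B(π)` in terms of `formalEnd`. The correction is needed because the empty
word has value `1` but is not the sum of any prefixed words. -/
theorem selSumOp_letterOp {w : List (Option R)} (hw : ∀ x ∈ w, x.isSome) (r : R) :
    selSumOp (letterOp r) (formalI B) none w (some r)
      = formalEnd B w (some r) - if w = [] then 1 else 0 := by
  by_cases h : w = []
  · subst h
    simp [selSumOp, splits, letterOp_nil, formalEnd]
  · rw [formalEnd, dif_neg h, B_eq_selSumOp, if_neg h, sub_zero]
    simp only
    rw [map_some_of_isSome hw]

theorem comul_selSumOp_letterOp (r : R) (g : Option R → List (Option R) → Option R → Shuf (Polygon R))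
    (a : Option R) (w : List (Option R)) (b : Option R) :
    Shuf.comulHom (selSumOp (letterOp r) g a w b)
      = 1 ⊗ₜ selSumOp (letterOp r) g a w b
        + selSumOp (letterOpLeft r) (fun a u s => Shuf.comulHom (g a u s)) a w b := by
  simp only [selSumOp]
  induction splits w with
  | nil => simp
  | cons p m ih =>
    simp only [List.map_cons, List.sum_cons, map_add, TensorProduct.tmul_add, ih, comul_letterOp,
      IterInt.map_gapProd]
    abel

theorem selSumOp_letterOpLeft (r : R) (a : Option R) (w : List (Option R)) (b : Option R) :
    selSumOp (letterOpLeft r) (fun a u s => formalI B a u s ⊗ₜ[ℚ] 1) a w b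
      = selSumOp (letterOp r) (formalI B) a w b ⊗ₜ 1 := by
  have h : ∀ p : List (Option R) × List (Option R × List (Option R)),
      gapProd (fun a u s => formalI B a u s ⊗ₜ[ℚ] (1 : Shuf (Polygon R))) a p.1 p.2 b
        = gapProd (formalI B) a p.1 p.2 b ⊗ₜ 1 := fun p =>
    (IterInt.map_gapProd (Algebra.TensorProduct.includeLeft :
      Shuf (Polygon R) →ₐ[ℚ] Shuf (Polygon R) ⊗[ℚ] Shuf (Polygon R)) (formalI B) a p.1 p.2 b).symm
  simp only [selSumOp, h, letterOpLeft_tmul_one]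
  induction splits w with
  | nil => simp
  | cons p m ih => simp only [List.map_cons, List.sum_cons, TensorProduct.add_tmul, ih]

/-- The coproduct of `B(π)` is given by Goncharov's formula. -/
theorem comul_formalEnd (v : List (Option R)) (hv : ∀ x ∈ v, x.isSome) (s : Option R) :
    Shuf.comulHom (formalEnd B v s) = formalComul B none v s := by
  obtain ⟨N, hN⟩ : ∃ N, v.length = N := ⟨_, rfl⟩
  induction N using Nat.strong_induction_on generalizing v s with
  | _ N ih =>
    cases s with
    | none =>
      rw [formalComul_none, formalEnd]
      split_ifs <;> simp
    | some r =>
      have hi : ∀ a u s, (∀ x ∈ u, x.isSome) → u.length < v.length →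
          Shuf.comulHom (formalI B a u s) = formalComul B a u s := fun a u s hu hl =>
        comul_formalI_of_formalEnd (N := v.length)
          (fun v' hv' hl' s => ih v'.length (hN ▸ hl') v' hv' s rfl) a hu hl s
      set X := selSumOp (letterOp r) (formalI B) none v (some r) with hX
      have e0 : formalEnd B v (some r) = X + if v = [] then 1 else 0 := by
        rw [hX, selSumOp_letterOp hv, sub_add_cancel]
      have e1 := comul_selSumOp_letterOp r (formalI B) none v (some r)
      -- All gaps that occur are shorter than `v`, so the induction hypothesis replaces their
      -- coproducts by Goncharov's formula.
      rw [selSumOp_congr (letterOpLeft_nil r) (some r) hi hv none, ← hX] at e1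
      -- The resulting sum over nested subsequences is rearranged so that the recursion sits inside,
      -- in the left tensor factor.
      have e2 : selSumOp (letterOpLeft r) (formalComul B) none v (some r) = _ :=
        selSumOp_assoc (letterOpLeft r) (fun a u s => formalI B a u s ⊗ₜ[ℚ] 1)
        (fun a u s => 1 ⊗ₜ[ℚ] formalI B a u s) (fun l _ _ _ y => letterOpLeft_tmul_mul r l _ y)
        none v (some r)
      -- The inner sums are again values of `formalEnd`, up to the correction for the empty
      -- selection. Once summed, that correction gives `1 ⊗ formalEnd B v (some r)`, which accounts
      -- for the other half of the cocycle identity.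
      have e3 := selSumAt_congr_left (P := fun x => x.isSome)
        (fun a u s => (1 : Shuf (Polygon R)) ⊗ₜ[ℚ] formalI B a u s)
        (F := fun l => formalI B none l (some r) ⊗ₜ[ℚ] 1)
        (F' := fun l => selSumOp (letterOpLeft r) (fun a u s => formalI B a u s ⊗ₜ[ℚ] 1) none l
          (some r) + if l = [] then 1 else 0) (fun l hl => by
            rw [selSumOp_letterOpLeft, selSumOp_letterOp hl, formalI_none_left,
              TensorProduct.sub_tmul]
            split_ifs
            · rw [← Algebra.TensorProduct.one_def, sub_add_cancel]
            · rw [TensorProduct.zero_tmul, sub_zero, add_zero]) none hv (some r)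
      rw [selSumAt_add, selSumAt_counit_left, List.nil_append, formalI_none_left, ← e2] at e3
      rw [e0, map_add, e1, formalComul, e3, e0, TensorProduct.tmul_add]
      have e4 : Shuf.comulHom (if v = [] then (1 : Shuf (Polygon R)) else 0)
          = 1 ⊗ₜ if v = [] then (1 : Shuf (Polygon R)) else 0 := by
        split_ifs
        · rw [map_one]; rfl
        · rw [map_zero, TensorProduct.tmul_zero]
      rw [e4]
      abel

end Polygon

/-! ## The elements `B(π)` are algebraically independent -/

namespace Polygon

variable {R : Type*}

theorem region_empty (π : Polygon R) : π.region ∅ (rootArrow π.weight) = π := by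
  have hr : regionSides ∅ (rootArrow π.weight) = Finset.range π.weight := by
    rw [regionSides, Finset.filter_true_of_mem (by simp), Arrow.cut_rootArrow]
  obtain ⟨e1, e2⟩ := π.region_sides_eq (D := ∅) (α := rootArrow π.weight)
    (by rw [hr]; exact Finset.nonempty_range_iff.mpr π.weight_pos.ne')
  refine ext_sides_root ?_ (e2.trans π.deco_weight)
  rw [e1, if_neg (by simp only [rootArrow, Arrow.IsBackward]; omega), hr, Finset.sort_range]
  apply List.ext_getElem
  · simp [weight]
  · intro i h1 h2
    simp only [List.getElem_map, List.getElem_range, deco]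
    simp [h2]

/-- Every arrow of a dissection cuts off at least one side, which is then missing from the root
region. -/
theorem weight_region_lt (π : Polygon R) {D : Finset Arrow} (hD : D ∈ dissections π.weight)
    (hne : D.Nonempty) : (π.region D (rootArrow π.weight)).weight < π.weight := by
  obtain ⟨e1, -⟩ := π.region_sides_eq
    (regionSides_nonempty π.weight_pos hD (Finset.mem_insert_self _ _))
  rw [if_neg (by simp only [rootArrow, Arrow.IsBackward]; omega)] at e1
  have e2 : (π.region D (rootArrow π.weight)).weight
      = (regionSides D (rootArrow π.weight)).card := by
    rw [weight, e1, List.length_map, Finset.length_sort]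
  rw [e2]
  conv_rhs => rw [← Finset.card_range π.weight]
  refine Finset.card_lt_card ⟨regionSides_subset_range π.weight_pos hD (Finset.mem_insert_self _ _),
    fun hs => ?_⟩
  obtain ⟨β, hβ⟩ := hne
  have hbox := insert_rootArrow_subset π.weight_pos hD (Finset.mem_insert_of_mem hβ)
  have := mem_boxArrows.mp hbox
  obtain ⟨i, hi⟩ := Arrow.cut_nonempty this.2.1 this.2.2
  exact (Finset.mem_filter.mp (hs (Arrow.cut_subset_range hbox hi))).2 β hβ
    (below_rootArrow_of_mem_dissections hD hβ) hi

theorem empty_mem_dissections (n : ℕ) : ∅ ∈ dissections n := by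
  rw [dissections, Finset.mem_filter]
  simp

open Classical in
-- The first letters of `B(π)` are the polygons of root regions: `π` itself for the empty
-- dissection, and polygons of smaller weight otherwise. This is the triangularity behind algebraic
-- independence.
theorem headL_B {π π₀ : Polygon R} (h : π.weight ≤ π₀.weight) :
    Shuf.headL π₀ π.B = if π = π₀ then 1 else 0 := by
  rw [B_eq_consL, map_sum, Finset.sum_eq_single_of_mem ∅ (empty_mem_dissections _)]
  · rw [region_empty, term_empty, Shuf.headL_consL]
  · intro D hD hne
    rw [Shuf.headL_consL, if_neg]
    rintro rfl
    exact absurd h (not_le.mpr (π.weight_region_lt hD (Finset.nonempty_iff_ne_empty.mpr hne)))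

/-- Both sides are derivations of the polynomial ring with values in the shuffle algebra, and they
agree on the variables occurring in `p`. -/
theorem headL_aeval_B (π₀ : Polygon R) {p : MvPolynomial (Polygon R) ℚ}
    (h : ∀ π ∈ p.vars, π.weight ≤ π₀.weight) :
    Shuf.headL π₀ (MvPolynomial.aeval B p)
      = MvPolynomial.aeval B (MvPolynomial.pderiv π₀ p) := by
  classical
  -- The shuffle algebra is a module over the polynomial ring through evaluation at the `B(π)`, so
  -- that both maps become derivations into it.
  let _ : Module (MvPolynomial (Polygon R) ℚ) (Shuf (Polygon R)) :=
    Module.compHom _ (MvPolynomial.aeval (R := ℚ) (B (R := R))).toRingHom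
  have hsmul : ∀ (q : MvPolynomial (Polygon R) ℚ) (x : Shuf (Polygon R)),
      q • x = MvPolynomial.aeval B q * x := fun _ _ => rfl
  let d₁ : Derivation ℚ (MvPolynomial (Polygon R) ℚ) (Shuf (Polygon R)) :=
    { (Shuf.headL π₀).comp (MvPolynomial.aeval (R := ℚ) (B (R := R))).toLinearMap with
      map_one_eq_zero' := by
        change Shuf.headL π₀ (MvPolynomial.aeval B 1) = 0
        rw [map_one, Shuf.headL_one]
      leibniz' := fun q q' => by
        change Shuf.headL π₀ (MvPolynomial.aeval B (q * q')) = _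
        rw [map_mul, Shuf.headL_mul]
        rfl }
  let d₂ : Derivation ℚ (MvPolynomial (Polygon R) ℚ) (Shuf (Polygon R)) :=
    { (MvPolynomial.aeval (R := ℚ) (B (R := R))).toLinearMap.comp
        (MvPolynomial.pderiv (R := ℚ) π₀).toLinearMap with
      map_one_eq_zero' := by
        change MvPolynomial.aeval B (MvPolynomial.pderiv π₀ 1) = 0
        rw [MvPolynomial.pderiv_one, map_zero]
      leibniz' := fun q q' => by
        change MvPolynomial.aeval B (MvPolynomial.pderiv π₀ (q * q')) = _
        rw [Derivation.leibniz, map_add, smul_eq_mul, smul_eq_mul, map_mul, map_mul]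
        rfl }
  refine MvPolynomial.derivation_eq_of_forall_mem_vars (D₁ := d₁) (D₂ := d₂) fun π hπ => ?_
  change Shuf.headL π₀ (MvPolynomial.aeval B (MvPolynomial.X π))
    = MvPolynomial.aeval B (MvPolynomial.pderiv π₀ (MvPolynomial.X π))
  rw [MvPolynomial.aeval_X, headL_B (h π hπ), MvPolynomial.pderiv_X, Pi.single_apply]
  split_ifs <;> simp

/-- Induction on the degree of a relation: its derivative in a variable `π₀` of maximal weight is
again a relation, hence zero, whereas in characteristic zero a variable that occurs gives a non-zero
derivative. -/
theorem algebraicIndependent_B : AlgebraicIndependent ℚ (B (R := R)) := by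
  rw [algebraicIndependent_iff]
  intro p hp
  obtain ⟨n, hn⟩ : ∃ n, p.totalDegree < n := ⟨_, Nat.lt_succ_self _⟩
  induction n generalizing p with
  | zero => exact absurd hn (Nat.not_lt_zero _)
  | succ n ih =>
    rcases p.vars.eq_empty_or_nonempty with hv | hv
    · obtain ⟨c, rfl⟩ : ∃ c, p = MvPolynomial.C c :=
        ⟨_, MvPolynomial.vars_eq_empty_iff_eq_C.mp hv⟩
      rw [MvPolynomial.aeval_C] at hp
      -- The counit recovers the constant.
      have := congrArg Shuf.counitHom hp
      rw [AlgHom.commutes, map_zero] at this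
      rw [show c = 0 from this, map_zero]
    · exfalso
      obtain ⟨π₀, hπ₀, hmax⟩ := p.vars.exists_max_image weight hv
      obtain ⟨m, hm, hm0⟩ := (MvPolynomial.mem_vars_iff_mem_support π₀).mp hπ₀
      rw [Finsupp.mem_support_iff] at hm0
      have hms : m - Finsupp.single π₀ 1 + Finsupp.single π₀ 1 = m :=
        tsub_add_cancel_of_le (Finsupp.single_le_iff.mpr (Nat.one_le_iff_ne_zero.mpr hm0))
      have hdeg : ∀ m' ∈ p.support, (m'.sum fun _ e => e) ≤ n := fun m' hm' =>
        Nat.lt_succ_iff.mp ((MvPolynomial.le_totalDegree hm').trans_lt hn)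
      have hsum : ∀ m' : Polygon R →₀ ℕ, ((m' + Finsupp.single π₀ 1).sum fun _ e => e)
          = (m'.sum fun _ e => e) + 1 := by
        intro m'
        rw [Finsupp.sum_add_index' (fun _ => rfl) (fun _ _ _ => rfl), Finsupp.sum_single_index rfl]
      have hq := headL_aeval_B π₀ hmax
      rw [hp, map_zero] at hq
      have hq0 := ih _ hq.symm (by
        have hn0 : 0 < n := by
          have := hdeg m hm
          rw [← hms, hsum] at this
          omega
        rw [MvPolynomial.totalDegree, Finset.sup_lt_iff (by simpa using hn0)]
        intro m' hm'
        rw [MvPolynomial.mem_support_iff, MvPolynomial.coeff_pderiv] at hm'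
        have := hdeg _ (MvPolynomial.mem_support_iff.mpr (left_ne_zero_of_mul hm'))
        rw [hsum] at this
        omega)
      -- The monomial `m` contains `π₀`. Lowering its exponent by one picks out the coefficient of
      -- `m` in `p` times a positive integer.
      have hc := congrArg (MvPolynomial.coeff (m - Finsupp.single π₀ 1)) hq0
      rw [MvPolynomial.coeff_pderiv, hms, MvPolynomial.coeff_zero] at hc
      refine (mul_ne_zero (MvPolynomial.mem_support_iff.mp hm) ?_) hc
      exact Nat.cast_add_one_ne_zero _

/-- `cocycleAlgebra R` is the polynomial algebra on the `B(π)`. -/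
def cocycleEquiv (R : Type*) : MvPolynomial (Polygon R) ℚ ≃ₐ[ℚ] cocycleAlgebra R :=
  (algebraicIndependent_B (R := R)).aevalEquiv

theorem cocycleEquiv_X (π : Polygon R) : cocycleEquiv R (MvPolynomial.X π) = π.cocycle :=
  Subtype.ext (by
    rw [cocycleEquiv]
    exact ((algebraicIndependent_B (R := R)).algebraMap_aevalEquiv _).trans
      (MvPolynomial.aeval_X _ _))

theorem cocycleAlgebra_hom_ext {Y : Type*} [Semiring Y] [Algebra ℚ Y]
    {f g : cocycleAlgebra R →ₐ[ℚ] Y} (h : ∀ π : Polygon R, f π.cocycle = g π.cocycle) : f = g := by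
  have h' : f.comp (cocycleEquiv R).toAlgHom = g.comp (cocycleEquiv R).toAlgHom :=
    MvPolynomial.algHom_ext fun π => by
      change f (cocycleEquiv R (MvPolynomial.X π)) = g (cocycleEquiv R (MvPolynomial.X π))
      rw [cocycleEquiv_X]; exact h π
  refine AlgHom.ext fun x => ?_
  obtain ⟨p, rfl⟩ := (cocycleEquiv R).surjective x
  exact DFunLike.congr_fun h' p

/-- The algebra map with given values on the `B(π)`. -/
def cocycleLift {Y : Type*} [CommRing Y] [Algebra ℚ Y] (b : Polygon R → Y) :
    cocycleAlgebra R →ₐ[ℚ] Y :=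
  (MvPolynomial.aeval b).comp (cocycleEquiv R).symm.toAlgHom

theorem cocycleLift_cocycle {Y : Type*} [CommRing Y] [Algebra ℚ Y] (b : Polygon R → Y)
    (π : Polygon R) : cocycleLift b π.cocycle = b π := by
  rw [← cocycleEquiv_X]
  change MvPolynomial.aeval b ((cocycleEquiv R).symm (cocycleEquiv R (MvPolynomial.X π))) = b π
  rw [AlgEquiv.symm_apply_apply, MvPolynomial.aeval_X]

/-! ### The coalgebra structure -/

theorem formalEnd_sides {Y : Type*} [CommRing Y] (b : Polygon R → Y) (π : Polygon R) :
    formalEnd b (π.sides.map some) (some π.root) = b π := by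
  rw [formalEnd, dif_neg (by simpa using π.sides_ne)]
  congr 1
  refine ext_sides_root ?_ rfl
  simp [Function.comp_def]

/-- The coproduct of `cocycleAlgebra R`. -/
def cocycleComul (R : Type*) :
    cocycleAlgebra R →ₐ[ℚ] cocycleAlgebra R ⊗[ℚ] cocycleAlgebra R :=
  cocycleLift fun π => formalComul cocycle none (π.sides.map some) (some π.root)

/-- Both sides are algebra maps, so it is enough to compare them on the `B(π)`, where Goncharov's
formula shows that the deconcatenation only involves elements of the subalgebra. -/
theorem map_val_cocycleComul :
    (Algebra.TensorProduct.map (cocycleAlgebra R).val (cocycleAlgebra R).val).comp (cocycleComul R)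
      = Shuf.comulHom.comp (cocycleAlgebra R).val := by
  refine cocycleAlgebra_hom_ext fun π => ?_
  change Algebra.TensorProduct.map _ _ (cocycleComul R π.cocycle) = Shuf.comulHom π.B
  rw [cocycleComul, cocycleLift_cocycle, map_formalComul, ← formalEnd_sides B π, comul_formalEnd]
  · rfl
  · simp

end Polygon

/-- A subspace of a coalgebra to which the coproduct restricts is a coalgebra. -/
abbrev coalgebraOfInjective {A C : Type*} [AddCommGroup A] [Module ℚ A] [AddCommGroup C]
    [Module ℚ C] [Coalgebra ℚ C] (v : A →ₗ[ℚ] C) (hv : Function.Injective v)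
    (δ : A →ₗ[ℚ] A ⊗[ℚ] A) (hδ : TensorProduct.map v v ∘ₗ δ = Coalgebra.comul ∘ₗ v) :
    Coalgebra ℚ A where
  comul := δ
  counit := Coalgebra.counit ∘ₗ v
  coassoc := by
    -- Everything is flat over `ℚ`, so the triple tensor power of the inclusion stays injective and
    -- coassociativity may be checked in the ambient coalgebra.
    have hinj : Function.Injective (TensorProduct.map v (TensorProduct.map v v)) :=
      TensorProduct.map_injective_of_flat_flat _ _ hv
        (TensorProduct.map_injective_of_flat_flat _ _ hv hv)
    refine LinearMap.ext fun x => hinj ?_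
    have h1 : TensorProduct.map v (TensorProduct.map v v) ∘ₗ
        (TensorProduct.assoc ℚ A A A).toLinearMap ∘ₗ δ.rTensor A
        = (TensorProduct.assoc ℚ C C C).toLinearMap ∘ₗ
          (Coalgebra.comul (R := ℚ) (A := C)).rTensor C ∘ₗ TensorProduct.map v v := by
      rw [← LinearMap.comp_assoc, TensorProduct.map_map_comp_assoc_eq, LinearMap.comp_assoc,
        LinearMap.rTensor, LinearMap.rTensor, ← TensorProduct.map_comp, ← TensorProduct.map_comp,
        hδ]
      rfl
    have h2 : TensorProduct.map v (TensorProduct.map v v) ∘ₗ δ.lTensor A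
        = (Coalgebra.comul (R := ℚ) (A := C)).lTensor C ∘ₗ TensorProduct.map v v := by
      rw [LinearMap.lTensor, LinearMap.lTensor, ← TensorProduct.map_comp, ← TensorProduct.map_comp,
        hδ]
      rfl
    have e1 := DFunLike.congr_fun h1 (δ x)
    have e2 := DFunLike.congr_fun h2 (δ x)
    have e3 := DFunLike.congr_fun hδ x
    simp only [LinearMap.comp_apply] at e1 e2 e3 ⊢
    rw [e1, e2, e3]
    exact Coalgebra.coassoc_apply (R := ℚ) (v x)
  rTensor_counit_comp_comul := by
    have hinj : Function.Injective (TensorProduct.map (LinearMap.id (R := ℚ) (M := ℚ)) v) :=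
      TensorProduct.map_injective_of_flat_flat _ _ Function.injective_id hv
    refine LinearMap.ext fun x => hinj ?_
    have h1 : TensorProduct.map LinearMap.id v ∘ₗ
        (Coalgebra.counit (R := ℚ) (A := C) ∘ₗ v).rTensor A
        = (Coalgebra.counit (R := ℚ) (A := C)).rTensor C ∘ₗ TensorProduct.map v v := by
      rw [LinearMap.rTensor, LinearMap.rTensor, ← TensorProduct.map_comp, ← TensorProduct.map_comp]
      rfl
    have e1 := DFunLike.congr_fun h1 (δ x)
    have e3 := DFunLike.congr_fun hδ x
    simp only [LinearMap.comp_apply] at e1 e3 ⊢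
    rw [e1, e3, Coalgebra.rTensor_counit_comul]
    simp
  lTensor_counit_comp_comul := by
    have hinj : Function.Injective (TensorProduct.map v (LinearMap.id (R := ℚ) (M := ℚ))) :=
      TensorProduct.map_injective_of_flat_flat _ _ hv Function.injective_id
    refine LinearMap.ext fun x => hinj ?_
    have h1 : TensorProduct.map v LinearMap.id ∘ₗ
        (Coalgebra.counit (R := ℚ) (A := C) ∘ₗ v).lTensor A
        = (Coalgebra.counit (R := ℚ) (A := C)).lTensor C ∘ₗ TensorProduct.map v v := by
      rw [LinearMap.lTensor, LinearMap.lTensor, ← TensorProduct.map_comp, ← TensorProduct.map_comp]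
      rfl
    have e1 := DFunLike.congr_fun h1 (δ x)
    have e3 := DFunLike.congr_fun hδ x
    simp only [LinearMap.comp_apply] at e1 e3 ⊢
    rw [e1, e3, Coalgebra.lTensor_counit_comul]
    simp

namespace Polygon

variable {R : Type*}

/-- The coalgebra structure on `cocycleAlgebra R` for which its inclusion is a map of coalgebras. -/
abbrev cocycleCoalgebra (R : Type*) : Coalgebra ℚ (cocycleAlgebra R) :=
  coalgebraOfInjective (cocycleAlgebra R).val.toLinearMap Subtype.val_injective
    (cocycleComul R).toLinearMap
    (LinearMap.ext fun x => DFunLike.congr_fun map_val_cocycleComul x)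

theorem counitL_B (π : Polygon R) : Shuf.counitL π.B = 0 := by
  rw [B_eq_consL, map_sum]
  exact Finset.sum_eq_zero fun D _ => Shuf.counitL_consL _ _

end Polygon

/-! ## Comparison with formal iterated integrals -/

section Comparison

variable {S : Type*}

theorem splits_map {S' : Type*} (f : S' → S) (w : List S') :
    splits (w.map f)
      = (splits w).map fun p => (p.1.map f, p.2.map fun q => (f q.1, q.2.map f)) := by
  induction w with
  | nil => rfl
  | cons x w ih => simp [splits, ih, Function.comp_def]

theorem gapProd_map {S' X : Type*} [CommRing X] (f : S' → S) (g : S → List S → S → X) (a : S')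
    (u : List S') (m : List (S' × List S')) (b : S') :
    gapProd g (f a) (u.map f) (m.map fun q => (f q.1, q.2.map f)) (f b)
      = gapProd (fun a u b => g (f a) (u.map f) (f b)) a u m b := by
  induction m generalizing a u with
  | nil => rfl
  | cons q m ih => simp only [List.map_cons, gapProd, ih]

namespace IterInt

open Classical in
-- Compose a loop on a non-empty word through its own base point. By induction only the two terms
-- with an empty part survive, each equal to the loop itself; thus `I = I + I` and the loop
-- vanishes.
theorem I_loop (a : S) (w : List S) : I a w a = if w = [] then 1 else 0 := by
  obtain ⟨n, hn⟩ : ∃ n, w.length = n := ⟨_, rfl⟩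
  induction n using Nat.strong_induction_on generalizing w with
  | _ n ih =>
    cases w with
    | nil => rw [I_nil, if_pos rfl]
    | cons x w =>
      have h := I_path a a a (x :: w)
      have h' : cutSum (fun u v => I a (x :: u) a * I a v a) w = I a (x :: w) a := by
        rw [← cutSum_mul_delta (fun u => I a (x :: u) a) w]
        refine cutSum_congr fun u v huv => ?_
        rw [ih v.length (by rw [← hn, ← huv, List.length_cons, List.length_append]; omega) v rfl]
      rw [cutSum_cons, I_nil, one_mul, h'] at h
      rw [if_neg (List.cons_ne_nil _ _)]
      exact left_eq_add.mp h

variable (o : S) {R : Set S}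

/-- The iterated integral attached to a polygon. -/
def ofPolygon (π : Polygon R) : IterInt S := I o (π.sides.map Subtype.val) π.root

/-- The inclusion of the decorations, with the base point added. -/
def baseMap (x : Option R) : S := x.elim o Subtype.val

theorem map_baseMap {w : List (Option R)} (hw : ∀ x ∈ w, x.isSome) (r : R) :
    (w.map (·.getD r)).map Subtype.val = w.map (baseMap o) := by
  rw [List.map_map]
  refine List.map_congr_left fun x hx => ?_
  obtain ⟨y, rfl⟩ := Option.isSome_iff_exists.mp (hw x hx)
  rfl

/-- Paths ending at the base point are the only case where something is at stake: the value
prescribed in `formalEnd` is the true one by `I_loop`. -/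
theorem formalEnd_ofPolygon {w : List (Option R)} (hw : ∀ x ∈ w, x.isSome) (s : Option R) :
    formalEnd (ofPolygon o) w s = I o (w.map (baseMap o)) (baseMap o s) := by
  cases s with
  | none =>
    change _ = I o (w.map (baseMap o)) o
    rw [formalEnd, I_loop]
    by_cases h : w = [] <;> simp [h]
  | some r =>
    by_cases h : w = []
    · subst h
      rw [formalEnd_nil, List.map_nil, I_nil]
    · rw [formalEnd, dif_neg h, ofPolygon]
      simp only
      rw [map_baseMap o hw]
      rfl

/-- True iterated integrals satisfy path composition through the distinguished point and inversion,
and these two rules express them through integrals starting there exactly as in the definition of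
`formalI`. -/
theorem formalI_ofPolygon (a : Option R) {w : List (Option R)} (hw : ∀ x ∈ w, x.isSome)
    (s : Option R) :
    formalI (ofPolygon o) a w s = I (baseMap o a) (w.map (baseMap o)) (baseMap o s) := by
  have hmap : ∀ φ : List S → List S → IterInt S, cutSum φ (w.map (baseMap o))
      = cutSum (fun u v => φ (u.map (baseMap o)) (v.map (baseMap o))) w := by
    intro φ
    simp [cutSum, List.map_take, List.map_drop]
  rw [I_path _ _ o, hmap, formalI]
  refine cutSum_congr fun u v huv => ?_
  have hu : ∀ x ∈ u.reverse, x.isSome := fun x hx =>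
    hw x (huv ▸ List.mem_append_left v (List.mem_reverse.mp hx))
  have hv : ∀ x ∈ v, x.isSome := fun x hx => hw x (huv ▸ List.mem_append_right u hx)
  rw [formalEnd_ofPolygon o hu, formalEnd_ofPolygon o hv, List.map_reverse, I_reverse,
    List.length_map, ← mul_assoc, ← mul_pow]
  simp

/-- Both are sums over the same subsequences, compared term by term. All letters of `w` come from
`R`, so the dictionary `formalI_ofPolygon` applies to every gap and every selection. -/
theorem comulI_eq_formalComul {w : List (Option R)} (hw : ∀ x ∈ w, x.isSome) (r : R) :
    comulI o (w.map (baseMap o)) r = formalComul (ofPolygon o) none w (some r) := by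
  rw [comulI, formalComul, selSumAt_eq (fun a u s => 1 ⊗ₜ[ℚ] formalI (ofPolygon o) a u s),
    splits_map, List.map_map]
  congr 1
  refine List.map_congr_left fun p hp => ?_
  have hp' := mem_of_mem_splits hp
  have h1 : gapProd I o (p.1.map (baseMap o))
      (p.2.map fun q => (baseMap o q.1, q.2.map (baseMap o))) (r : S)
      = gapProd (formalI (ofPolygon o)) none p.1 p.2 (some r) := by
    rw [gapProd_congr (some r) (fun a u s hu => formalI_ofPolygon o a hu s) hw none hp]
    exact gapProd_map (baseMap o) I none p.1 p.2 (some r)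
  have h2 : (1 : IterInt S) ⊗ₜ[ℚ] gapProd (formalI (ofPolygon o)) none p.1 p.2 (some r)
      = gapProd (fun a u s => 1 ⊗ₜ[ℚ] formalI (ofPolygon o) a u s) none p.1 p.2 (some r) :=
    map_gapProd (Algebra.TensorProduct.includeRight : IterInt S →ₐ[ℚ] IterInt S ⊗[ℚ] IterInt S)
      (formalI (ofPolygon o)) none p.1 p.2 (some r)
  have h3 : ∀ x ∈ p.2.map Prod.fst, x.isSome := by
    intro x hx
    obtain ⟨q, hq, rfl⟩ := List.mem_map.mp hx
    exact hw _ (hp'.2 q hq).1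
  rw [List.nil_append, ← h2, Algebra.TensorProduct.tmul_mul_tmul, one_mul, mul_one,
    formalI_ofPolygon o none h3, ← h1]
  simp only [Function.comp_apply, List.map_map]
  rfl

end IterInt

end Comparison

end PolyBar

end

/-! ### The theorem: all compatibilities are checked on the free generators `B(π)`. -/

theorem mainTheorem9 {S : Type*} (o : S) (R : Set S) :
    ∃ _ : Coalgebra ℚ (PolyBar.Polygon.cocycleAlgebra R),
      (∀ x : PolyBar.Polygon.cocycleAlgebra R,
        TensorProduct.map (PolyBar.Polygon.cocycleAlgebra R).val.toLinearMap
            (PolyBar.Polygon.cocycleAlgebra R).val.toLinearMap (Coalgebra.comul (R := ℚ) x)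
          = Coalgebra.comul (R := ℚ) (x : PolyBar.Shuf (PolyBar.Polygon R))) ∧
      (∀ x : PolyBar.Polygon.cocycleAlgebra R, Coalgebra.counit (R := ℚ) x
          = Coalgebra.counit (R := ℚ) (x : PolyBar.Shuf (PolyBar.Polygon R))) ∧
      ∃! φ : PolyBar.Polygon.cocycleAlgebra R →ₐ[ℚ] PolyBar.IterInt S,
        (∀ π : PolyBar.Polygon R,
          φ π.cocycle = PolyBar.IterInt.I o (π.sides.map Subtype.val) π.root) ∧
        (∀ x : PolyBar.Polygon.cocycleAlgebra R, Coalgebra.comul (R := ℚ) (φ x)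
          = TensorProduct.map φ.toLinearMap φ.toLinearMap (Coalgebra.comul (R := ℚ) x)) ∧
        ∀ x : PolyBar.Polygon.cocycleAlgebra R,
          Coalgebra.counit (R := ℚ) (φ x) = Coalgebra.counit (R := ℚ) x := by
  refine ⟨PolyBar.Polygon.cocycleCoalgebra R,
    fun x => DFunLike.congr_fun PolyBar.Polygon.map_val_cocycleComul x, fun x => rfl,
    PolyBar.Polygon.cocycleLift (PolyBar.IterInt.ofPolygon o), ⟨?_, ?_, ?_⟩, ?_⟩
  · exact fun π => PolyBar.Polygon.cocycleLift_cocycle _ π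
  · intro x
    -- On generators both sides are Goncharov's formula for the family of integrals attached to
    -- polygons, because `formalComul` is natural in that family.
    have h : PolyBar.IterInt.comulHom.comp
          (PolyBar.Polygon.cocycleLift (PolyBar.IterInt.ofPolygon o))
        = (Algebra.TensorProduct.map
            (PolyBar.Polygon.cocycleLift (PolyBar.IterInt.ofPolygon (R := R) o))
            (PolyBar.Polygon.cocycleLift (PolyBar.IterInt.ofPolygon o))).comp
          (PolyBar.Polygon.cocycleComul R) := by
      refine PolyBar.Polygon.cocycleAlgebra_hom_ext fun π => ?_
      rw [AlgHom.comp_apply, AlgHom.comp_apply, PolyBar.Polygon.cocycleLift_cocycle,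
        PolyBar.Polygon.cocycleComul, PolyBar.Polygon.cocycleLift_cocycle,
        PolyBar.map_formalComul, PolyBar.IterInt.ofPolygon, PolyBar.IterInt.comulHom_I]
      have := PolyBar.IterInt.comulI_eq_formalComul o (w := π.sides.map some) (fun x hx => by
        obtain ⟨y, -, rfl⟩ := List.mem_map.mp hx; rfl) π.root
      rw [List.map_map] at this
      refine this.trans (congrArg (fun b => PolyBar.formalComul b _ _ _) ?_)
      funext π
      exact (PolyBar.Polygon.cocycleLift_cocycle _ π).symm
    exact DFunLike.congr_fun h x
  · intro x
    -- Both counits vanish on generators: every word in `B(π)` begins with the polygon of a root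
    -- region, and a polygon has at least one non-root side.
    have h : PolyBar.IterInt.counitHom.comp
          (PolyBar.Polygon.cocycleLift (PolyBar.IterInt.ofPolygon (R := R) o))
        = PolyBar.Shuf.counitHom.comp (PolyBar.Polygon.cocycleAlgebra R).val := by
      refine PolyBar.Polygon.cocycleAlgebra_hom_ext fun π => ?_
      rw [AlgHom.comp_apply, PolyBar.Polygon.cocycleLift_cocycle, PolyBar.IterInt.ofPolygon,
        PolyBar.IterInt.counitHom_I, if_neg (mt List.map_eq_nil_iff.mp π.sides_ne)]
      exact π.counitL_B.symm
    exact DFunLike.congr_fun h x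
  · rintro ψ ⟨hψ, -, -⟩
    refine PolyBar.Polygon.cocycleAlgebra_hom_ext fun π => ?_
    rw [hψ, PolyBar.Polygon.cocycleLift_cocycle, PolyBar.IterInt.ofPolygon]
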